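/- **Theorem (Paley–Kesten–McKay relation).** *Definitions.* For $0<\gamma<1$ let $A_1=\dfrac{2-\gamma^{-1}}{2\sqrt{\gamma^{-1}-1}}$, $A_2=1$ and $A_{s+1}=-\sum_{i=1}^{s}A_iA_{s+1-i}$ for $s\ge 2$. For $1\le t\le r$ let $\Pi(r,t)$ be the set of partitions of $\{1,\dots,r\}$ into $t$ blocks. The graph $G(\pi)$ of $\pi\in\Pi(r,t)$ has the blocks of $\pi$ as vertices and $r$ edges, the $e$-th one going from the block of $e$ to the block of $e+1$ (cyclically, $r\to 1$). If $\pi$ is non-crossing then $G(\pi)$ is a cactus, and $V^*(\pi,\gamma)=\prod_{C}A_{|C|}$, the product over the cycles $C$ of $G(\pi)$ (loops included), where $|C|$ is the length of $C$; if $\pi$ is crossing then $V^*(\pi,\gamma)=0$. For $0<p<1$ and $r\ge 1$ put $$m^{\rm central}_r(\gamma,p)=\sum_{t=1}^{r}\Bigl(\sum_{\pi\in\Pi(r,t)}V^*(\pi,\gamma)\Bigr)p^t,$$ $$m^*_r(\gamma,p)=\Bigl(\frac{\gamma^{-1}}{2}\Bigr)^r p+\sum_{j=1}^{r}\binom rj(\gamma^{-1}-1)^{j/2}\Bigl(\frac{\gamma^{-1}}{2}\Bigr)^{r-j}m^{\rm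 central}_j(\gamma,p).$$ For $v>1$ let $\mathrm{KM}_v$ be the Kesten–McKay distribution, with density $\dfrac{v\sqrt{4(v-1)-x^2}}{2\pi(v^2-x^2)}$ on $|x|\le 2\sqrt{v-1}$ and atoms of mass $(1-v/2)^+$ at $\pm v$ (absent if $v\ge 2$), and, in the normalization of the frame moments below, let $$m^{\rm KM}_r(p)=p\int (px)^r\,d\mathrm{KM}_{1/p}(x).$$ With $x=\gamma^{-1}-1$ and $N_j(q)=\sum_{i=1}^{j}\frac1j\binom ji\binom j{i-1}q^i$, the $r$-th MANOVA moment is $$m^{\rm MANOVA}_r(\gamma,p)=p(x+1)^{r-1}-(1-p)^2\sum_{j=0}^{r-2}(1-p)^j(x+1)^{r-2-j}N_{j+1}\Bigl(x\frac p{1-p}\Bigr).$$ Wachter's MANOVA distribution $\mu_{\beta,\gamma}$ has density $\dfrac{\sqrt{(\lambda_+-x)(x-\lambda_-)}}{2\pi\beta x(1-\gamma x)}$ on $[\lambda_-,\lambda_+]$, $\lambda_\pm=\bigl(\sqrt{\beta(1-\gamma)}\pm\sqrt{1-\beta\gamma}\bigr)^2$, an atom of mass $\bigl(1+\frac1\beta-\frac1{\beta\gamma}\bigr)^+$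 at $1/\gamma$, and an atom of mass $(1-\frac1\beta)^+$ at $0$. An $m\times n$ real or complex matrix $F$ with columns $f_1,\dots,f_n$ is an equiangular tight frame (ETF) if there are constants $\nu,\rho\ge 0$ such that $|\langle f_i,f_j\rangle|=1$ for $i=j$ and $=\nu$ for $i\ne j$, and $FF^\dagger=\rho I_m$. *Statement.* Let $0<p<1$ and let $r\ge 1$ be an integer. Then: 1. $m^{\rm central}_r(\tfrac12,p)=m^{\rm KM}_r(p)$ (and the integral that defines the right-hand side converges absolutely). 2. $m^*_r(\tfrac12,p)=m^{\rm MANOVA}_r(\tfrac12,p)=p\displaystyle\int x^r\,d\mu_{2p,1/2}(x)$ (and the integral converges absolutely). 3. If $F_i$ ($i=1,2,\dots$) are $m_i\times n_i$ real, or complex, ETFs with $n_i\to\infty$ and $m_i/n_i\to\tfrac12$, and $P_i$ is the random diagonal $n_i\times n_i$ matrix whose diagonal entries are independent Bernoulli($p$) variables, then $$\frac1{n_i}\,\mathbb E\Bigl[\operatorname{tr}\bigl((F_iP_iF_i^\dagger)^r\bigr)\Bigr]\longrightarrow m^{\rm MANOVA}_r(\tfrac12,p)\qquad(i\to\infty).$$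 -/

import Mathlib

open MeasureTheory Filter
open scoped Topology Matrix

noncomputable section

namespace PaleyKM

/-! ### The recursive procedure -/

/-- The cycle values `A 1, A 2, A 3, …` attached to `γ`:
`A 1 = (2 - γ⁻¹) / (2 √(γ⁻¹ - 1))`, `A 2 = 1`, and, for `s ≥ 2`,
`A (s + 1) = - ∑_{i = 1}^{s} A i * A (s + 1 - i)`.
(The index `0` is not used. In the last clause `s = n + 2`, and the summation index is `i + 1`.) -/
def cycleValue (γ : ℝ) : ℕ → ℝ
  | 0 => 0
  | 1 => (2 - γ⁻¹) / (2 * √(γ⁻¹ - 1))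
  | 2 => 1
  | n + 3 => -∑ i : Fin (n + 2), cycleValue γ (i.val + 1) * cycleValue γ (n + 2 - i.val)
termination_by n => n
decreasing_by all_goals omega

/-- Partitions of the index set `Fin r = {0, …, r - 1}` into nonempty blocks. -/
abbrev SetPartition (r : ℕ) : Type := Finpartition (Finset.univ : Finset (Fin r))

/-- `π` is crossing: there are two blocks `A ≠ B` and elements `a₁ < b₁ < a₂ < b₂`
with `a₁, a₂ ∈ A` and `b₁, b₂ ∈ B`. -/
def IsCrossing {r : ℕ} (π : SetPartition r) : Prop :=
  ∃ A ∈ π.parts, ∃ B ∈ π.parts, A ≠ B ∧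
    ∃ a₁ ∈ A, ∃ a₂ ∈ A, ∃ b₁ ∈ B, ∃ b₂ ∈ B, a₁ < b₁ ∧ b₁ < a₂ ∧ a₂ < b₂

/-- The graph `G(π)` is the directed multigraph (loops allowed) whose vertices are the blocks of
`π` and whose edges are the elements `e` of `Fin r`; the edge `e` joins the block of `e` to the
block of the cyclic successor of `e`. This is the start vertex of the edge `e`. -/
def edgeSource {r : ℕ} (π : SetPartition r) (e : Fin r) : Finset (Fin r) := π.part e

/-- The end vertex of the edge `e` of `G(π)`; `finRotate r` is `e ↦ e + 1` modulo `r`. -/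
def edgeTarget {r : ℕ} (π : SetPartition r) (e : Fin r) : Finset (Fin r) :=
  π.part (finRotate r e)

/-- `C` is the edge set of a (simple, directed) cycle of `G(π)`: its edges can be listed as
`e 0, …, e (s - 1)`, `s ≥ 1`, so that each one ends where the (cyclically) next one starts, and no
vertex is visited twice. Loops are cycles with `s = 1`. -/
def IsCycleOf {r : ℕ} (π : SetPartition r) (C : Finset (Fin r)) : Prop :=
  ∃ (s : ℕ) (e : Fin s → Fin r), 0 < s ∧
    (∀ k, edgeTarget π (e k) = edgeSource π (e (finRotate s k))) ∧
    Function.Injective (fun k => edgeSource π (e k)) ∧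
    Finset.univ.image e = C

open Classical in
/-- The value `V*(π, γ)`: zero if `π` is crossing, and otherwise the product, over the cycles of
the cactus `G(π)`, of the values of their lengths. -/
def partitionValue (γ : ℝ) {r : ℕ} (π : SetPartition r) : ℝ :=
  if IsCrossing π then 0
  else ∏ C ∈ Finset.univ.filter (fun C : Finset (Fin r) => IsCycleOf π C), cycleValue γ C.card

open Classical in
/-- The centralized quantity `∑_{t = 1}^{r} (∑_{π ∈ Π(r, t)} V*(π, γ)) p ^ t`, where `Π(r, t)` is
the set of partitions into `t` blocks. -/
def mCentral (γ p : ℝ) (r : ℕ) : ℝ :=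
  ∑ t ∈ Finset.Icc 1 r,
    (∑ π ∈ Finset.univ.filter (fun π : SetPartition r => π.parts.card = t),
      partitionValue γ π) * p ^ t

/-- The decentralized quantity
`(γ⁻¹ / 2) ^ r p + ∑_{j = 1}^{r} (r choose j) (γ⁻¹ - 1) ^ (j / 2) (γ⁻¹ / 2) ^ (r - j) mCentral j`. -/
def mStar (γ p : ℝ) (r : ℕ) : ℝ :=
  (γ⁻¹ / 2) ^ r * p +
    ∑ j ∈ Finset.Icc 1 r, (r.choose j : ℝ) *
      ((γ⁻¹ - 1) ^ ((j : ℝ) / 2) * (γ⁻¹ / 2) ^ (r - j) * mCentral γ p j)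

/-! ### The Kesten–McKay distribution -/

/-- The Kesten–McKay distribution with parameter `v > 1`: density
`v √(4(v-1) - x²) / (2π (v² - x²))` on `|x| ≤ 2 √(v-1)` and, if `v < 2`, atoms of mass `1 - v/2` at
`v` and at `-v` (there are no atoms if `v ≥ 2`). -/
def kestenMcKay (v : ℝ) : Measure ℝ :=
  volume.withDensity (fun x => ENNReal.ofReal
      ((Set.Icc (-(2 * √(v - 1))) (2 * √(v - 1))).indicator
        (fun x => v * √(4 * (v - 1) - x ^ 2) / (2 * Real.pi * (v ^ 2 - x ^ 2))) x))
    + ENNReal.ofReal (1 - v / 2) • (Measure.dirac v + Measure.dirac (-v))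

/-- The `r`-th Kesten–McKay moment, in the normalization of the moments of random subsets of frames:
the parameter is `v = 1 / p`, the variable is scaled to `x / v = p x`, and the moment is multiplied
by the expected fraction `p` of selected vectors. -/
def mKestenMcKay (p : ℝ) (r : ℕ) : ℝ :=
  p * ∫ x, (p * x) ^ r ∂(kestenMcKay p⁻¹)

/-! ### The MANOVA distribution -/

/-- Wachter's asymptotic MANOVA distribution with parameters `β`, `γ`: with
`λ± = (√(β(1-γ)) ± √(1-βγ))²`, it has density `√((λ₊ - x)(x - λ₋)) / (2πβ x (1 - γx))` on
`[λ₋, λ₊]`, an atom of mass `(1 + 1/β - 1/(βγ))⁺` at `1/γ`, and an atom of mass `(1 - 1/β)⁺` at `0`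
(which is there only if `β > 1`). -/
def manovaMeasure (β γ : ℝ) : Measure ℝ :=
  volume.withDensity (fun x => ENNReal.ofReal
      ((Set.Icc ((√(β * (1 - γ)) - √(1 - β * γ)) ^ 2) ((√(β * (1 - γ)) + √(1 - β * γ)) ^ 2)).indicator
        (fun x => √(((√(β * (1 - γ)) + √(1 - β * γ)) ^ 2 - x) *
            (x - (√(β * (1 - γ)) - √(1 - β * γ)) ^ 2)) /
          (2 * β * Real.pi * x * (1 - γ * x))) x))
    + ENNReal.ofReal (1 + 1 / β - 1 / (β * γ)) • Measure.dirac (1 / γ)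
    + ENNReal.ofReal (1 - 1 / β) • Measure.dirac 0

/-- The Narayana polynomial `N_j(q) = ∑_{i = 1}^{j} (1 / j) (j choose i) (j choose (i - 1)) q ^ i`. -/
def narayanaPoly (j : ℕ) (q : ℝ) : ℝ :=
  ∑ i ∈ Finset.Icc 1 j, (1 / (j : ℝ)) * (j.choose i : ℝ) * (j.choose (i - 1) : ℝ) * q ^ i

/-- The `r`-th MANOVA moment, `r ≥ 1`, by its closed formula: with `x = 1 / γ - 1`,
`p (x+1)^(r-1) - (1-p)² ∑_{j = 0}^{r-2} (1-p)^j (x+1)^(r-2-j) N_{j+1}(x p / (1-p))`. -/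
def mManova (γ p : ℝ) (r : ℕ) : ℝ :=
  p * ((1 / γ - 1) + 1) ^ (r - 1)
    - (1 - p) ^ 2 * ∑ j ∈ Finset.range (r - 1),
        (1 - p) ^ j * ((1 / γ - 1) + 1) ^ (r - 2 - j) *
          narayanaPoly (j + 1) ((1 / γ - 1) * (p / (1 - p)))

/-! ### Random subsets of equiangular tight frames -/

/-- The columns of the `m × n` matrix `F` form an equiangular tight frame (with unit vectors): the
modulus of the inner product of columns `i` and `j` is `1` if `i = j` and a constant `ν ≥ 0` if
`i ≠ j`, and `F Fᴴ = ρ I` for a constant `ρ ≥ 0`. -/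
def IsETF {𝕜 : Type*} [RCLike 𝕜] {m n : ℕ} (F : Matrix (Fin m) (Fin n) 𝕜) : Prop :=
  ∃ ν ρ : ℝ, 0 ≤ ν ∧ 0 ≤ ρ ∧
    (∀ i j, ‖(Fᴴ * F) i j‖ = if i = j then 1 else ν) ∧
    F * Fᴴ = (ρ : 𝕜) • (1 : Matrix (Fin m) (Fin m) 𝕜)

/-- The selection matrix of the subset `S`: diagonal, with entry `1` at `i ∈ S` and `0` at
`i ∉ S`. -/
def selection (𝕜 : Type*) [RCLike 𝕜] {n : ℕ} (S : Finset (Fin n)) : Matrix (Fin n) (Fin n) 𝕜 :=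
  Matrix.diagonal (fun i => if i ∈ S then 1 else 0)

/-- The expected `r`-th moment `(1 / n) E[trace ((F P Fᴴ) ^ r)]` of a random subset of the frame `F`,
in which each vector is selected independently with probability `p`: the subset `S` is selected with
probability `p ^ |S| (1 - p) ^ (n - |S|)`. (The trace is real, since `F P Fᴴ` is Hermitian.) -/
def meanMoment {𝕜 : Type*} [RCLike 𝕜] {m n : ℕ} (F : Matrix (Fin m) (Fin n) 𝕜) (p : ℝ) (r : ℕ) : ℝ :=
  (1 / (n : ℝ)) * ∑ S : Finset (Fin n),
    p ^ S.card * (1 - p) ^ (n - S.card) *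
      RCLike.re (Matrix.trace ((F * selection 𝕜 S * Fᴴ) ^ r))

end PaleyKM

end

noncomputable section

namespace PaleyKM

/-! ### Moments of the semicircle -/

/-! Everything is compared with one sequence, `kmMoment p`: m_0 = p, m_1 = 0, m_j - m_(j+2) = s_j,
where s_j are the moments of the density √(4c - y²)/2π and c = p(1-p). Its binomial transform
`kmShiftedMoment` plays the same role for the decentralized quantities.

Kesten–McKay. In the variable y = px, and with total mass p, the density is √(4c - y²)/(2π(1 - y²)),
and the possible atoms sit at ±1. Multiplication by 1 - y² cancels the denominator and kills the
atoms, which is the recurrence; m_1 = 0 by symmetry, and m_0 comes from an explicit primitive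
(`integral_pow_mul_kmDensity`).

MANOVA. For γ = 1/2 and β = 2p the measure, times p, is the same one translated by 1, so its moments
are the binomial transform. The identity (X+1)^(r+2) = 2(X+1)^(r+1) - (1-X²)(X+1)^r turns the
recurrence of m into one for the transform, whose inhomogeneous term is a Narayana polynomial by its
gamma expansion (`narayanaPoly_gamma_expansion`). The closed formula is the solution of that
recurrence.

Partitions. At γ = 1/2 the cycle values have generating function A with A + A² = z². A noncrossing
partition is a closed walk on its blocks, and it is cut at the last return to the initial block. The
part before is again noncrossing; in the part after, the two edges at the cut vertex are merged into
one, so the cycle through the closing edge becomes one edge shorter. Recording this deficit k in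
`walkWeight` gives a recursion that unrolls to F - p = A(zF) for the generating function F of the
weights (with constant term p). Hence (F - p) + (F - p)² = (zF)². The series of `kmMoment p`
satisfies the same equation, which has only one solution with constant term p
(`eq_kmMoment_of_recursion`).

Frames. Let P be the selection matrix, D = P - p and S = F†F - 1. Then S² = (ρ-2)S + (ρ-1) with ρ →
2, so S is asymptotically a reflection. The mean normalized trace of (DS)^k tends to 0: in the sum
over closed walks the expectation vanishes unless every vertex is visited at least twice, and the
entries of S are O(n^(-1/2)). Together with the vanishing of the other alternating words this is
asymptotic freeness of P and S, to the extent needed here. The mixed words (PS)^j P (SD)^k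
correspond to the polynomials X^j `chainPoly p k`, and the limit functional is pinned down by
annihilating `chainPoly p k` for k ≥ 1. The functional of `kmMoment p` annihilates them because
Chebyshev polynomials of the second kind are orthogonal for the semicircle
(`momentFunctional_km_chainPoly`). -/

/-- The moments `∫ y ^ j √(4c - y²) dy / 2π` of the (unnormalized) semicircle. -/
def semicircleMoment (c : ℝ) (j : ℕ) : ℝ :=
  if Even j then c ^ (j / 2 + 1) * catalan (j / 2) else 0

lemma semicircleMoment_even (c : ℝ) (i : ℕ) :
    semicircleMoment c (2 * i) = c ^ (i + 1) * catalan i := by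
  simp [semicircleMoment]

lemma semicircleMoment_odd (c : ℝ) (i : ℕ) : semicircleMoment c (2 * i + 1) = 0 := by
  simp [semicircleMoment]

lemma add_two_mul_catalan_succ (i : ℕ) :
    ((i : ℝ) + 2) * catalan (i + 1) = 2 * (2 * i + 1) * catalan i := by
  have h1 := succ_mul_catalan_eq_centralBinom i
  have h2 := succ_mul_catalan_eq_centralBinom (i + 1)
  have h3 := Nat.succ_mul_centralBinom_succ i
  rw [← h1, ← h2] at h3
  have h4 : ((i : ℝ) + 1) * (((i : ℝ) + 1 + 1) * catalan (i + 1))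
      = 2 * (2 * i + 1) * (((i : ℝ) + 1) * catalan i) := by exact_mod_cast h3
  have h5 : (0 : ℝ) < i + 1 := by positivity
  have h6 : ((i : ℝ) + 1) * (((i : ℝ) + 2) * catalan (i + 1))
      = ((i : ℝ) + 1) * (2 * (2 * i + 1) * catalan i) := by linear_combination h4
  exact mul_left_cancel₀ h5.ne' h6

lemma integral_odd_interval {f : ℝ → ℝ} (hf : ∀ x, f (-x) = -f x) (a : ℝ) :
    ∫ x in -a..a, f x = 0 := by
  have h := intervalIntegral.integral_comp_neg (a := -a) (b := a) f
  simp only [hf, neg_neg, intervalIntegral.integral_neg] at h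
  linarith

lemma continuous_pow_mul_semicircle (a : ℝ) (j : ℕ) :
    Continuous fun y : ℝ => y ^ j * √(a ^ 2 - y ^ 2) := by fun_prop

lemma integral_semicircle_zero {a : ℝ} (ha : 0 < a) :
    ∫ y in -a..a, √(a ^ 2 - y ^ 2) = Real.pi * a ^ 2 / 2 := by
  have h := intervalIntegral.mul_integral_comp_mul_left (a := -1) (b := 1)
    (f := fun y => √(a ^ 2 - y ^ 2)) (c := a)
  simp only [mul_neg, mul_one] at h
  rw [← h]
  have h2 : ∀ x : ℝ, √(a ^ 2 - (a * x) ^ 2) = a * √(1 - x ^ 2) := by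
    intro x
    rw [show a ^ 2 - (a * x) ^ 2 = a ^ 2 * (1 - x ^ 2) by ring, Real.sqrt_mul (by positivity),
      Real.sqrt_sq ha.le]
  simp only [h2, intervalIntegral.integral_const_mul, integral_sqrt_one_sub_sq]
  ring

/-- The derivative of y^(j+1) (a² - y²)^(3/2) is (j+1)a² y^j √(a² - y²) - (j+4) y^(j+2) √(a² - y²),
and the function vanishes at ±a. -/
lemma integral_semicircle_add_two {a : ℝ} (ha : 0 < a) (j : ℕ) :
    ((j : ℝ) + 4) * ∫ y in -a..a, y ^ (j + 2) * √(a ^ 2 - y ^ 2)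
      = (j + 1) * a ^ 2 * ∫ y in -a..a, y ^ j * √(a ^ 2 - y ^ 2) := by
  have hint : ∀ i : ℕ, IntervalIntegrable (fun y : ℝ => y ^ i * √(a ^ 2 - y ^ 2)) volume (-a) a :=
    fun i => (continuous_pow_mul_semicircle a i).intervalIntegrable _ _
  have key : ∫ y in -a..a, (((j : ℝ) + 1) * a ^ 2 * (y ^ j * √(a ^ 2 - y ^ 2))
      - ((j : ℝ) + 4) * (y ^ (j + 2) * √(a ^ 2 - y ^ 2)))
      = (fun y : ℝ => y ^ (j + 1) * ((a ^ 2 - y ^ 2) * √(a ^ 2 - y ^ 2))) a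
        - (fun y : ℝ => y ^ (j + 1) * ((a ^ 2 - y ^ 2) * √(a ^ 2 - y ^ 2))) (-a) := by
    refine intervalIntegral.integral_eq_sub_of_hasDerivAt_of_le
      (f := fun y : ℝ => y ^ (j + 1) * ((a ^ 2 - y ^ 2) * √(a ^ 2 - y ^ 2))) (by linarith) ?_ ?_ ?_
    · exact Continuous.continuousOn (by fun_prop)
    · intro y hy
      have hpos : 0 < a ^ 2 - y ^ 2 := by nlinarith [hy.1, hy.2]
      have h1 : HasDerivAt (fun y : ℝ => a ^ 2 - y ^ 2) (-(2 * y)) y := by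
        simpa using ((hasDerivAt_pow 2 y).const_sub (a ^ 2))
      have h2 := (hasDerivAt_pow (j + 1) y).mul (h1.mul (h1.sqrt hpos.ne'))
      refine h2.congr_deriv ?_
      have hs : 0 < √(a ^ 2 - y ^ 2) := Real.sqrt_pos.2 hpos
      have hss : √(a ^ 2 - y ^ 2) ^ 2 = a ^ 2 - y ^ 2 := Real.sq_sqrt hpos.le
      simp only [Pi.mul_apply, Nat.add_sub_cancel]
      generalize √(a ^ 2 - y ^ 2) = t at *
      rw [← hss]
      have ha2 : a ^ 2 = t ^ 2 + y ^ 2 := by linarith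
      rw [ha2]
      push_cast
      field_simp
      ring
    · exact ((hint j).const_mul _).sub ((hint (j + 2)).const_mul _)
  rw [intervalIntegral.integral_sub ((hint j).const_mul _) ((hint (j + 2)).const_mul _),
    intervalIntegral.integral_const_mul, intervalIntegral.integral_const_mul] at key
  simp at key
  linarith

theorem integral_pow_mul_semicircle {c : ℝ} (hc : 0 < c) (j : ℕ) :
    ∫ y in -(2 * √c)..(2 * √c), y ^ j * √((2 * √c) ^ 2 - y ^ 2)
      = 2 * Real.pi * semicircleMoment c j := by
  have ha : 0 < 2 * √c := by positivity
  have hsq : (2 * √c) ^ 2 = 4 * c := by rw [mul_pow, Real.sq_sqrt hc.le]; norm_num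
  obtain ⟨i, rfl | rfl⟩ := Nat.even_or_odd' j
  · rw [semicircleMoment_even]
    induction i with
    | zero =>
      simp only [mul_zero, pow_zero, one_mul]
      rw [integral_semicircle_zero ha, hsq]
      simp; ring
    | succ i ih =>
      have h := integral_semicircle_add_two ha (2 * i)
      rw [ih] at h
      rw [show 2 * (i + 1) = 2 * i + 2 by ring]
      have h2 : ((2 * i : ℕ) : ℝ) + 4 ≠ 0 := by positivity
      apply mul_left_cancel₀ h2
      rw [h, hsq]
      have h3 := add_two_mul_catalan_succ i
      push_cast
      rw [pow_succ c (i + 1)]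
      linear_combination (-4 * c ^ (i + 1) * c * Real.pi) * h3
  · rw [semicircleMoment_odd, mul_zero]
    apply integral_odd_interval
    intro x
    rw [Odd.neg_pow (by exact ⟨i, rfl⟩)]
    simp

/-! ### Moments of the scaled Kesten–McKay distribution -/

/-- The moments of the Kesten–McKay distribution, scaled to `[-1, 1]` and to total mass `p`. -/
def kmMoment (p : ℝ) : ℕ → ℝ
  | 0 => p
  | 1 => 0
  | j + 2 => kmMoment p j - semicircleMoment (p * (1 - p)) j

lemma kmMoment_sub (p : ℝ) (j : ℕ) :
    kmMoment p j - kmMoment p (j + 2) = semicircleMoment (p * (1 - p)) j := by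
  simp [kmMoment]

/-- For a = 1, which occurs at p = 1/2, the density is singular at the endpoints. Since a ≤ 1, it is
dominated by the arcsine density 1/√(1 - y²). -/
lemma intervalIntegrable_kmDensity {a : ℝ} (ha : 0 < a) (ha1 : a ≤ 1) :
    IntervalIntegrable (fun y : ℝ => √(a ^ 2 - y ^ 2) / (1 - y ^ 2)) volume (-a) a := by
  have h := Polynomial.Chebyshev.intervalIntegrable_sqrt_one_sub_sq_inv
  have h2 : IntervalIntegrable (fun x ↦ √(1 - x ^ 2)⁻¹) volume (-a) a := by
    apply h.mono_set
    rw [Set.uIcc_of_le (by linarith), Set.uIcc_of_le (by linarith)]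
    exact Set.Icc_subset_Icc (by linarith) ha1
  apply h2.mono_fun
  · apply Measurable.aestronglyMeasurable
    fun_prop
  · refine (ae_restrict_iff' measurableSet_uIoc).2 (Eventually.of_forall fun y hy => ?_)
    rw [Set.uIoc_of_le (by linarith)] at hy
    have h1 : 0 ≤ 1 - y ^ 2 := by nlinarith [hy.1, hy.2]
    beta_reduce
    rw [Real.norm_of_nonneg (by positivity), Real.norm_of_nonneg (by positivity)]
    rcases h1.eq_or_lt with h0 | h0
    · simp [← h0]
    · rw [Real.sqrt_inv, div_le_iff₀ h0]
      have : √(1 - y ^ 2) ≠ 0 := (Real.sqrt_pos.2 h0).ne'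
      calc √(a ^ 2 - y ^ 2) ≤ √(1 - y ^ 2) := Real.sqrt_le_sqrt (by nlinarith)
        _ = (√(1 - y ^ 2))⁻¹ * (√(1 - y ^ 2) * √(1 - y ^ 2)) := by field_simp
        _ = (√(1 - y ^ 2))⁻¹ * (1 - y ^ 2) := by rw [Real.mul_self_sqrt h1]

lemma tendsto_kmPrimitive {a s : ℝ} (ha : 0 < a) (hs : 0 ≤ s) :
    Tendsto (fun y : ℝ => Real.arcsin (y / a) - s * Real.arctan (s * y / √(a ^ 2 - y ^ 2)))
      (𝓝[<] a) (𝓝 (Real.pi / 2 - s * (Real.pi / 2))) := by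
  have h1 : Tendsto (fun y : ℝ => Real.arcsin (y / a)) (𝓝[<] a) (𝓝 (Real.pi / 2)) := by
    have : Continuous fun y : ℝ => Real.arcsin (y / a) :=
      Real.continuous_arcsin.comp (continuous_id.div_const a)
    have h := this.tendsto a
    rw [div_self ha.ne', Real.arcsin_one] at h
    exact h.mono_left nhdsWithin_le_nhds
  refine h1.sub ?_
  rcases hs.eq_or_lt with rfl | hs
  · simp
  refine Tendsto.const_mul s ?_
  refine (tendsto_nhdsWithin_iff.1 Real.tendsto_arctan_atTop).1.comp ?_
  have hsq : Tendsto (fun y : ℝ => √(a ^ 2 - y ^ 2)) (𝓝[<] a) (𝓝[>] 0) := by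
    rw [tendsto_nhdsWithin_iff]
    constructor
    · have : Continuous fun y : ℝ => √(a ^ 2 - y ^ 2) := by fun_prop
      have h := this.tendsto a
      simp only [sub_self, Real.sqrt_zero] at h
      exact h.mono_left nhdsWithin_le_nhds
    · filter_upwards [Ioo_mem_nhdsLT (show -a < a by linarith)] with y hy
      exact Real.sqrt_pos.2 (by nlinarith [hy.1, hy.2])
  have hnum : Tendsto (fun y : ℝ => s * y) (𝓝[<] a) (𝓝 (s * a)) :=
    ((continuous_const.mul continuous_id).tendsto a).mono_left nhdsWithin_le_nhds
  simp only [div_eq_mul_inv]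
  exact hnum.pos_mul_atTop (by positivity) (tendsto_inv_nhdsGT_zero.comp hsq)

/-- With s = √(1 - a²), a primitive is arcsin(y/a) - s arctan(s y/√(a² - y²)). It is odd, and its
limit at a is found in `tendsto_kmPrimitive`, where the argument of arctan tends to infinity unless
s = 0. -/
lemma integral_kmDensity {a : ℝ} (ha : 0 < a) (ha1 : a ≤ 1) :
    ∫ y in -a..a, √(a ^ 2 - y ^ 2) / (1 - y ^ 2) = Real.pi * (1 - √(1 - a ^ 2)) := by
  set s := √(1 - a ^ 2) with hs
  have hs0 : 0 ≤ s := Real.sqrt_nonneg _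
  have hs2 : s ^ 2 = 1 - a ^ 2 := Real.sq_sqrt (by nlinarith)
  have hodd : ∀ y : ℝ, Real.arcsin (-y / a) - s * Real.arctan (s * -y / √(a ^ 2 - (-y) ^ 2))
      = -(Real.arcsin (y / a) - s * Real.arctan (s * y / √(a ^ 2 - y ^ 2))) := by
    intro y
    rw [neg_div, Real.arcsin_neg, mul_neg, neg_sq, neg_div, Real.arctan_neg]; ring
  have hb := tendsto_kmPrimitive ha hs0
  have hneg : Tendsto (fun y : ℝ => -y) (𝓝[>] (-a)) (𝓝[<] a) := by
    rw [tendsto_nhdsWithin_iff]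
    constructor
    · have : Tendsto (fun y : ℝ => -y) (𝓝 (-a)) (𝓝 (- -a)) := continuous_neg.tendsto _
      rw [neg_neg] at this
      exact this.mono_left nhdsWithin_le_nhds
    · filter_upwards [self_mem_nhdsWithin] with y hy
      simp only [Set.mem_Iio, Set.mem_Ioi] at *; linarith
  have ha' : Tendsto (fun y : ℝ => Real.arcsin (y / a) - s * Real.arctan (s * y / √(a ^ 2 - y ^ 2)))
      (𝓝[>] (-a)) (𝓝 (-(Real.pi / 2 - s * (Real.pi / 2)))) := by
    have h := (hb.comp hneg).neg
    refine h.congr fun y => ?_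
    simp only [Function.comp_apply]
    rw [hodd, neg_neg]
  rw [intervalIntegral.integral_eq_sub_of_hasDerivAt_of_tendsto (show -a < a by linarith) ?_
    (intervalIntegrable_kmDensity ha ha1) ha' hb]
  · ring
  intro y hy
  have hpos : 0 < a ^ 2 - y ^ 2 := by nlinarith [hy.1, hy.2]
  have hone : 0 < 1 - y ^ 2 := by nlinarith
  have h1 : HasDerivAt (fun y : ℝ => a ^ 2 - y ^ 2) (-(2 * y)) y := by
    simpa using ((hasDerivAt_pow 2 y).const_sub (a ^ 2))
  have hya : -1 < y / a ∧ y / a < 1 := by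
    constructor
    · rw [lt_div_iff₀ ha]; linarith [hy.1]
    · rw [div_lt_iff₀ ha]; linarith [hy.2]
  have h2 : HasDerivAt (fun y : ℝ => Real.arcsin (y / a)) (1 / √(1 - (y / a) ^ 2) * (1 / a)) y :=
    HasDerivAt.comp (h₂ := Real.arcsin) y (Real.hasDerivAt_arcsin hya.1.ne' hya.2.ne)
      ((hasDerivAt_id y).div_const a)
  have hsp : 0 < √(a ^ 2 - y ^ 2) := Real.sqrt_pos.2 hpos
  have h3 := ((((hasDerivAt_id y).const_mul s).div (h1.sqrt hpos.ne') hsp.ne').arctan).const_mul s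
  refine (h2.sub h3).congr_deriv ?_
  have hss : √(a ^ 2 - y ^ 2) ^ 2 = a ^ 2 - y ^ 2 := Real.sq_sqrt hpos.le
  have h4 : √(1 - (y / a) ^ 2) = √(a ^ 2 - y ^ 2) / a := by
    rw [show 1 - (y / a) ^ 2 = (a ^ 2 - y ^ 2) / a ^ 2 by field_simp,
      Real.sqrt_div hpos.le, Real.sqrt_sq ha.le]
  rw [h4]
  simp only [id, Pi.div_apply]
  generalize √(a ^ 2 - y ^ 2) = t at *
  have h5 : 1 + (s * y / t) ^ 2 = a ^ 2 * (1 - y ^ 2) / t ^ 2 := by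
    field_simp
    rw [hss, hs2]; ring
  rw [h5]
  field_simp
  have ha2 : s ^ 2 = 1 - (t ^ 2 + y ^ 2) := by rw [hs2]; linarith
  have ha3 : a ^ 2 = t ^ 2 + y ^ 2 := by linarith
  simp only [ha2, ha3]
  ring

lemma intervalIntegrable_pow_mul_kmDensity {a : ℝ} (ha : 0 < a) (ha1 : a ≤ 1) (j : ℕ) :
    IntervalIntegrable (fun y : ℝ => y ^ j * (√(a ^ 2 - y ^ 2) / (1 - y ^ 2))) volume (-a) a :=
  (intervalIntegrable_kmDensity ha ha1).continuousOn_mul (by fun_prop)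

/-- Induction in steps of two: multiplying by 1 - y² leaves the semicircle, and 1^j + (-1)^j does
not change from j to j + 2. For j = 0, √(1 - a²) = |1 - 2p|, so the density has mass min(p, 1-p),
and the atoms complete it to p. -/
theorem integral_pow_mul_kmDensity {p : ℝ} (hp0 : 0 < p) (hp1 : p < 1) (j : ℕ) :
    (∫ y in -(2 * √(p * (1 - p)))..(2 * √(p * (1 - p))),
        y ^ j * (√((2 * √(p * (1 - p))) ^ 2 - y ^ 2) / (1 - y ^ 2))) / (2 * Real.pi)
      + max (p - 1 / 2) 0 * (1 ^ j + (-1) ^ j) = kmMoment p j := by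
  have hpq : 0 < p * (1 - p) := mul_pos hp0 (by linarith)
  set a := 2 * √(p * (1 - p)) with ha
  have ha0 : 0 < a := by positivity
  have hsq : a ^ 2 = 4 * (p * (1 - p)) := by rw [ha, mul_pow, Real.sq_sqrt hpq.le]; norm_num
  have ha1 : a ≤ 1 := by
    have : a ^ 2 ≤ 1 := by rw [hsq]; nlinarith [sq_nonneg (2 * p - 1)]
    nlinarith
  have hpi := Real.pi_pos
  induction j using Nat.twoStepInduction with
  | zero =>
    simp only [pow_zero, one_mul, kmMoment]
    rw [integral_kmDensity ha0 ha1, show 1 - a ^ 2 = (1 - 2 * p) ^ 2 by rw [hsq]; ring,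
      Real.sqrt_sq_eq_abs]
    rcases le_total p (1 / 2) with h | h
    · rw [abs_of_nonneg (by linarith), max_eq_right (by linarith)]
      field_simp; ring
    · rw [abs_of_nonpos (by linarith), max_eq_left (by linarith)]
      field_simp; ring
  | one =>
    rw [integral_odd_interval (fun x => by simp)]
    simp [kmMoment]
  | more j ih _ =>
    rw [kmMoment, ← ih]
    have h1 := integral_pow_mul_semicircle hpq j
    have h2 : ∫ y in -a..a, y ^ j * √(a ^ 2 - y ^ 2)
        = (∫ y in -a..a, y ^ j * (√(a ^ 2 - y ^ 2) / (1 - y ^ 2)))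
          - ∫ y in -a..a, y ^ (j + 2) * (√(a ^ 2 - y ^ 2) / (1 - y ^ 2)) := by
      rw [← intervalIntegral.integral_sub (intervalIntegrable_pow_mul_kmDensity ha0 ha1 j)
        (intervalIntegrable_pow_mul_kmDensity ha0 ha1 (j + 2))]
      apply intervalIntegral.integral_congr
      intro y hy
      rw [Set.uIcc_of_le (by linarith)] at hy
      simp only
      -- Where the denominator vanishes the quotients are 0 by convention; the semicircle is 0 there
      -- too, since a ≤ 1.
      by_cases h0 : 1 - y ^ 2 = 0
      · have : a ^ 2 - y ^ 2 ≤ 0 := by nlinarith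
        simp [Real.sqrt_eq_zero_of_nonpos this]
      · field_simp
        ring
    rw [h2] at h1
    rw [sub_eq_iff_eq_add'] at h1
    rw [h1]
    field_simp
    ring

/-! ### The Kesten–McKay and MANOVA measures -/

lemma integral_withDensity_indicator {l u : ℝ} (hlu : l ≤ u) {d f : ℝ → ℝ} (hd : Measurable d)
    (hnn : ∀ x ∈ Set.Icc l u, 0 ≤ d x) (hfd : IntervalIntegrable (fun x => f x * d x) volume l u) :
    Integrable f (volume.withDensity fun x => ENNReal.ofReal ((Set.Icc l u).indicator d x)) ∧
      ∫ x, f x ∂(volume.withDensity fun x => ENNReal.ofReal ((Set.Icc l u).indicator d x))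
        = ∫ x in l..u, f x * d x := by
  have hmeas : Measurable fun x => ENNReal.ofReal ((Set.Icc l u).indicator d x) :=
    (hd.indicator measurableSet_Icc).ennreal_ofReal
  have hfin : ∀ᵐ x, ENNReal.ofReal ((Set.Icc l u).indicator d x) < ⊤ :=
    Eventually.of_forall fun x => ENNReal.ofReal_lt_top
  have heq : (fun x => (ENNReal.ofReal ((Set.Icc l u).indicator d x)).toReal • f x)
      = (Set.Icc l u).indicator fun x => f x * d x := by
    funext x
    by_cases hx : x ∈ Set.Icc l u
    · simp [hx, ENNReal.toReal_ofReal (hnn x hx), mul_comm]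
    · simp [hx]
  rw [intervalIntegrable_iff_integrableOn_Icc_of_le hlu] at hfd
  constructor
  · rw [integrable_withDensity_iff_integrable_smul' hmeas hfin, heq]
    exact hfd.integrable_indicator measurableSet_Icc
  · rw [integral_withDensity_eq_integral_toReal_smul hmeas hfin, heq,
      integral_indicator measurableSet_Icc, intervalIntegral.integral_of_le hlu,
      integral_Icc_eq_integral_Ioc]

lemma integrable_dirac_real (f : ℝ → ℝ) (a : ℝ) : Integrable f (Measure.dirac a) :=
  integrable_dirac (by simp)

/-- The density of the scaled Kesten–McKay distribution of total mass `p`. -/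
def kmDensity (p y : ℝ) : ℝ :=
  √((2 * √(p * (1 - p))) ^ 2 - y ^ 2) / (1 - y ^ 2) / (2 * Real.pi)

lemma measurable_kmDensity (p : ℝ) : Measurable (kmDensity p) := by
  unfold kmDensity; fun_prop

lemma two_sqrt_mul_le_one {p : ℝ} (hp0 : 0 < p) (hp1 : p < 1) : 2 * √(p * (1 - p)) ≤ 1 := by
  have hpq : 0 < p * (1 - p) := mul_pos hp0 (by linarith)
  have h : (2 * √(p * (1 - p))) ^ 2 ≤ 1 := by
    rw [mul_pow, Real.sq_sqrt hpq.le]; nlinarith [sq_nonneg (2 * p - 1)]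
  have : 0 ≤ 2 * √(p * (1 - p)) := by positivity
  nlinarith

lemma kmDensity_nonneg {p : ℝ} (hp0 : 0 < p) (hp1 : p < 1) {y : ℝ}
    (hy : y ∈ Set.Icc (-(2 * √(p * (1 - p)))) (2 * √(p * (1 - p)))) : 0 ≤ kmDensity p y := by
  have h1 := two_sqrt_mul_le_one hp0 hp1
  have : 0 ≤ 1 - y ^ 2 := by nlinarith [hy.1, hy.2]
  unfold kmDensity
  positivity

lemma intervalIntegrable_pow_mul_kmDensity' {p : ℝ} (hp0 : 0 < p) (hp1 : p < 1) (j : ℕ) :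
    IntervalIntegrable (fun y : ℝ => y ^ j * kmDensity p y) volume
      (-(2 * √(p * (1 - p)))) (2 * √(p * (1 - p))) := by
  have hpq : 0 < p * (1 - p) := mul_pos hp0 (by linarith)
  have h := (intervalIntegrable_pow_mul_kmDensity (by positivity)
    (two_sqrt_mul_le_one hp0 hp1) j).div_const (2 * Real.pi)
  simpa only [kmDensity, mul_div_assoc] using h

lemma kmMoment_eq_integral {p : ℝ} (hp0 : 0 < p) (hp1 : p < 1) (j : ℕ) :
    kmMoment p j = (∫ y in -(2 * √(p * (1 - p)))..(2 * √(p * (1 - p))), y ^ j * kmDensity p y)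
      + max (p - 1 / 2) 0 * (1 ^ j + (-1) ^ j) := by
  rw [← integral_pow_mul_kmDensity hp0 hp1 j, ← intervalIntegral.integral_div]
  simp only [kmDensity, mul_div_assoc]

/-- No factor appears because the total mass p cancels the Jacobian 1/p of y = px. -/
lemma kestenMcKay_density_eq {p : ℝ} (hp0 : 0 < p) (x : ℝ) :
    p⁻¹ * √(4 * (p⁻¹ - 1) - x ^ 2) / (2 * Real.pi * (p⁻¹ ^ 2 - x ^ 2)) = kmDensity p (p * x) := by
  have h1 : p ^ 2 * (p⁻¹ - 1) = p * (1 - p) := by field_simp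
  by_cases hp1 : 0 ≤ p * (1 - p)
  · have h2 : √((2 * √(p * (1 - p))) ^ 2 - (p * x) ^ 2) = p * √(4 * (p⁻¹ - 1) - x ^ 2) := by
      rw [mul_pow, Real.sq_sqrt hp1, show (2 : ℝ) ^ 2 * (p * (1 - p)) - (p * x) ^ 2
        = p ^ 2 * (4 * (p⁻¹ - 1) - x ^ 2) by linear_combination (-4) * h1,
        Real.sqrt_mul (by positivity), Real.sqrt_sq hp0.le]
    rw [kmDensity, h2, show 1 - (p * x) ^ 2 = p ^ 2 * (p⁻¹ ^ 2 - x ^ 2) by field_simp]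
    by_cases h3 : p⁻¹ ^ 2 - x ^ 2 = 0
    · simp only [h3, mul_zero, div_zero, zero_div]
    · have hpi := Real.pi_pos
      rw [div_div, div_eq_div_iff (by positivity) (by positivity)]
      field_simp
  · have h4 : 4 * (p⁻¹ - 1) - x ^ 2 ≤ 0 := by
      have : p ^ 2 * (p⁻¹ - 1) < 0 := by linarith
      nlinarith [sq_nonneg x, sq_pos_of_pos hp0]
    rw [kmDensity, Real.sqrt_eq_zero_of_nonpos (not_le.1 hp1).le, Real.sqrt_eq_zero_of_nonpos h4,
      Real.sqrt_eq_zero_of_nonpos (by nlinarith [sq_nonneg (p * x)])]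
    simp

lemma two_sqrt_inv_sub_one {p : ℝ} (hp0 : 0 < p) :
    p * (2 * √(p⁻¹ - 1)) = 2 * √(p * (1 - p)) := by
  rw [show p * (1 - p) = p ^ 2 * (p⁻¹ - 1) by field_simp, Real.sqrt_mul (by positivity),
    Real.sqrt_sq hp0.le]
  ring

lemma mul_ofReal_toReal {p : ℝ} (hp0 : 0 < p) :
    p * (ENNReal.ofReal (1 - p⁻¹ / 2)).toReal = max (p - 1 / 2) 0 := by
  rw [ENNReal.toReal_ofReal', mul_max_of_nonneg _ _ hp0.le]
  congr 1
  · field_simp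
  · simp

theorem integrable_and_mKestenMcKay_eq {p : ℝ} (hp0 : 0 < p) (hp1 : p < 1) (r : ℕ) :
    Integrable (fun x : ℝ => (p * x) ^ r) (kestenMcKay p⁻¹) ∧ mKestenMcKay p r = kmMoment p r := by
  set a := 2 * √(p * (1 - p)) with ha
  set b := 2 * √(p⁻¹ - 1) with hb
  have hab : p * b = a := two_sqrt_inv_sub_one hp0
  have hb0 : 0 ≤ b := by positivity
  have hint := intervalIntegrable_pow_mul_kmDensity' hp0 hp1 r
  rw [← ha] at hint
  have hdens : (fun x : ℝ => p⁻¹ * √(4 * (p⁻¹ - 1) - x ^ 2) / (2 * Real.pi * (p⁻¹ ^ 2 - x ^ 2)))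
      = fun x => kmDensity p (p * x) := funext fun x => kestenMcKay_density_eq hp0 x
  have hD := integral_withDensity_indicator (l := -b) (u := b) (d := fun x => kmDensity p (p * x))
    (f := fun x => (p * x) ^ r) (by linarith)
    ((measurable_kmDensity p).comp (measurable_const_mul p)) (fun x hx => by
      apply kmDensity_nonneg hp0 hp1
      rw [← ha, ← hab]
      exact ⟨by nlinarith [hx.1], by nlinarith [hx.2]⟩) (by
      have h := hint.comp_mul_left (c := p)
      rwa [show -a / p = -b by rw [← hab]; field_simp,
        show a / p = b by rw [← hab]; field_simp] at h)
  have hatom : Integrable (fun x : ℝ => (p * x) ^ r)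
      (ENNReal.ofReal (1 - p⁻¹ / 2) • (Measure.dirac p⁻¹ + Measure.dirac (-p⁻¹))) :=
    ((integrable_dirac_real _ _).add_measure (integrable_dirac_real _ _)).smul_measure
      ENNReal.ofReal_ne_top
  unfold mKestenMcKay kestenMcKay
  rw [hdens]
  refine ⟨hD.1.add_measure hatom, ?_⟩
  rw [integral_add_measure hD.1 hatom, hD.2, integral_smul_measure,
    integral_add_measure (integrable_dirac_real _ _) (integrable_dirac_real _ _),
    integral_dirac, integral_dirac, kmMoment_eq_integral hp0 hp1, mul_add]
  have h := intervalIntegral.mul_integral_comp_mul_left (a := -b) (b := b)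
    (f := fun y => y ^ r * kmDensity p y) (c := p)
  rw [h, mul_neg, hab, ← ha, smul_eq_mul, ← mul_assoc, mul_ofReal_toReal hp0]
  congr 3
  · rw [mul_inv_cancel₀ hp0.ne']
  · rw [mul_neg, mul_inv_cancel₀ hp0.ne']

lemma manova_endpoints {p : ℝ} (hp0 : 0 < p) (hp1 : p < 1) :
    (√(2 * p * (1 - 1 / 2)) - √(1 - 2 * p * (1 / 2))) ^ 2 = 1 - 2 * √(p * (1 - p)) ∧
    (√(2 * p * (1 - 1 / 2)) + √(1 - 2 * p * (1 / 2))) ^ 2 = 1 + 2 * √(p * (1 - p)) := by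
  rw [show 2 * p * (1 - 1 / 2) = p by ring, show 1 - 2 * p * (1 / 2) = 1 - p by ring,
    Real.sqrt_mul hp0.le]
  have h1 := Real.sq_sqrt hp0.le
  have h2 := Real.sq_sqrt (show 0 ≤ 1 - p by linarith)
  constructor <;> linear_combination h1 + h2

/-- The binomial transform of the scaled Kesten–McKay moments. -/
def kmShiftedMoment (p : ℝ) (r : ℕ) : ℝ :=
  ∑ j ∈ Finset.range (r + 1), (r.choose j : ℝ) * kmMoment p j

/-- With x = 1 + y, the denominator x(1 - x/2) becomes (1 - y²)/2. The factor p⁻¹ normalizes the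
mass p to 1. -/
lemma manova_density_eq {p : ℝ} (hp0 : 0 < p) (x : ℝ) :
    √((1 + 2 * √(p * (1 - p)) - x) * (x - (1 - 2 * √(p * (1 - p))))) /
      (2 * (2 * p) * Real.pi * x * (1 - 1 / 2 * x)) = p⁻¹ * kmDensity p (x - 1) := by
  rw [kmDensity, show (1 + 2 * √(p * (1 - p)) - x) * (x - (1 - 2 * √(p * (1 - p))))
    = (2 * √(p * (1 - p))) ^ 2 - (x - 1) ^ 2 by ring,
    show 2 * (2 * p) * Real.pi * x * (1 - 1 / 2 * x)
      = (1 - (x - 1) ^ 2) * (2 * Real.pi) * p by ring, ← div_div, ← div_div]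
  field_simp

theorem integrable_and_integral_manova {p : ℝ} (hp0 : 0 < p) (hp1 : p < 1) (r : ℕ) :
    Integrable (fun x : ℝ => x ^ r) (manovaMeasure (2 * p) (1 / 2)) ∧
      p * ∫ x, x ^ r ∂(manovaMeasure (2 * p) (1 / 2)) = kmShiftedMoment p r := by
  set a := 2 * √(p * (1 - p)) with ha
  have ha0 : 0 ≤ a := by positivity
  have hexp : ∀ y : ℝ, (y + 1) ^ r * kmDensity p y
      = ∑ j ∈ Finset.range (r + 1), (r.choose j : ℝ) * (y ^ j * kmDensity p y) := by
    intro y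
    rw [add_pow, Finset.sum_mul]
    exact Finset.sum_congr rfl fun j _ => by rw [one_pow]; ring
  have hint : ∀ j : ℕ, IntervalIntegrable (fun y => (r.choose j : ℝ) * (y ^ j * kmDensity p y))
      volume (-a) a := fun j => (intervalIntegrable_pow_mul_kmDensity' hp0 hp1 j).const_mul _
  have hint1 : IntervalIntegrable (fun y => (y + 1) ^ r * kmDensity p y) volume (-a) a := by
    simp only [hexp]
    have h := IntervalIntegrable.sum (Finset.range (r + 1)) (fun j _ => hint j)
    simpa only [Finset.sum_fn] using h
  have hint2 : IntervalIntegrable (fun x => x ^ r * (p⁻¹ * kmDensity p (x - 1))) volume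
      (1 - a) (1 + a) := by
    have h := (hint1.comp_sub_right 1).const_mul p⁻¹
    rw [show -a + 1 = 1 - a by ring, show a + 1 = 1 + a by ring] at h
    convert h using 1
    ext x; simp; ring
  have hdens : (fun x : ℝ => √((1 + a - x) * (x - (1 - a))) /
      (2 * (2 * p) * Real.pi * x * (1 - 1 / 2 * x))) = fun x => p⁻¹ * kmDensity p (x - 1) :=
    funext fun x => manova_density_eq hp0 x
  have hD := integral_withDensity_indicator (l := 1 - a) (u := 1 + a)
    (d := fun x => p⁻¹ * kmDensity p (x - 1)) (f := fun x => x ^ r) (by linarith)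
    (((measurable_kmDensity p).comp (measurable_id.sub_const 1)).const_mul _) (fun x hx => by
      have := kmDensity_nonneg hp0 hp1 (y := x - 1) ⟨by linarith [hx.1], by linarith [hx.2]⟩
      positivity) hint2
  have hatom : ∀ w b : ℝ, Integrable (fun x : ℝ => x ^ r)
      (ENNReal.ofReal w • Measure.dirac b) := fun w b =>
    (integrable_dirac_real _ _).smul_measure ENNReal.ofReal_ne_top
  unfold manovaMeasure
  obtain ⟨e1, e2⟩ := manova_endpoints hp0 hp1
  rw [e1, e2, ← ha, hdens]
  refine ⟨(hD.1.add_measure (hatom _ _)).add_measure (hatom _ _), ?_⟩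
  rw [integral_add_measure (hD.1.add_measure (hatom _ _)) (hatom _ _),
    integral_add_measure hD.1 (hatom _ _), hD.2, integral_smul_measure, integral_smul_measure,
    integral_dirac, integral_dirac, kmShiftedMoment]
  have h1 : ∫ x in (1 - a)..(1 + a), x ^ r * (p⁻¹ * kmDensity p (x - 1))
      = p⁻¹ * ∑ j ∈ Finset.range (r + 1),
        (r.choose j : ℝ) * ∫ y in -a..a, y ^ j * kmDensity p y := by
    have h := intervalIntegral.integral_comp_sub_right (a := 1 - a) (b := 1 + a)
      (fun y => (y + 1) ^ r * kmDensity p y) 1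
    simp only [sub_add_cancel] at h
    rw [show 1 - a - 1 = -a by ring, show 1 + a - 1 = a by ring] at h
    simp only [hexp] at h
    rw [intervalIntegral.integral_finsetSum (fun j _ => hint j)] at h
    simp only [intervalIntegral.integral_const_mul] at h
    rw [← h, ← intervalIntegral.integral_const_mul]
    congr 1
    ext x; ring
  have h2 : (∑ j ∈ Finset.range (r + 1), (r.choose j : ℝ) * (1 ^ j + (-1) ^ j) : ℝ)
      = (1 / (1 / 2)) ^ r + 0 ^ r := by
    have e3 := add_pow (1 : ℝ) 1 r
    have e4 := add_pow (-1 : ℝ) 1 r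
    rw [show (1 : ℝ) / (1 / 2) = 1 + 1 by norm_num, show (0 : ℝ) = -1 + 1 by norm_num, e3, e4,
      ← Finset.sum_add_distrib]
    exact Finset.sum_congr rfl fun j _ => by simp; ring
  -- For these parameters the atoms at 2 and at 0 carry the same mass; after translation they are
  -- the atoms at 1 and -1.
  have hw1 : 1 + 1 / (2 * p) - 1 / (2 * p * (1 / 2)) = 1 - p⁻¹ / 2 := by field_simp; ring
  have hw2 : 1 - 1 / (2 * p) = 1 - p⁻¹ / 2 := by field_simp
  rw [h1, hw1, hw2]
  simp only [kmMoment_eq_integral hp0 hp1, mul_add, Finset.sum_add_distrib, ← mul_assoc,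
    smul_eq_mul, mul_ofReal_toReal hp0, mul_inv_cancel₀ hp0.ne', one_mul, ← ha]
  simp only [mul_comm _ (max (p - 1 / 2) 0), mul_assoc, ← Finset.mul_sum]
  rw [add_assoc, ← mul_add, ← mul_add, ← Finset.sum_add_distrib, ← h2]
  simp only [mul_add]

/-! ### Moment functionals on polynomials -/

open Polynomial in
/-- The linear functional on real polynomials with prescribed moments. -/
def momentFunctional (m : ℕ → ℝ) : ℝ[X] →ₗ[ℝ] ℝ := (Polynomial.basisMonomials ℝ).constr ℝ m

lemma momentFunctional_X_pow (m : ℕ → ℝ) (j : ℕ) : momentFunctional m (Polynomial.X ^ j) = m j := by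
  have h := (Polynomial.basisMonomials ℝ).constr_basis ℝ m j
  rw [momentFunctional]
  simpa only [Polynomial.coe_basisMonomials, Polynomial.monomial_one_right_eq_X_pow] using h

open Polynomial in
lemma linearMap_polynomial_ext {f g : ℝ[X] →ₗ[ℝ] ℝ} (h : ∀ j : ℕ, f (X ^ j) = g (X ^ j)) :
    f = g := by
  refine (Polynomial.basisMonomials ℝ).ext fun j => ?_
  simpa [Polynomial.X_pow_eq_monomial] using h j

-- The linear extension of m_j - m_(j+2) = s_j: an algebraic form of the fact that 1 - y² turns the
-- Kesten–McKay density into the semicircle.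
open Polynomial in
lemma momentFunctional_km_one_sub_sq (p : ℝ) (f : ℝ[X]) :
    momentFunctional (kmMoment p) ((1 - X ^ 2) * f)
      = momentFunctional (semicircleMoment (p * (1 - p))) f := by
  have h : (momentFunctional (kmMoment p)).comp (LinearMap.mulLeft ℝ (1 - X ^ 2))
      = momentFunctional (semicircleMoment (p * (1 - p))) := by
    refine linearMap_polynomial_ext fun j => ?_
    simp only [LinearMap.comp_apply, LinearMap.mulLeft_apply]
    rw [sub_mul, one_mul, ← pow_add, add_comm 2 j, map_sub, momentFunctional_X_pow,
      momentFunctional_X_pow, momentFunctional_X_pow, kmMoment_sub]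
  exact LinearMap.congr_fun h f

open Polynomial in
lemma momentFunctional_X_add_one_pow (m : ℕ → ℝ) (r : ℕ) :
    momentFunctional m ((X + 1) ^ r) = ∑ j ∈ Finset.range (r + 1), (r.choose j : ℝ) * m j := by
  rw [add_pow, map_sum]
  refine Finset.sum_congr rfl fun j _ => ?_
  rw [one_pow, mul_one, mul_comm, ← nsmul_eq_mul, map_nsmul, momentFunctional_X_pow, nsmul_eq_mul]

-- Apply the functional to (X+1)^(r+2) = 2(X+1)^(r+1) - (1 - X²)(X+1)^r.
open Polynomial in
lemma kmShiftedMoment_add_two (p : ℝ) (r : ℕ) :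
    kmShiftedMoment p (r + 2) = 2 * kmShiftedMoment p (r + 1)
      - ∑ j ∈ Finset.range (r + 1), (r.choose j : ℝ) * semicircleMoment (p * (1 - p)) j := by
  simp only [kmShiftedMoment, ← momentFunctional_X_add_one_pow]
  rw [← momentFunctional_km_one_sub_sq, ← smul_eq_mul, ← map_smul, ← map_sub]
  congr 1
  rw [smul_eq_C_mul, C_ofNat]
  ring

/-! ### The closed formula for the MANOVA moments -/

lemma sum_range_two_mul (f : ℕ → ℝ) (n : ℕ) :
    ∑ j ∈ Finset.range (2 * n), f j = ∑ k ∈ Finset.range n, (f (2 * k) + f (2 * k + 1)) := by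
  induction n with
  | zero => simp
  | succ n ih => rw [mul_add, mul_one, Finset.sum_range_succ, Finset.sum_range_succ,
      Finset.sum_range_succ, ih, add_assoc]

lemma sum_choose_mul_semicircleMoment (c : ℝ) (r : ℕ) :
    ∑ j ∈ Finset.range (r + 1), (r.choose j : ℝ) * semicircleMoment c j
      = ∑ k ∈ Finset.range (r + 1), (r.choose (2 * k) : ℝ) * catalan k * c ^ (k + 1) := by
  have h1 : ∑ j ∈ Finset.range (r + 1), (r.choose j : ℝ) * semicircleMoment c j
      = ∑ j ∈ Finset.range (2 * (r + 1)), (r.choose j : ℝ) * semicircleMoment c j := by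
    refine Finset.sum_subset (fun j hj => ?_) fun j _ hj => ?_
    · simp only [Finset.mem_range] at *; omega
    · rw [Nat.choose_eq_zero_of_lt (by simpa using hj)]; simp
  rw [h1, sum_range_two_mul]
  refine Finset.sum_congr rfl fun k _ => ?_
  rw [semicircleMoment_even, semicircleMoment_odd]
  ring

/-- Homogenization: (pq)^(k+1) is multiplied by (p+q)^(r-2k) = 1, so that all terms have total
degree r + 2 in p and q. -/
lemma sum_choose_shift {p q : ℝ} (hpq : p + q = 1) {r k : ℕ} (hk : 2 * k ≤ r) :
    ∑ i ∈ Finset.range (r + 1), (if k ≤ i then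
      ((r - 2 * k).choose (i - k) : ℝ) * (p ^ (i + 1) * q ^ (r + 1 - i)) else 0)
      = (p * q) ^ (k + 1) := by
  obtain ⟨n, rfl⟩ := Nat.exists_eq_add_of_le hk
  rw [show 2 * k + n + 1 = k + ((n + 1) + k) by ring, Finset.sum_range_add, Finset.sum_range_add]
  rw [Finset.sum_eq_zero (fun i hi => if_neg (by simpa using hi)), zero_add,
    Finset.sum_eq_zero (s := Finset.range k) (fun i _ => by
      rw [if_pos (by omega), Nat.choose_eq_zero_of_lt (by omega)]; simp), add_zero]
  have h := add_pow p q n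
  rw [hpq, one_pow] at h
  rw [← mul_one ((p * q) ^ (k + 1)), h, Finset.mul_sum]
  refine Finset.sum_congr rfl fun l hl => ?_
  rw [Finset.mem_range] at hl
  rw [if_pos (by omega), show 2 * k + n - 2 * k = n by omega, show k + l - k = l by omega,
    show k + (n + 1 + k) - (k + l) = k + 1 + (n - l) by omega, pow_add, pow_add q,
    mul_pow]
  ring

/-- Both sides equal (r+1)! / (k! (k+1)! (i-k)! (r-i-k)!) when i + k ≤ r, and 0 otherwise. -/
lemma choose_mul_catalan_mul_choose {r i k : ℕ} (hi : i ≤ r) (hk : k ≤ i) :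
    (r + 1) * (r.choose (2 * k) * catalan k * (r - 2 * k).choose (i - k))
      = (r + 1).choose i * (i.choose k * (r + 1 - i).choose (k + 1)) := by
  rcases lt_or_ge r (i + k) with h | h
  · rw [Nat.choose_eq_zero_of_lt (show r + 1 - i < k + 1 by omega)]
    rcases lt_or_ge r (2 * k) with h2 | h2
    · rw [Nat.choose_eq_zero_of_lt h2]; simp
    · rw [Nat.choose_eq_zero_of_lt (show r - 2 * k < i - k by omega)]; simp
  · obtain ⟨l, rfl⟩ := Nat.exists_eq_add_of_le hk
    obtain ⟨n, rfl⟩ := Nat.exists_eq_add_of_le h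
    have hc : (catalan k : ℚ) * ((k + 1) * k.factorial * k.factorial) = (2 * k).factorial := by
      have h1 := succ_mul_catalan_eq_centralBinom k
      have h2 := Nat.choose_mul_factorial_mul_factorial (show k ≤ 2 * k by omega)
      rw [show 2 * k - k = k by omega, ← Nat.centralBinom_eq_two_mul_choose, ← h1] at h2
      have h3 : (((k + 1) * catalan k * k.factorial * k.factorial : ℕ) : ℚ) = (2 * k).factorial := by
        exact_mod_cast h2
      push_cast at h3
      linear_combination h3
    have e1 := Nat.choose_mul_factorial_mul_factorial (show 2 * k ≤ k + l + k + n by omega)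
    have e2 := Nat.choose_mul_factorial_mul_factorial (show l ≤ l + n by omega)
    have e3 := Nat.choose_mul_factorial_mul_factorial (show k + l ≤ k + l + k + n + 1 by omega)
    have e4 := Nat.choose_mul_factorial_mul_factorial (show k ≤ k + l by omega)
    have e5 := Nat.choose_mul_factorial_mul_factorial (show k + 1 ≤ k + 1 + n by omega)
    rw [show k + l + k + n - 2 * k = l + n by omega] at e1
    rw [show l + n - l = n by omega] at e2
    rw [show k + l + k + n + 1 - (k + l) = k + 1 + n by omega] at e3
    rw [show k + l - k = l by omega] at e4
    rw [show k + 1 + n - (k + 1) = n by omega] at e5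
    rw [show k + l + k + n - 2 * k = l + n by omega, show k + l - k = l by omega,
      show k + l + k + n + 1 - (k + l) = k + 1 + n by omega]
    rw [Nat.factorial_succ (k + l + k + n)] at e3
    rw [Nat.factorial_succ k] at e5
    have f := fun m : ℕ => Nat.cast_ne_zero (R := ℚ) |>.2 (Nat.factorial_ne_zero m)
    have hk1 : (k : ℚ) + 1 ≠ 0 := by positivity
    have g : ∀ a b c d : ℕ, a * b.factorial * c.factorial = d →
        (a : ℚ) = d / (b.factorial * c.factorial) := by
      intro a b c d h
      have := f b
      have := f c
      rw [← h]; push_cast; field_simp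
    have hcat : (catalan k : ℚ) = (2 * k).factorial / ((k + 1) * k.factorial * k.factorial) := by
      rw [← hc]
      have := f k
      field_simp
    have e5' : ((k + 1 + n).choose (k + 1) : ℚ)
        = (k + 1 + n).factorial / ((k + 1) * k.factorial * n.factorial) := by
      have := f k
      have := f n
      rw [← e5]; push_cast; field_simp
    have key : (((k + l + k + n + 1) * ((k + l + k + n).choose (2 * k) * catalan k *
        (l + n).choose l) : ℕ) : ℚ) = (((k + l + k + n + 1).choose (k + l) *
        ((k + l).choose k * (k + 1 + n).choose (k + 1)) : ℕ) : ℚ) := by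
      push_cast
      rw [g _ _ _ _ e1, g _ _ _ _ e2, g _ _ _ _ e3, g _ _ _ _ e4, e5', hcat]
      have := f k
      have := f n
      have := f l
      have := f (2 * k)
      have := f (l + n)
      have := f (k + l)
      have := f (k + 1 + n)
      push_cast
      field_simp
    exact_mod_cast key

/-- Vandermonde's convolution, after the symmetry of binomial coefficients. -/
lemma sum_choose_mul_choose_succ {r i : ℕ} (hi : i ≤ r) :
    ∑ k ∈ Finset.range (i + 1), i.choose k * (r + 1 - i).choose (k + 1)
      = (r + 1).choose (i + 1) := by
  have h := Nat.add_choose_eq i (r + 1 - i) (i + 1)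
  rw [Finset.Nat.sum_antidiagonal_eq_sum_range_succ
    (fun a b => i.choose a * (r + 1 - i).choose b), Finset.sum_range_succ,
    Nat.choose_succ_self, zero_mul, add_zero, show i + (r + 1 - i) = r + 1 by omega] at h
  rw [h, ← Finset.sum_range_reflect]
  refine Finset.sum_congr rfl fun k hk => ?_
  rw [Finset.mem_range] at hk
  rw [show i + 1 - 1 - k = i - k by omega, Nat.choose_symm (by omega),
    show i - k + 1 = i + 1 - k by omega]

/-- This is the gamma expansion N_(r+1)(x) = ∑_k C(r,2k) Cat_k x^(k+1) (1+x)^(r-2k) at x = p/q, q =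
1 - p, where 1 + x = 1/q. The coefficients of p^(i+1) q^(r+1-i) are compared: summing over k with
`choose_mul_catalan_mul_choose` and Vandermonde gives the Narayana number. -/
theorem narayanaPoly_gamma_expansion {p : ℝ} (hp1 : p < 1) (r : ℕ) :
    (1 - p) ^ (r + 2) * narayanaPoly (r + 1) (p / (1 - p))
      = ∑ j ∈ Finset.range (r + 1), (r.choose j : ℝ) * semicircleMoment (p * (1 - p)) j := by
  have hq : (1 - p) ≠ 0 := by linarith
  set q := 1 - p with hqdef
  have hpq : p + q = 1 := by rw [hqdef]; ring
  rw [sum_choose_mul_semicircleMoment]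
  have h1 : ∀ k ∈ Finset.range (r + 1), (r.choose (2 * k) : ℝ) * catalan k * (p * q) ^ (k + 1)
      = ∑ i ∈ Finset.range (r + 1), (if k ≤ i then (r.choose (2 * k) : ℝ) * catalan k *
        ((r - 2 * k).choose (i - k)) * (p ^ (i + 1) * q ^ (r + 1 - i)) else 0) := by
    intro k _
    rcases lt_or_ge r (2 * k) with h | h
    · rw [Nat.choose_eq_zero_of_lt h]; simp
    · rw [← sum_choose_shift hpq h, Finset.mul_sum]
      refine Finset.sum_congr rfl fun i _ => ?_
      split_ifs
      · ring
      · simp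
  rw [Finset.sum_congr rfl h1, Finset.sum_comm, narayanaPoly, Finset.mul_sum,
    Finset.range_eq_Ico, ← Finset.Ico_add_one_right_eq_Icc, Finset.sum_Ico_eq_sum_range,
    Nat.add_sub_cancel, ← Finset.range_eq_Ico]
  refine Finset.sum_congr rfl fun i hi => ?_
  rw [Finset.mem_range] at hi
  have h2 : ∑ k ∈ Finset.range (r + 1), (if k ≤ i then (r.choose (2 * k) : ℝ) * catalan k *
        ((r - 2 * k).choose (i - k)) * (p ^ (i + 1) * q ^ (r + 1 - i)) else 0)
      = ∑ k ∈ Finset.range (i + 1), (r.choose (2 * k) : ℝ) * catalan k *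
        ((r - 2 * k).choose (i - k)) * (p ^ (i + 1) * q ^ (r + 1 - i)) := by
    rw [← Finset.sum_filter]
    congr 1
    ext k; simp; omega
  have h3 : ((r : ℝ) + 1) * ∑ k ∈ Finset.range (i + 1), (r.choose (2 * k) : ℝ) * catalan k *
        ((r - 2 * k).choose (i - k)) = (r + 1).choose i * (r + 1).choose (i + 1) := by
    rw [← sum_choose_mul_choose_succ (show i ≤ r by omega)]
    have h4 : (r + 1) * ∑ k ∈ Finset.range (i + 1), r.choose (2 * k) * catalan k *
        ((r - 2 * k).choose (i - k)) = (r + 1).choose i *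
        ∑ k ∈ Finset.range (i + 1), i.choose k * (r + 1 - i).choose (k + 1) := by
      rw [Finset.mul_sum, Finset.mul_sum]
      refine Finset.sum_congr rfl fun k hk => ?_
      rw [Finset.mem_range] at hk
      exact choose_mul_catalan_mul_choose (by omega) (by omega)
    exact_mod_cast h4
  have h5 : (r : ℝ) + 1 ≠ 0 := by positivity
  rw [h2, ← Finset.sum_mul]
  have h6 : ∑ k ∈ Finset.range (i + 1), (r.choose (2 * k) : ℝ) * catalan k *
        ((r - 2 * k).choose (i - k)) = (r + 1).choose i * (r + 1).choose (i + 1) / (r + 1) := by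
    rw [← h3]; field_simp
  rw [h6]
  have h7 : q ^ (r + 2) * (p / q) ^ (1 + i) = p ^ (i + 1) * q ^ (r + 1 - i) := by
    rw [div_pow, show r + 2 = (r + 1 - i) + (1 + i) by omega, pow_add, add_comm 1 i]
    field_simp
  rw [← h7, add_comm 1 i, Nat.add_sub_cancel]
  push_cast
  ring

/-- For γ = 1/2 the base of the geometric factors is 2, so passing from r to r + 1 doubles the old
terms and adds one new Narayana polynomial. This is the recurrence of `kmShiftedMoment_add_two`. -/
theorem mManova_half_eq {p : ℝ} (hp1 : p < 1) {r : ℕ} (hr : 1 ≤ r) :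
    mManova (1 / 2) p r = kmShiftedMoment p r := by
  induction r, hr using Nat.le_induction with
  | base => simp [mManova, kmShiftedMoment, Finset.sum_range_succ, kmMoment]
  | succ r hr ih =>
    obtain ⟨r, rfl⟩ := Nat.exists_eq_add_of_le' hr
    rw [kmShiftedMoment_add_two, ← ih, ← narayanaPoly_gamma_expansion hp1]
    have h2 : (1 : ℝ) / (1 / 2) - 1 = 1 := by norm_num
    simp only [mManova, h2, Nat.add_sub_cancel, one_mul]
    rw [Finset.sum_range_succ]
    have h3 : ∑ j ∈ Finset.range r, (1 - p) ^ j * (1 + 1) ^ (r + 1 + 1 - 2 - j) *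
          narayanaPoly (j + 1) (p / (1 - p))
        = 2 * ∑ j ∈ Finset.range r, (1 - p) ^ j * (1 + 1) ^ (r + 1 - 2 - j) *
          narayanaPoly (j + 1) (p / (1 - p)) := by
      rw [Finset.mul_sum]
      refine Finset.sum_congr rfl fun j hj => ?_
      rw [Finset.mem_range] at hj
      rw [show r + 1 + 1 - 2 - j = (r + 1 - 2 - j) + 1 by omega, pow_succ]
      ring
    rw [h3, show r + 1 + 1 - 2 - r = 0 by omega]
    ring

/-! ### Generating functions -/

section GeneratingFunctions

open PowerSeries

/-- The quadratic equation of the Catalan series, with cX² substituted for the variable. -/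
lemma semicircle_series_eq (c : ℝ) :
    (mk (semicircleMoment c) : ℝ⟦X⟧) = C c + X ^ 2 * mk (semicircleMoment c) ^ 2 := by
  have hs : HasSubst (X ^ 2 : ℝ⟦X⟧) := HasSubst.X_pow (by norm_num)
  set K : ℝ⟦X⟧ := subst (X ^ 2 : ℝ⟦X⟧) (rescale c (catalanSeries.map (Nat.castRingHom ℝ))) with hK
  have h1 : K = 1 + C c * X ^ 2 * K ^ 2 := by
    have h := congrArg (fun s => substAlgHom hs (rescale c (s.map (Nat.castRingHom ℝ))))
      catalanSeries_sq_mul_X_add_one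
    simp only [map_add, map_mul, map_pow, map_one, PowerSeries.map_X, rescale_X] at h
    rw [coe_substAlgHom, ← hK, subst_X hs, subst_C] at h
    have h' : K ^ 2 * (C c * X ^ 2) + 1 = K := h
    linear_combination -h'
  have h2 : (mk (semicircleMoment c) : ℝ⟦X⟧) = C c * K := by
    ext n
    rw [coeff_C_mul, hK, coeff_subst_X_pow (by norm_num), coeff_mk, semicircleMoment]
    simp only [even_iff_two_dvd]
    split_ifs
    · simp [pow_succ]; ring
    · simp
  rw [h2]
  conv_lhs => rw [h1]
  ring

/-- The recurrence says F(1 - X²) = p - X²K, with K the semicircle series. Eliminating K by its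
quadratic equation gives the claim multiplied by 1 - X², which can be cancelled. -/
lemma km_series_quadratic (p : ℝ) :
    (mk (kmMoment p) - C p) + (mk (kmMoment p) - C p) ^ 2
      = (X * mk (kmMoment p) : ℝ⟦X⟧) ^ 2 := by
  set F : ℝ⟦X⟧ := mk (kmMoment p)
  set K : ℝ⟦X⟧ := mk (semicircleMoment (p * (1 - p)))
  have hK : K = C (p * (1 - p)) + X ^ 2 * K ^ 2 := semicircle_series_eq _
  have hF : F * (1 - X ^ 2) = C p - X ^ 2 * K := by
    ext n
    rw [mul_sub, mul_one, map_sub, map_sub, coeff_mk, mul_comm F]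
    rcases n with _ | _ | n
    · simp [coeff_X_pow_mul', kmMoment]
    · simp [coeff_X_pow_mul', kmMoment]
    · rw [show n + 1 + 1 = n + 2 by ring, coeff_X_pow_mul, coeff_X_pow_mul, coeff_mk, coeff_mk, ← kmMoment_sub]
      simp
  have h1 : (1 - X ^ 2 : ℝ⟦X⟧) ≠ 0 := fun h => by
    have := congrArg (constantCoeff) h
    simp at this
  rw [map_mul, map_sub, map_one] at hK
  have key : (1 - X ^ 2) * ((F - C p) + (F - C p) ^ 2) = (1 - X ^ 2) * (X * F) ^ 2 := by
    linear_combination (F * (1 - X ^ 2) + C p - X ^ 2 * K + 1 - 2 * C p) * hF - X ^ 2 * hK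
  exact mul_left_cancel₀ h1 key

/-- The difference of the two equations is F - G times a series with constant term 1. -/
lemma quadratic_series_unique {F G : ℝ⟦X⟧} {p : ℝ} (hF0 : constantCoeff F = p)
    (hG0 : constantCoeff G = p)
    (hF : (F - C p) + (F - C p) ^ 2 = (X * F) ^ 2)
    (hG : (G - C p) + (G - C p) ^ 2 = (X * G) ^ 2) : F = G := by
  have h : (F - G) * (1 + (F + G - 2 * C p) - X ^ 2 * (F + G)) = 0 := by
    linear_combination hF - hG
  rcases mul_eq_zero.1 h with h | h
  · exact sub_eq_zero.1 h
  · have := congrArg constantCoeff h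
    simp [hF0, hG0, map_ofNat] at this
    linarith

/-- At γ = 1/2 the value A_1 is 0, and A_0 = 0 by convention, so the defining recursion becomes a
full convolution: A + A² = z². -/
lemma cycleValue_half_add_sum (n : ℕ) :
    cycleValue (1 / 2) n + ∑ x ∈ Finset.HasAntidiagonal.antidiagonal n,
      cycleValue (1 / 2) x.1 * cycleValue (1 / 2) x.2 = if n = 2 then 1 else 0 := by
  rcases n with _ | _ | _ | n
  · simp [cycleValue]
  · simp [cycleValue, Finset.Nat.antidiagonal_succ]
  · simp [cycleValue, Finset.Nat.antidiagonal_succ]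
  · rw [if_neg (by omega), cycleValue, Finset.Nat.sum_antidiagonal_eq_sum_range_succ
      (fun a b => cycleValue (1 / 2) a * cycleValue (1 / 2) b), Finset.sum_range_succ,
      Finset.sum_range_succ']
    rw [Fin.sum_univ_eq_sum_range
      (fun i => cycleValue (1 / 2) (i + 1) * cycleValue (1 / 2) (n + 2 - i)) (n + 2)]
    have : ∀ i, n + 3 - (i + 1) = n + 2 - i := fun i => by omega
    simp [cycleValue, this]

/-- The generating function of the shifted sequence of cycle values. -/
def cycleSeries (k : ℕ) : ℝ⟦X⟧ := mk fun j => cycleValue (1 / 2) (k + j)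

lemma cycleSeries_eq (k : ℕ) :
    cycleSeries k = C (cycleValue (1 / 2) k) + X * cycleSeries (k + 1) := by
  ext n
  rcases n with _ | n
  · simp [cycleSeries]
  · simp [cycleSeries, coeff_succ_X_mul, add_assoc, add_comm 1 n]

lemma cycleSeries_quadratic : cycleSeries 0 + cycleSeries 0 ^ 2 = X ^ 2 := by
  ext n
  rw [map_add, sq (cycleSeries 0), coeff_mul, coeff_X_pow, ← cycleValue_half_add_sum n]
  simp [cycleSeries]

/-- The hypotheses read F = p + XF·H_1 and H_k = A_k + XF·H_(k+1). Unrolled, H_k = ∑_j A_(k+j)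
(XF)^j, hence F - p = A(XF), and A + A² = z² becomes the quadratic equation of the Kesten–McKay
series. -/
theorem eq_kmMoment_of_recursion {p : ℝ} {f : ℕ → ℝ} {h : ℕ → ℕ → ℝ} (hf0 : f 0 = p)
    (hf : ∀ n, f (n + 1) = ∑ m ∈ Finset.range (n + 1), f m * h (n - m) 1)
    (h0 : ∀ k, 1 ≤ k → h 0 k = cycleValue (1 / 2) k)
    (hh : ∀ n k, 1 ≤ k → h (n + 1) k = ∑ m ∈ Finset.range (n + 1), f m * h (n - m) (k + 1))
    (n : ℕ) : f n = kmMoment p n := by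
  set F : ℝ⟦X⟧ := mk f with hFdef
  set H : ℕ → ℝ⟦X⟧ := fun k => mk fun n => h n k with hHdef
  have hF0 : constantCoeff F = p := by simp [hFdef, hf0]
  have hF : F = C p + X * F * H 1 := by
    ext n
    rcases n with _ | n
    · simp [hFdef, hf0, mul_assoc]
    · rw [map_add, mul_assoc, coeff_succ_X_mul, coeff_mul, coeff_mk, hf,
        Finset.Nat.sum_antidiagonal_eq_sum_range_succ_mk]
      simp [hFdef, hHdef]
  have hH : ∀ k, 1 ≤ k → H k = C (cycleValue (1 / 2) k) + X * F * H (k + 1) := by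
    intro k hk
    ext n
    rcases n with _ | n
    · simp [hHdef, h0 k hk, mul_assoc]
    · rw [map_add, mul_assoc, coeff_succ_X_mul, coeff_mul, coeff_mk, hh n k hk,
        Finset.Nat.sum_antidiagonal_eq_sum_range_succ_mk]
      simp [hFdef, hHdef]
  have hs : HasSubst (X * F) := HasSubst.of_constantCoeff_zero' (by simp)
  set G : ℕ → ℝ⟦X⟧ := fun k => substAlgHom hs (cycleSeries k) with hGdef
  have hG : ∀ k, G k = C (cycleValue (1 / 2) k) + X * F * G (k + 1) := by
    intro k
    simp only [hGdef]
    conv_lhs => rw [cycleSeries_eq, map_add, map_mul, substAlgHom_X]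
    rw [coe_substAlgHom, subst_C]
    rfl
  -- `H` and `G` obey the same recursion in k, which has no initial value; but each unrolling
  -- contributes a factor X, so their difference is divisible by every power of X.
  have hHG : ∀ N k, 1 ≤ k → X ^ N ∣ H k - G k := by
    intro N
    induction N with
    | zero => intro k _; simp
    | succ N ih =>
      intro k hk
      rw [hH k hk, hG k, add_sub_add_left_eq_sub, ← mul_sub, pow_succ', mul_assoc]
      exact mul_dvd_mul_left _ (dvd_mul_of_dvd_right (ih (k + 1) (by omega)) _)
  have hHG1 : H 1 = G 1 := by
    rw [← sub_eq_zero]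
    ext n
    exact X_pow_dvd_iff.1 (hHG (n + 1) 1 le_rfl) n (by omega)
  have hFG : F - C p = G 0 := by
    rw [hG 0, zero_add, ← hHG1]
    nth_rewrite 1 [hF]
    simp [cycleValue]
  have hquad : (F - C p) + (F - C p) ^ 2 = (X * F) ^ 2 := by
    have := congrArg (substAlgHom hs) cycleSeries_quadratic
    rw [map_add, map_pow, map_pow, substAlgHom_X] at this
    rw [hFG]; exact this
  have := quadratic_series_unique hF0 (by simp [kmMoment]) hquad (km_series_quadratic p)
  simpa [hFdef] using congrArg (coeff n) this

end GeneratingFunctions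

/-! ### Closed walks on an interval and their cycles -/

/-- The cyclic successor in the interval `[a, b)`. -/
def cyclicSucc (a b e : ℕ) : ℕ := if e + 1 = b then a else e + 1

/-- `C` is the edge set of a simple cycle of the closed walk `v a, v (a + 1), …, v (b - 1), v a`,
whose edges are the elements of `[a, b)`. -/
def IsWalkCycle {α : Type*} (v : ℕ → α) (a b : ℕ) (C : Finset ℕ) : Prop :=
  ∃ (s : ℕ) (e : ℕ → ℕ), 0 < s ∧ (∀ k < s, a ≤ e k ∧ e k < b) ∧
    (∀ k < s, v (cyclicSucc a b (e k)) = v (e (cyclicSucc 0 s k))) ∧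
    (∀ i < s, ∀ j < s, v (e i) = v (e j) → i = j) ∧ (Finset.range s).image e = C

lemma cyclicSucc_lt {s k : ℕ} (hk : k < s) : cyclicSucc 0 s k < s := by
  unfold cyclicSucc; split_ifs <;> omega

lemma cyclicSucc_mem {a b e : ℕ} (h1 : a ≤ e) (h2 : e < b) :
    a ≤ cyclicSucc a b e ∧ cyclicSucc a b e < b := by
  unfold cyclicSucc; split_ifs <;> omega

lemma cyclicSucc_last {a b : ℕ} (h : a < b) : cyclicSucc a b (b - 1) = a := by
  unfold cyclicSucc; rw [if_pos (by omega)]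

lemma cyclicSucc_of_lt {a b e : ℕ} (h : e + 1 < b) : cyclicSucc a b e = e + 1 := by
  unfold cyclicSucc; rw [if_neg (by omega)]

section WalkCycle

variable {α β : Type*} {v : ℕ → α} {a b m : ℕ} {C : Finset ℕ}

lemma IsWalkCycle.subset (h : IsWalkCycle v a b C) : C ⊆ Finset.Ico a b := by
  obtain ⟨s, e, -, he, -, -, rfl⟩ := h
  intro x hx
  obtain ⟨k, hk, rfl⟩ := Finset.mem_image.1 hx
  exact Finset.mem_Ico.2 (he k (Finset.mem_range.1 hk))

lemma IsWalkCycle.nonempty (h : IsWalkCycle v a b C) : C.Nonempty := by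
  obtain ⟨s, e, hs, -, -, -, rfl⟩ := h
  exact ⟨e 0, Finset.mem_image_of_mem _ (Finset.mem_range.2 hs)⟩

/-- A cycle can be listed so that a given edge comes last. -/
lemma IsWalkCycle.exists_last (h : IsWalkCycle v a b C) {c : ℕ} (hc : c ∈ C) :
    ∃ (s : ℕ) (e : ℕ → ℕ), (∀ k < s + 1, a ≤ e k ∧ e k < b) ∧
    (∀ k < s, v (cyclicSucc a b (e k)) = v (e (k + 1))) ∧
    v (cyclicSucc a b c) = v (e 0) ∧ e s = c ∧
    (∀ i < s + 1, ∀ j < s + 1, v (e i) = v (e j) → i = j) ∧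
    (Finset.range (s + 1)).image e = C := by
  obtain ⟨s, e, hs, he, hstep, hinj, rfl⟩ := h
  obtain ⟨d, hd, rfl⟩ := Finset.mem_image.1 hc
  rw [Finset.mem_range] at hd
  obtain ⟨s, rfl⟩ := Nat.exists_eq_add_of_le' hs
  set idx : ℕ → ℕ := fun k => if k + (d + 1) < s + 1 then k + (d + 1) else k + d - s with hidx
  have hlt : ∀ k < s + 1, idx k < s + 1 := by
    intro k hk; simp only [hidx]; split_ifs <;> omega
  have hcomm : ∀ k < s + 1, idx (cyclicSucc 0 (s + 1) k) = cyclicSucc 0 (s + 1) (idx k) := by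
    intro k hk; simp only [hidx, cyclicSucc]; split_ifs <;> omega
  have hidxinj : ∀ i < s + 1, ∀ j < s + 1, idx i = idx j → i = j := by
    intro i hi j hj; simp only [hidx]; split_ifs <;> omega
  have hlast : idx s = d := by simp only [hidx]; split_ifs <;> omega
  have hstep' : ∀ k < s + 1, v (cyclicSucc a b (e (idx k))) = v (e (idx (cyclicSucc 0 (s + 1) k))) :=
    fun k hk => by rw [hcomm k hk]; exact hstep _ (hlt k hk)
  refine ⟨s, fun k => e (idx k), fun k hk => he _ (hlt k hk), fun k hk => ?_, ?_, ?_,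
    fun i hi j hj hij => hidxinj i hi j hj (hinj _ (hlt i hi) _ (hlt j hj) hij), ?_⟩
  · rw [hstep' k (by omega), cyclicSucc_of_lt (by omega)]
  · have := hstep' s (by omega)
    rwa [hlast, show cyclicSucc 0 (s + 1) s = 0 from if_pos rfl] at this
  · simp only [hlast]
  · have hsurj : (Finset.range (s + 1)).image idx = Finset.range (s + 1) := by
      apply Finset.eq_of_subset_of_card_le
      · intro x hx
        obtain ⟨k, hk, rfl⟩ := Finset.mem_image.1 hx
        exact Finset.mem_range.2 (hlt k (Finset.mem_range.1 hk))
      · rw [Finset.card_image_of_injOn]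
        intro i hi j hj
        exact hidxinj i (by simpa using hi) j (by simpa using hj)
    conv_rhs => rw [← hsurj, Finset.image_image]
    rfl

lemma isWalkCycle_of_last {s : ℕ} {e : ℕ → ℕ} (he : ∀ k < s + 1, a ≤ e k ∧ e k < b)
    (hstep : ∀ k < s, v (cyclicSucc a b (e k)) = v (e (k + 1)))
    (hlast : v (cyclicSucc a b (e s)) = v (e 0))
    (hinj : ∀ i < s + 1, ∀ j < s + 1, v (e i) = v (e j) → i = j) :
    IsWalkCycle v a b ((Finset.range (s + 1)).image e) := by
  refine ⟨s + 1, e, by omega, he, fun k hk => ?_, hinj, rfl⟩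
  rcases Nat.lt_succ_iff_lt_or_eq.1 hk with h | rfl
  · rw [cyclicSucc_of_lt (a := 0) (e := k) (by omega)]; exact hstep k h
  · rw [show cyclicSucc 0 (k + 1) k = 0 from if_pos rfl]; exact hlast

/-- Otherwise the property would propagate from i once around the cycle and reach j. -/
lemma exists_cyclic_exit {s : ℕ} {P : ℕ → Prop} {i j : ℕ} (hi : i < s) (hj : j < s) (hPi : P i)
    (hPj : ¬P j) : ∃ k < s, P k ∧ ¬P (cyclicSucc 0 s k) := by
  by_contra! hcon
  have up : ∀ i d, i + d < s → P i → P (i + d) := by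
    intro i d
    induction d with
    | zero => intro _ h; exact h
    | succ d ih =>
      intro h hP
      have h2 := hcon (i + d) (by omega) (ih (by omega) hP)
      rwa [cyclicSucc_of_lt (by omega)] at h2
  have h1 := up i (s - 1 - i) (by omega) hPi
  rw [show i + (s - 1 - i) = s - 1 by omega] at h1
  have h2 := hcon (s - 1) (by omega) h1
  rw [cyclicSucc_last (by omega)] at h2
  have h3 := up 0 j (by omega) h2
  rw [zero_add] at h3
  exact hPj h3

/-- `m` is a cut point: the walk on `[a, b)` returns to its starting vertex at `m`, and the vertices
after `m` differ from those up to `m`. -/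
structure IsCutPoint (v : ℕ → α) (a b m : ℕ) : Prop where
  le : a ≤ m
  lt : m < b
  eq : v m = v a
  ne : ∀ i j, a ≤ i → i ≤ m → m < j → j < b → v i ≠ v j

lemma IsCutPoint.eq_of_mem (h : IsCutPoint v a b m) {i : ℕ} (hi : m ≤ i) (hib : i < b)
    (hv : v i = v a) : i = m := by
  by_contra hne
  exact h.ne a i le_rfl h.le (by omega) hib hv.symm

/-- The two sides of the cut share only the vertex v a. A cycle with edges on both sides crosses
over in each direction, so it would visit v a twice: at the edge m when it enters the right side,
and at an edge below m when it enters the left side. -/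
lemma IsCutPoint.subset_or_subset (h : IsCutPoint v a b m) (hC : IsWalkCycle v a b C) :
    C ⊆ Finset.Ico a m ∨ C ⊆ Finset.Ico m b := by
  obtain ⟨s, e, hs, he, hstep, hinj, rfl⟩ := hC
  by_contra hcon
  rw [not_or, Finset.not_subset, Finset.not_subset] at hcon
  obtain ⟨⟨x, hx, hx'⟩, ⟨y, hy, hy'⟩⟩ := hcon
  obtain ⟨i, hi, rfl⟩ := Finset.mem_image.1 hx
  obtain ⟨j, hj, rfl⟩ := Finset.mem_image.1 hy
  rw [Finset.mem_range] at hi hj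
  have hi2 := he i hi
  have hj2 := he j hj
  rw [Finset.mem_Ico] at hx' hy'
  obtain ⟨k, hk, hk1, hk2⟩ := exists_cyclic_exit (P := fun k => e k < m) hj hi (by omega) (by omega)
  obtain ⟨l, hl, hl1, hl2⟩ := exists_cyclic_exit (P := fun k => m ≤ e k) hi hj (by omega) (by omega)
  rw [not_lt] at hk2
  rw [not_le] at hl2
  have hk3 := he _ (cyclicSucc_lt hk)
  have hl3 := he _ (cyclicSucc_lt hl)
  have hk4 := hstep k hk
  have hl4 := hstep l hl
  have hlt := h.lt
  have hle := h.le
  have hk5 : e (cyclicSucc 0 s k) = m := by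
    by_contra hne
    rw [cyclicSucc_of_lt (a := a) (by omega)] at hk4
    exact h.ne (e k + 1) _ (by have := he k hk; omega) (by omega) (by omega) hk3.2 hk4
  have hl5 : v (e (cyclicSucc 0 s l)) = v a := by
    by_cases hlast : e l + 1 = b
    · rw [← hl4, cyclicSucc, if_pos hlast]
    · rw [cyclicSucc_of_lt (a := a) (by have := he l hl; omega)] at hl4
      exact absurd hl4.symm (h.ne _ _ hl3.1 hl2.le (by omega) (by have := he l hl; omega))
  have h6 := hinj _ (cyclicSucc_lt hk) _ (cyclicSucc_lt hl) (by rw [hk5, hl5, h.eq])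
  rw [← h6] at hl2
  omega

/-- The successor of m - 1 is m in one interval and a in the other, and these are the same vertex.
-/
lemma IsCutPoint.isWalkCycle_left_iff (h : IsCutPoint v a b m) (hC : C ⊆ Finset.Ico a m) :
    IsWalkCycle v a b C ↔ IsWalkCycle v a m C := by
  have hlt := h.lt
  have hv : ∀ x, x < m → v (cyclicSucc a b x) = v (cyclicSucc a m x) := by
    intro x hx
    rw [cyclicSucc_of_lt (by omega)]
    unfold cyclicSucc
    split_ifs with h1
    · rw [h1, h.eq]
    · rfl
  constructor
  · rintro ⟨s, e, hs, he, hstep, hinj, rfl⟩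
    have he' : ∀ k < s, a ≤ e k ∧ e k < m := fun k hk =>
      Finset.mem_Ico.1 (hC (Finset.mem_image_of_mem _ (Finset.mem_range.2 hk)))
    exact ⟨s, e, hs, he', fun k hk => by rw [← hv _ (he' k hk).2]; exact hstep k hk, hinj, rfl⟩
  · rintro ⟨s, e, hs, he, hstep, hinj, rfl⟩
    exact ⟨s, e, hs, fun k hk => ⟨(he k hk).1, (he k hk).2.trans hlt⟩,
      fun k hk => by rw [hv _ (he k hk).2]; exact hstep k hk, hinj, rfl⟩

/-- On the right side only the last edge returns to v a. A cycle without it never visits v a, so it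
does not use the edge m. -/
lemma IsCutPoint.isWalkCycle_right_iff (h : IsCutPoint v a b m) (hC : C ⊆ Finset.Ico m b)
    (hlast : b - 1 ∉ C) : IsWalkCycle v a b C ↔ IsWalkCycle v (m + 1) b C := by
  have hle := h.le
  have hlt := h.lt
  constructor
  · rintro ⟨s, e, hs, he, hstep, hinj, rfl⟩
    have hmem : ∀ k < s, m ≤ e k ∧ e k + 1 < b := by
      intro k hk
      have h1 := Finset.mem_image_of_mem e (Finset.mem_range.2 hk)
      have h2 := Finset.mem_Ico.1 (hC h1)
      have h3 : e k ≠ b - 1 := fun h => hlast (h ▸ h1)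
      omega
    have hm : ∀ k < s, m < e (cyclicSucc 0 s k) := by
      intro k hk
      have h1 := hstep k hk
      rw [cyclicSucc_of_lt (hmem k hk).2] at h1
      have h2 := hmem _ (cyclicSucc_lt hk)
      by_contra hne
      have h3 : e (cyclicSucc 0 s k) = m := by omega
      rw [h3] at h1
      exact h.ne m (e k + 1) hle le_rfl (by have := hmem k hk; omega) (hmem k hk).2 h1.symm
    have hm' : ∀ k < s, m < e k := by
      intro k hk
      rcases Nat.eq_zero_or_pos k with rfl | hk0
      · have := hm (s - 1) (by omega)
        rwa [cyclicSucc_last hs] at this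
      · have := hm (k - 1) (by omega)
        rwa [cyclicSucc_of_lt (by omega), Nat.sub_add_cancel hk0] at this
    refine ⟨s, e, hs, fun k hk => ⟨hm' k hk, (he k hk).2⟩, fun k hk => ?_, hinj, rfl⟩
    rw [← hstep k hk, cyclicSucc_of_lt (hmem k hk).2, cyclicSucc_of_lt (hmem k hk).2]
  · rintro ⟨s, e, hs, he, hstep, hinj, rfl⟩
    refine ⟨s, e, hs, fun k hk => ⟨by have := he k hk; omega, (he k hk).2⟩, fun k hk => ?_, hinj, rfl⟩
    have h1 := Finset.mem_image_of_mem e (Finset.mem_range.2 hk)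
    have h3 : e k ≠ b - 1 := fun h => hlast (h ▸ h1)
    have h4 := he k hk
    rw [← hstep k hk, cyclicSucc_of_lt (by omega), cyclicSucc_of_lt (by omega)]

/-- After the last edge the cycle is at v a, and m is the only edge of the right side that starts
there. Deleting m is possible because in [m+1, b) the last edge goes directly to v (m+1), the end of
the edge m. -/
lemma IsCutPoint.exists_of_last_mem (h : IsCutPoint v a b m) (hmb : m + 1 < b)
    (hC : C ⊆ Finset.Ico m b) (hlast : b - 1 ∈ C) (hcyc : IsWalkCycle v a b C) :
    ∃ C', IsWalkCycle v (m + 1) b C' ∧ b - 1 ∈ C' ∧ C = insert m C' := by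
  have hle := h.le
  have hm : m ∈ C := by
    obtain ⟨s, e, he, -, h0, -, -, rfl⟩ := hcyc.exists_last hlast
    rw [cyclicSucc_last (by omega)] at h0
    have h1 := Finset.mem_image_of_mem e (Finset.mem_range.2 (Nat.succ_pos s))
    have h2 := Finset.mem_Ico.1 (hC h1)
    rw [h.eq_of_mem h2.1 h2.2 h0.symm] at h1
    exact h1
  obtain ⟨t, e, he, hstep, h0, het, hinj, rfl⟩ := hcyc.exists_last hm
  have hmem : ∀ k < t + 1, m ≤ e k ∧ e k < b := fun k hk =>
    Finset.mem_Ico.1 (hC (Finset.mem_image_of_mem _ (Finset.mem_range.2 hk)))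
  have hne : ∀ k < t, m < e k := by
    intro k hk
    have h1 := hmem k (by omega)
    by_contra h2
    have h3 := hinj k (by omega) t (by omega) (by rw [het]; congr 1; omega)
    omega
  rw [cyclicSucc_of_lt hmb] at h0
  -- In the listing that ends with m, the edge b - 1 can only come immediately before m.
  have hnext : ∀ k < t, e k = b - 1 → k + 1 = t := by
    intro k hk hek
    have h1 := hstep k hk
    rw [hek, cyclicSucc_last (by omega)] at h1
    have h2 := hmem (k + 1) (by omega)
    have h3 := h.eq_of_mem h2.1 h2.2 h1.symm
    exact hinj _ (by omega) _ (by omega) (by rw [h3, het])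
  obtain ⟨i, hi, hib⟩ := Finset.mem_image.1 hlast
  rw [Finset.mem_range] at hi
  have hit : i ≠ t := by rintro rfl; omega
  have hi1 := hnext i (by omega) hib
  obtain ⟨t, rfl⟩ : ∃ t', t = t' + 1 := ⟨i, hi1.symm⟩
  obtain rfl : i = t := by omega
  refine ⟨(Finset.range (i + 1)).image e, isWalkCycle_of_last
    (fun k hk => ⟨hne k hk, (hmem k (by omega)).2⟩) (fun k hk => ?_) ?_
    (fun x hx y hy => hinj x (by omega) y (by omega)), ?_, ?_⟩
  · have h1 : e k ≠ b - 1 := fun h => by have := hnext k (by omega) h; omega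
    have h2 := hmem k (by omega)
    rw [← hstep k (by omega), cyclicSucc_of_lt (by omega), cyclicSucc_of_lt (by omega)]
  · rw [hib, cyclicSucc_last (by omega), h0]
  · rw [← hib]; exact Finset.mem_image_of_mem _ (Finset.mem_range.2 (by omega))
  · rw [Finset.range_add_one, Finset.image_insert, het]

lemma IsCutPoint.isWalkCycle_insert (h : IsCutPoint v a b m) (hmb : m + 1 < b)
    (hcyc : IsWalkCycle v (m + 1) b C) (hlast : b - 1 ∈ C) : IsWalkCycle v a b (insert m C) := by
  have hle := h.le
  obtain ⟨t, e, he, hstep, h0, het, hinj, rfl⟩ := hcyc.exists_last hlast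
  rw [cyclicSucc_last hmb] at h0
  set e' : ℕ → ℕ := fun k => if k < t + 1 then e k else m with he'
  have hlow : ∀ k < t + 1, e' k = e k := fun k hk => if_pos hk
  have htop : e' (t + 1) = m := if_neg (by omega)
  have hset : insert m ((Finset.range (t + 1)).image e) = (Finset.range (t + 1 + 1)).image e' := by
    rw [Finset.range_add_one (n := t + 1), Finset.image_insert, htop]
    congr 1
    exact Finset.image_congr fun k hk => (hlow k (by simpa using hk)).symm
  rw [hset]
  refine isWalkCycle_of_last (fun k hk => ?_) (fun k hk => ?_) ?_ (fun i hi j hj hij => ?_)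
  · rcases Nat.lt_succ_iff_lt_or_eq.1 hk with h1 | rfl
    · rw [hlow k h1]; have := he k h1; omega
    · rw [htop]; exact ⟨hle, h.lt⟩
  · rw [hlow k hk]
    rcases Nat.lt_succ_iff_lt_or_eq.1 hk with h1 | rfl
    · rw [hlow _ (by omega), ← hstep k h1]
      have h2 : e k ≠ b - 1 := fun h3 => by
        have := hinj k hk t (by omega) (by rw [h3, het])
        omega
      have h3 := he k hk
      rw [cyclicSucc_of_lt (by omega), cyclicSucc_of_lt (by omega)]
    · rw [htop, het, cyclicSucc_last (by omega), h.eq]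
  · rw [htop, hlow 0 (by omega), cyclicSucc_of_lt hmb, h0]
  · have hne : ∀ k < t + 1, v (e k) ≠ v m := fun k hk h1 =>
      h.ne m (e k) hle le_rfl (he k hk).1 (he k hk).2 h1.symm
    rcases Nat.lt_succ_iff_lt_or_eq.1 hi with h1 | rfl <;>
      rcases Nat.lt_succ_iff_lt_or_eq.1 hj with h2 | rfl
    · rw [hlow i h1, hlow j h2] at hij
      exact hinj i h1 j h2 hij
    · rw [hlow i h1, htop] at hij
      exact absurd hij (hne i h1)
    · rw [hlow j h2, htop] at hij
      exact absurd hij.symm (hne j h2)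
    · rfl

open Classical in
/-- The edge sets of the simple cycles of a closed walk on `[a, b)`. -/
def walkCycles (v : ℕ → α) (a b : ℕ) : Finset (Finset ℕ) :=
  (Finset.Ico a b).powerset.filter (IsWalkCycle v a b)

lemma mem_walkCycles : C ∈ walkCycles v a b ↔ IsWalkCycle v a b C := by
  simp only [walkCycles, Finset.mem_filter, Finset.mem_powerset]
  exact ⟨fun h => h.2, fun h => ⟨h.subset, h⟩⟩

lemma IsCutPoint.isWalkCycle_singleton (h : IsCutPoint v a (m + 1) m) :
    IsWalkCycle v a (m + 1) {m} := by
  have h1 := isWalkCycle_of_last (v := v) (a := a) (b := m + 1) (s := 0) (e := fun _ => m)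
    (fun _ _ => ⟨h.le, h.lt⟩) (fun k hk => by omega) ?_ (fun i hi j hj _ => by omega)
  · simpa using h1
  · rw [cyclicSucc, if_pos rfl, h.eq]

lemma IsCutPoint.prod_walkCycles_of_eq (h : IsCutPoint v a (m + 1) m) (g : Finset ℕ → ℝ) :
    ∏ C ∈ walkCycles v a (m + 1), g C = (∏ C ∈ walkCycles v a m, g C) * g {m} := by
  have hset : walkCycles v a (m + 1) = insert {m} (walkCycles v a m) := by
    ext C
    rw [Finset.mem_insert, mem_walkCycles, mem_walkCycles]
    constructor
    · intro hC
      rcases h.subset_or_subset hC with h1 | h1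
      · exact Or.inr ((h.isWalkCycle_left_iff h1).1 hC)
      · left
        rw [Nat.Ico_succ_singleton, Finset.subset_singleton_iff] at h1
        exact h1.resolve_left hC.nonempty.ne_empty
    · rintro (rfl | hC)
      · exact h.isWalkCycle_singleton
      · exact (h.isWalkCycle_left_iff hC.subset).2 hC
  rw [hset, Finset.prod_insert, mul_comm]
  intro hmem
  have := (mem_walkCycles.1 hmem).subset (Finset.mem_singleton_self m)
  simp at this

/-- Each cycle lies on one side of the cut. Those on the right correspond to cycles of the shortened
walk on [m+1, b), the edge m being restored exactly when the last edge is used; erasing m is the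
inverse. -/
lemma IsCutPoint.prod_walkCycles (h : IsCutPoint v a b m) (hmb : m + 1 < b) (g : Finset ℕ → ℝ) :
    ∏ C ∈ walkCycles v a b, g C = (∏ C ∈ walkCycles v a m, g C) *
      ∏ C ∈ walkCycles v (m + 1) b, g (if b - 1 ∈ C then insert m C else C) := by
  classical
  set φ : Finset ℕ → Finset ℕ := fun C => if b - 1 ∈ C then insert m C else C with hφ
  have hset : walkCycles v a b = walkCycles v a m ∪ (walkCycles v (m + 1) b).image φ := by
    ext C
    rw [Finset.mem_union, mem_walkCycles, mem_walkCycles, Finset.mem_image]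
    constructor
    · intro hC
      rcases h.subset_or_subset hC with h1 | h1
      · exact Or.inl ((h.isWalkCycle_left_iff h1).1 hC)
      · right
        by_cases hlast : b - 1 ∈ C
        · obtain ⟨C', h2, h3, rfl⟩ := h.exists_of_last_mem hmb h1 hlast hC
          exact ⟨C', mem_walkCycles.2 h2, if_pos h3⟩
        · exact ⟨C, mem_walkCycles.2 ((h.isWalkCycle_right_iff h1 hlast).1 hC), if_neg hlast⟩
    · rintro (hC | ⟨C', hC', rfl⟩)
      · exact (h.isWalkCycle_left_iff hC.subset).2 hC
      · rw [mem_walkCycles] at hC'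
        by_cases hlast : b - 1 ∈ C'
        · simp only [hφ, if_pos hlast]
          exact h.isWalkCycle_insert hmb hC' hlast
        · simp only [hφ, if_neg hlast]
          refine (h.isWalkCycle_right_iff (hC'.subset.trans ?_) hlast).2 hC'
          exact Finset.Ico_subset_Ico_left (by omega)
  have hm : ∀ C ∈ walkCycles v (m + 1) b, m ∉ C := fun C hC hmem => by
    have := (mem_walkCycles.1 hC).subset hmem
    simp at this
  have hinj : Set.InjOn φ (walkCycles v (m + 1) b) := by
    intro C hC D hD hCD
    have h1 : ∀ E ∈ walkCycles v (m + 1) b, (φ E).erase m = E := by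
      intro E hE
      simp only [hφ]
      split_ifs
      · exact Finset.erase_insert (hm E hE)
      · exact Finset.erase_eq_of_notMem (hm E hE)
    rw [← h1 C hC, ← h1 D hD, hCD]
  rw [hset, Finset.prod_union, Finset.prod_image hinj]
  rw [Finset.disjoint_left]
  intro C hC hC'
  obtain ⟨D, hD, rfl⟩ := Finset.mem_image.1 hC'
  rw [mem_walkCycles] at hC hD
  obtain ⟨x, hx⟩ := hD.nonempty
  have h1 := hD.subset hx
  have h2 : x ∈ φ D := by
    simp only [hφ]; split_ifs
    · exact Finset.mem_insert_of_mem hx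
    · exact hx
  have h3 := hC.subset h2
  rw [Finset.mem_Ico] at h1 h3
  omega

lemma isWalkCycle_congr {w : ℕ → β}
    (h : ∀ i j, a ≤ i → i < b → a ≤ j → j < b → (v i = v j ↔ w i = w j)) :
    IsWalkCycle v a b C ↔ IsWalkCycle w a b C := by
  constructor <;>
  · rintro ⟨s, e, hs, he, hstep, hinj, rfl⟩
    refine ⟨s, e, hs, he, fun k hk => ?_, fun i hi j hj hij => hinj i hi j hj ?_, rfl⟩
    · have h1 := he _ (cyclicSucc_lt hk)
      have h2 := cyclicSucc_mem (he k hk).1 (he k hk).2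
      have h3 := h _ _ h2.1 h2.2 h1.1 h1.2
      have h4 := hstep k hk
      tauto
    · have h3 := h _ _ (he i hi).1 (he i hi).2 (he j hj).1 (he j hj).2
      tauto

lemma isWalkCycle_shift (c n : ℕ) :
    IsWalkCycle (fun i => v (c + i)) 0 n C ↔ IsWalkCycle v c (c + n) (C.map (addLeftEmbedding c)) := by
  have hsucc : ∀ x, cyclicSucc c (c + n) (c + x) = c + cyclicSucc 0 n x := by
    intro x; unfold cyclicSucc; split_ifs <;> omega
  constructor
  · rintro ⟨s, e, hs, he, hstep, hinj, rfl⟩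
    refine ⟨s, fun k => c + e k, hs, fun k hk => by have := he k hk; dsimp only; omega,
      fun k hk => by rw [hsucc]; exact hstep k hk, hinj, ?_⟩
    rw [Finset.map_eq_image, Finset.image_image]; rfl
  · rintro ⟨s, e, hs, he, hstep, hinj, hC⟩
    have he' : ∀ k < s, c + (e k - c) = e k := fun k hk => by have := he k hk; omega
    refine ⟨s, fun k => e k - c, hs, fun k hk => by have := he k hk; dsimp only; omega,
      fun k hk => ?_, fun i hi j hj hij => hinj i hi j hj ?_, ?_⟩
    · simp only
      rw [he' _ (cyclicSucc_lt hk), ← hsucc, he' k hk]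
      exact hstep k hk
    · simp only [he' i hi, he' j hj] at hij
      exact hij
    · apply Finset.map_injective (addLeftEmbedding c)
      rw [← hC, Finset.map_eq_image, Finset.image_image]
      exact Finset.image_congr fun k hk => he' k (by simpa using hk)

lemma prod_walkCycles_shift (v : ℕ → α) (c n : ℕ) (g : Finset ℕ → ℝ) :
    ∏ C ∈ walkCycles v c (c + n), g C
      = ∏ C ∈ walkCycles (fun i => v (c + i)) 0 n, g (C.map (addLeftEmbedding c)) := by
  classical
  have hset : walkCycles v c (c + n)
      = (walkCycles (fun i => v (c + i)) 0 n).image (Finset.map (addLeftEmbedding c)) := by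
    ext C
    simp only [Finset.mem_image, mem_walkCycles, isWalkCycle_shift]
    constructor
    · intro hC
      have h1 : (C.image fun x => x - c).map (addLeftEmbedding c) = C := by
        rw [Finset.map_eq_image, Finset.image_image]
        conv_rhs => rw [← Finset.image_id (s := C)]
        refine Finset.image_congr fun x hx => ?_
        have := Finset.mem_Ico.1 (hC.subset hx)
        simp; omega
      exact ⟨_, by rwa [h1], h1⟩
    · rintro ⟨D, hD, rfl⟩
      exact hD
  rw [hset, Finset.prod_image ((Finset.map_injective _).injOn)]

end WalkCycle

/-! ### Weights of closed walks -/

section Weights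

variable {α β : Type*}

/-- The vertex `v i` is visited for the first time at `i` by the walk starting at `a`. -/
def IsFirstVisit (v : ℕ → α) (a i : ℕ) : Prop := ∀ j, a ≤ j → j < i → v j ≠ v i

open Classical in
/-- The weight of the closed walk `v` on `[a, b)`: a factor `p` for each vertex, and a factor for
each cycle, where the length of the cycle through the last edge is increased by `k`. -/
def walkWeight (p : ℝ) (k : ℕ) (v : ℕ → α) (a b : ℕ) : ℝ :=
  (∏ i ∈ Finset.Ico a b, if IsFirstVisit v a i then p else 1) *
    ∏ C ∈ walkCycles v a b, cycleValue (1 / 2) (C.card + if b - 1 ∈ C then k else 0)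

lemma walkWeight_congr (p : ℝ) (k : ℕ) {v : ℕ → α} {w : ℕ → β} {a b : ℕ}
    (h : ∀ i j, a ≤ i → i < b → a ≤ j → j < b → (v i = v j ↔ w i = w j)) :
    walkWeight p k v a b = walkWeight p k w a b := by
  have h1 : walkCycles v a b = walkCycles w a b := by
    ext C; rw [mem_walkCycles, mem_walkCycles, isWalkCycle_congr h]
  unfold walkWeight
  rw [h1]
  congr 1
  refine Finset.prod_congr rfl fun i hi => ?_
  rw [Finset.mem_Ico] at hi
  congr 1
  apply propext
  refine forall_congr' fun j => forall_congr' fun hj => forall_congr' fun hji => ?_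
  rw [Ne, Ne, h j i hj (by omega) hi.1 hi.2]

lemma walkWeight_shift (p : ℝ) (k : ℕ) (v : ℕ → α) (c n : ℕ) (hn : 0 < n) :
    walkWeight p k v c (c + n) = walkWeight p k (fun i => v (c + i)) 0 n := by
  unfold walkWeight
  rw [prod_walkCycles_shift]
  congr 1
  · rw [Finset.prod_Ico_eq_prod_range, show c + n - c = n by omega, ← Finset.range_eq_Ico]
    refine Finset.prod_congr rfl fun i _ => ?_
    congr 1
    apply propext
    constructor
    · intro h j _ hj; exact h (c + j) (by omega) (by omega)
    · intro h j hj hji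
      have h1 : v (c + (j - c)) ≠ v (c + i) := h (j - c) (by omega) (by omega)
      rwa [show c + (j - c) = j by omega] at h1
  · refine Finset.prod_congr rfl fun C _ => ?_
    have h1 : c + n - 1 ∈ C.map (addLeftEmbedding c) ↔ n - 1 ∈ C := by
      rw [show c + n - 1 = addLeftEmbedding c (n - 1) by simp; omega, Finset.mem_map']
    rw [Finset.card_map]
    simp only [h1]

/-- The sides share no vertex, so first visits are counted on each side separately. The position m
revisits v a, unless m = a, when the left side is empty and m itself supplies the factor. -/
lemma IsCutPoint.prod_first {v : ℕ → α} {a b m : ℕ} (h : IsCutPoint v a b m) (p : ℝ) :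
    (∏ i ∈ Finset.Ico a b, open Classical in if IsFirstVisit v a i then p else 1)
      = (∏ i ∈ Finset.Ico a m, open Classical in
          if IsFirstVisit v a i then p else 1) *
        (if m = a then p else 1) * ∏ i ∈ Finset.Ico (m + 1) b, open Classical in
          if IsFirstVisit v (m + 1) i then p else 1 := by
  have hle := h.le
  have hlt := h.lt
  rw [← Finset.prod_Ico_consecutive _ hle hlt.le, Finset.prod_eq_prod_Ico_succ_bot hlt, ← mul_assoc]
  congr 1
  · congr 1
    congr 1
    apply propext
    constructor
    · intro h1
      by_contra hne
      exact h1 a le_rfl (by omega) h.eq.symm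
    · rintro rfl j h1 h2; omega
  · refine Finset.prod_congr rfl fun i hi => ?_
    rw [Finset.mem_Ico] at hi
    congr 1
    apply propext
    constructor
    · intro h1 j hj; exact h1 j (by omega)
    · intro h1 j hj hji
      rcases le_or_gt j m with h2 | h2
      · exact h.ne j i hj h2 (by omega) hi.2
      · exact h1 j h2 hji

lemma IsCutPoint.prod_left {v : ℕ → α} {a b m : ℕ} (h : IsCutPoint v a b m) (k : ℕ) :
    ∏ C ∈ walkCycles v a m, cycleValue (1 / 2) (C.card + if b - 1 ∈ C then k else 0)
      = ∏ C ∈ walkCycles v a m, cycleValue (1 / 2) (C.card + if m - 1 ∈ C then 0 else 0) := by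
  refine Finset.prod_congr rfl fun C hC => ?_
  have hlt := h.lt
  have h1 : b - 1 ∉ C := fun hmem => by
    have := Finset.mem_Ico.1 ((mem_walkCycles.1 hC).subset hmem)
    omega
  simp [h1]

/-- The weight is multiplicative at the cut. The right part loses the edge m from the cycle through
its last edge, so the correction k becomes k + 1; if the right part is empty, that cycle is the loop
at m, of corrected length k + 1. -/
lemma IsCutPoint.walkWeight_eq {v : ℕ → α} {a b m : ℕ} (h : IsCutPoint v a b m) (p : ℝ) (k : ℕ) :
    walkWeight p k v a b = walkWeight p 0 v a m * (if m = a then p else 1) *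
      if m + 1 = b then cycleValue (1 / 2) (k + 1) else walkWeight p (k + 1) v (m + 1) b := by
  have hlt := h.lt
  by_cases h1 : m + 1 = b
  · subst h1
    rw [if_pos rfl, walkWeight, h.prod_first, h.prod_walkCycles_of_eq, h.prod_left k, walkWeight]
    simp [add_comm 1 k]
    ring_nf
  · rw [if_neg h1, walkWeight, h.prod_first, h.prod_walkCycles (by omega), h.prod_left k, walkWeight,
      walkWeight]
    have h2 : ∀ C ∈ walkCycles v (m + 1) b, cycleValue (1 / 2)
        ((if b - 1 ∈ C then insert m C else C).card +
          if b - 1 ∈ (if b - 1 ∈ C then insert m C else C) then k else 0)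
        = cycleValue (1 / 2) (C.card + if b - 1 ∈ C then k + 1 else 0) := by
      intro C hC
      have hm : m ∉ C := fun hmem => by
        have := (mem_walkCycles.1 hC).subset hmem
        simp at this
      by_cases hb : b - 1 ∈ C
      · simp only [if_pos hb, Finset.card_insert_of_notMem hm,
          if_pos (Finset.mem_insert_of_mem hb)]
        congr 1; ring
      · simp only [if_neg hb]
    rw [Finset.prod_congr rfl h2]
    ring

end Weights

/-! ### Noncrossing partitions -/

section Noncrossing

variable {α β : Type*} {n : ℕ}

/-- The block of `i` as a label, as a function on `ℕ`. -/
def blockLabel (π : SetPartition n) (i : ℕ) : Finset (Fin n) :=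
  if h : i < n then π.part ⟨i, h⟩ else ∅

open Classical in
/-- The partition of `{0, …, n - 1}` into the level sets of a function. -/
def levelPartition (n : ℕ) (v : ℕ → α) : SetPartition n :=
  Finpartition.ofSetoid (Setoid.ker fun i : Fin n => v i)

lemma blockLabel_of_lt (π : SetPartition n) {i : ℕ} (h : i < n) :
    blockLabel π i = π.part ⟨i, h⟩ := dif_pos h

lemma blockLabel_eq_iff (π : SetPartition n) {i j : ℕ} (hi : i < n) (hj : j < n) :
    blockLabel π i = blockLabel π j ↔ (⟨i, hi⟩ : Fin n) ∈ π.part ⟨j, hj⟩ := by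
  rw [blockLabel_of_lt π hi, blockLabel_of_lt π hj,
    π.mem_part_iff_part_eq_part (Finset.mem_univ _) (Finset.mem_univ _)]

lemma blockLabel_levelPartition (v : ℕ → α) {i j : ℕ} (hi : i < n) (hj : j < n) :
    blockLabel (levelPartition n v) i = blockLabel (levelPartition n v) j ↔ v i = v j := by
  classical
  exact (blockLabel_eq_iff _ hi hj).trans
    (Finpartition.mem_part_ofSetoid_iff_rel.trans (Setoid.ker_def.trans eq_comm))

lemma setPartition_ext {π σ : SetPartition n}
    (h : ∀ i j, i < n → j < n →
      (blockLabel π i = blockLabel π j ↔ blockLabel σ i = blockLabel σ j)) : π = σ := by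
  have hpart : ∀ j, π.part j = σ.part j := by
    intro j
    ext i
    have := h i j i.2 j.2
    rwa [blockLabel_eq_iff π i.2 j.2, blockLabel_eq_iff σ i.2 j.2] at this
  have hsub : ∀ {π σ : SetPartition n}, (∀ j, π.part j = σ.part j) → π.parts ⊆ σ.parts := by
    intro π σ h B hB
    obtain ⟨x, hx⟩ := π.nonempty_of_mem_parts hB
    rw [← π.part_eq_of_mem hB hx, h]
    exact σ.part_mem.2 (Finset.mem_univ _)
  exact Finpartition.ext (Finset.Subset.antisymm (hsub hpart) (hsub fun j => (hpart j).symm))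

/-- The function `v` has no crossing on `[0, n)`. -/
def NoCrossing (n : ℕ) (v : ℕ → α) : Prop :=
  ∀ i j k l, i < j → j < k → k < l → l < n → v i = v k → v j = v l → v i = v j

lemma not_isCrossing_iff (π : SetPartition n) : ¬IsCrossing π ↔ NoCrossing n (blockLabel π) := by
  rw [← not_iff_not, not_not]
  constructor
  · rintro ⟨A, hA, B, hB, hAB, a₁, ha₁, a₂, ha₂, b₁, hb₁, b₂, hb₂, h1, h2, h3⟩ hnc
    have hl : ∀ {D : Finset (Fin n)}, D ∈ π.parts → ∀ x ∈ D, blockLabel π x = D := by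
      intro D hD x hx
      rw [blockLabel_of_lt π x.2]
      exact π.part_eq_of_mem hD hx
    have := hnc a₁ b₁ a₂ b₂ h1 h2 h3 b₂.2 (by rw [hl hA _ ha₁, hl hA _ ha₂])
      (by rw [hl hB _ hb₁, hl hB _ hb₂])
    rw [hl hA _ ha₁, hl hB _ hb₁] at this
    exact hAB this
  · intro h
    unfold NoCrossing at h
    push Not at h
    obtain ⟨i, j, k, l, hij, hjk, hkl, hl, hik, hjl, hne⟩ := h
    have hmem : ∀ x (hx : x < n), (⟨x, hx⟩ : Fin n) ∈ blockLabel π x := fun x hx => by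
      rw [blockLabel_of_lt π hx]; exact π.mem_part (Finset.mem_univ _)
    have hpart : ∀ x, x < n → blockLabel π x ∈ π.parts := fun x hx => by
      rw [blockLabel_of_lt π hx]; exact π.part_mem.2 (Finset.mem_univ _)
    exact ⟨_, hpart i (by omega), _, hpart j (by omega), hne, ⟨i, by omega⟩, hmem _ _,
      ⟨k, by omega⟩, by rw [hik]; exact hmem _ _, ⟨j, by omega⟩, hmem _ _, ⟨l, hl⟩,
      by rw [hjl]; exact hmem _ _, hij, hjk, hkl⟩

lemma NoCrossing.congr {v : ℕ → α} {w : ℕ → β}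
    (h : ∀ i j, i < n → j < n → (v i = v j ↔ w i = w j)) (hv : NoCrossing n v) :
    NoCrossing n w := by
  intro i j k l hij hjk hkl hl h1 h2
  rw [← h _ _ (by omega) (by omega)] at h1 h2 ⊢
  exact hv i j k l hij hjk hkl hl h1 h2

/-- The last position at which the label of `0` occurs. -/
def lastReturn (n : ℕ) (v : ℕ → α) : ℕ :=
  open Classical in Nat.findGreatest (fun i => v i = v 0) (n - 1)

lemma lastReturn_lt (hn : 0 < n) (v : ℕ → α) : lastReturn n v < n := by
  classical
  have := Nat.findGreatest_le (P := fun i => v i = v 0) (n - 1)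
  unfold lastReturn; omega

lemma lastReturn_eq (n : ℕ) (v : ℕ → α) : v (lastReturn n v) = v 0 := by
  classical
  exact Nat.findGreatest_spec (P := fun i => v i = v 0) (Nat.zero_le _) rfl

lemma ne_of_lastReturn_lt {v : ℕ → α} {i : ℕ} (h : lastReturn n v < i) (hi : i < n) :
    v i ≠ v 0 := by
  classical
  exact fun h1 => Nat.findGreatest_is_greatest (P := fun i => v i = v 0) h (by omega) h1

lemma eq_lastReturn {v : ℕ → α} {m : ℕ} (hm : m < n) (h1 : v m = v 0)
    (h2 : ∀ i, m < i → i < n → v i ≠ v 0) : lastReturn n v = m := by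
  have h3 := lastReturn_lt (by omega) v (n := n)
  rcases lt_trichotomy (lastReturn n v) m with h | h | h
  · exact absurd h1 (ne_of_lastReturn_lt h hm)
  · exact h
  · exact absurd (lastReturn_eq n v) (h2 _ h h3)

/-- A label occurring both before and after the last return, and different from the label of 0,
would cross the pair formed by 0 and the last return. -/
lemma NoCrossing.isCutPoint {v : ℕ → α} (hv : NoCrossing n v) (hn : 0 < n) :
    IsCutPoint v 0 n (lastReturn n v) where
  le := Nat.zero_le _
  lt := lastReturn_lt hn v
  eq := lastReturn_eq n v
  ne := by
    intro i j _ him hmj hjn hij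
    have h1 := ne_of_lastReturn_lt hmj hjn
    have h2 := lastReturn_eq n v
    have h3 : v i ≠ v 0 := by rwa [hij]
    have hi0 : 0 < i := Nat.pos_of_ne_zero fun h => h3 (by rw [h])
    have him' : i < lastReturn n v := lt_of_le_of_ne him fun h => h3 (by rw [h, h2])
    exact h3 (hv 0 i (lastReturn n v) j hi0 him' hmj hjn h2.symm hij).symm

/-- Glue labels of `[0, m)` and of the positions after `m`, where `m` gets the label of `0`. -/
def glueLabel (m : ℕ) (v : ℕ → α) (w : ℕ → β) (i : ℕ) : α ⊕ β :=
  if i < m then Sum.inl (v i) else if i = m then Sum.inl (v 0) else Sum.inr (w (i - (m + 1)))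

lemma glueLabel_of_lt {m i : ℕ} (v : ℕ → α) (w : ℕ → β) (h : i < m) :
    glueLabel m v w i = Sum.inl (v i) := if_pos h

lemma glueLabel_self (m : ℕ) (v : ℕ → α) (w : ℕ → β) : glueLabel m v w m = Sum.inl (v 0) := by
  simp [glueLabel]

lemma glueLabel_of_gt {m i : ℕ} (v : ℕ → α) (w : ℕ → β) (h : m < i) :
    glueLabel m v w i = Sum.inr (w (i - (m + 1))) := by
  rw [glueLabel, if_neg (by omega), if_neg (by omega)]

lemma glueLabel_zero (m : ℕ) (v : ℕ → α) (w : ℕ → β) : glueLabel m v w 0 = Sum.inl (v 0) := by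
  rcases Nat.eq_zero_or_pos m with rfl | h
  · exact glueLabel_self 0 v w
  · exact glueLabel_of_lt v w h

lemma glueLabel_of_le {m i : ℕ} (v : ℕ → α) (w : ℕ → β) (h : i ≤ m) :
    ∃ i', glueLabel m v w i = Sum.inl (v i') ∧ (i' = i ∨ (i = m ∧ i' = 0)) := by
  rcases h.lt_or_eq with h | rfl
  · exact ⟨i, glueLabel_of_lt v w h, Or.inl rfl⟩
  · exact ⟨0, glueLabel_self _ v w, Or.inr ⟨rfl, rfl⟩⟩

lemma noCrossing_glueLabel {m : ℕ} {v : ℕ → α} {w : ℕ → β} (hv : NoCrossing m v)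
    (hw : NoCrossing (n - (m + 1)) w) : NoCrossing n (glueLabel m v w) := by
  intro i j k l hij hjk hkl hl hik hjl
  rcases lt_or_ge m i with h | h
  · rw [glueLabel_of_gt v w (by omega), glueLabel_of_gt v w (by omega)] at hik hjl
    rw [glueLabel_of_gt v w h, glueLabel_of_gt v w (by omega)]
    rw [Sum.inr.injEq] at *
    exact hw _ _ _ _ (by omega) (by omega) (by omega) (by omega) hik hjl
  · have hkm : k ≤ m := by
      by_contra hk
      obtain ⟨i', hi', -⟩ := glueLabel_of_le v w h
      rw [hi', glueLabel_of_gt v w (by omega)] at hik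
      simp at hik
    have hlm : l ≤ m := by
      by_contra hk
      obtain ⟨j', hj', -⟩ := glueLabel_of_le v w (show j ≤ m by omega)
      rw [hj', glueLabel_of_gt v w (by omega)] at hjl
      simp at hjl
    rw [glueLabel_of_lt v w (show j < m by omega)] at hjl ⊢
    rw [glueLabel_of_lt v w (show i < m by omega)] at hik ⊢
    rw [glueLabel_of_lt v w (show k < m by omega)] at hik
    rw [Sum.inl.injEq] at hik ⊢
    rcases hlm.lt_or_eq with hlm | rfl
    · rw [glueLabel_of_lt v w hlm, Sum.inl.injEq] at hjl
      exact hv i j k l hij hjk hkl hlm hik hjl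
    · rw [glueLabel_self, Sum.inl.injEq] at hjl
      -- The position m carries the label of 0. A crossing i < j < k < m is therefore moved to the
      -- quadruple 0 < i < j < k inside [0, m).
      rcases Nat.eq_zero_or_pos i with rfl | hi
      · exact hjl.symm
      · have := hv 0 i j k hi hij hjk hkl hjl.symm hik
        rw [← this, hjl]

lemma IsCutPoint.glueLabel_eq_iff {v : ℕ → α} {m : ℕ} (h : IsCutPoint v 0 n m) {i j : ℕ}
    (hi : i < n) (hj : j < n) :
    glueLabel m v (fun x => v (m + 1 + x)) i = glueLabel m v (fun x => v (m + 1 + x)) j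
      ↔ v i = v j := by
  have hle : ∀ x ≤ m, glueLabel m v (fun x => v (m + 1 + x)) x = Sum.inl (v x) := by
    intro x hx
    rcases hx.lt_or_eq with hx | rfl
    · exact glueLabel_of_lt _ _ hx
    · rw [glueLabel_self, h.eq]
  have hgt : ∀ x, m < x → glueLabel m v (fun x => v (m + 1 + x)) x = Sum.inr (v x) := by
    intro x hx
    rw [glueLabel_of_gt _ _ hx, show m + 1 + (x - (m + 1)) = x by omega]
  rcases le_or_gt i m with h1 | h1 <;> rcases le_or_gt j m with h2 | h2
  · rw [hle i h1, hle j h2, Sum.inl.injEq]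
  · rw [hle i h1, hgt j h2]
    simpa using h.ne i j (Nat.zero_le _) h1 h2 hj
  · rw [hgt i h1, hle j h2]
    simpa using (h.ne j i (Nat.zero_le _) h2 h1 hi).symm
  · rw [hgt i h1, hgt j h2, Sum.inr.injEq]

lemma glueLabel_congr {α' β' : Type*} {m : ℕ} {v : ℕ → α} {w : ℕ → β} {v' : ℕ → α'} {w' : ℕ → β'}
    (hm : m < n) (hv : ∀ i j, i < m → j < m → (v i = v j ↔ v' i = v' j))
    (hw : ∀ i j, i < n - (m + 1) → j < n - (m + 1) → (w i = w j ↔ w' i = w' j)) {i j : ℕ}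
    (hi : i < n) (hj : j < n) :
    glueLabel m v w i = glueLabel m v w j ↔ glueLabel m v' w' i = glueLabel m v' w' j := by
  -- The label of 0 is used by the gluing even when m = 0, where the hypothesis on [0, m) says
  -- nothing.
  have hv' : ∀ i j, (i < m ∨ i = 0) → (j < m ∨ j = 0) → (v i = v j ↔ v' i = v' j) := by
    intro i j hi hj
    rcases Nat.eq_zero_or_pos m with rfl | h0
    · obtain rfl : i = 0 := by omega
      obtain rfl : j = 0 := by omega
      simp
    · exact hv i j (by omega) (by omega)
  unfold glueLabel
  split_ifs with h1 h2 h3 h4 h5 h6 <;> simp only [Sum.inl.injEq, Sum.inr.injEq] <;>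
    first
    | exact hv' _ _ (by omega) (by omega)
    | exact hw _ _ (by omega) (by omega)

open Classical in
/-- The noncrossing partitions of `{0, …, n - 1}`. -/
def noncrossing (n : ℕ) : Finset (SetPartition n) := Finset.univ.filter fun π => ¬IsCrossing π

lemma mem_noncrossing {π : SetPartition n} :
    π ∈ noncrossing n ↔ NoCrossing n (blockLabel π) := by
  simp only [noncrossing, Finset.mem_filter, Finset.mem_univ, true_and, not_isCrossing_iff]

lemma levelPartition_mem_noncrossing {v : ℕ → α} (hv : NoCrossing n v) :
    levelPartition n v ∈ noncrossing n :=
  mem_noncrossing.2 (hv.congr fun _ _ hi hj => (blockLabel_levelPartition v hi hj).symm)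

/-- The total weight of the noncrossing partitions of `{0, …, n - 1}`. -/
def noncrossingWeight (p : ℝ) (n k : ℕ) : ℝ :=
  ∑ π ∈ noncrossing n, walkWeight p k (blockLabel π) 0 n

lemma walkWeight_levelPartition (p : ℝ) (k : ℕ) (v : ℕ → α) :
    walkWeight p k (blockLabel (levelPartition n v)) 0 n = walkWeight p k v 0 n :=
  walkWeight_congr p k fun _ _ _ hi _ hj => blockLabel_levelPartition v hi hj

-- Restricting the labels to [0, m) and to the positions after m is a bijection onto pairs of
-- noncrossing partitions, with gluing as inverse; the weights multiply by
-- `IsCutPoint.walkWeight_eq`.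
open Classical in
lemma sum_noncrossing_lastReturn_eq (p : ℝ) (k : ℕ) {m : ℕ} (hm : m < n) :
    ∑ π ∈ (noncrossing n).filter (fun π => lastReturn n (blockLabel π) = m),
        walkWeight p k (blockLabel π) 0 n
      = (noncrossingWeight p m 0 * if m = 0 then p else 1) *
        if n - (m + 1) = 0 then cycleValue (1 / 2) (k + 1)
          else noncrossingWeight p (n - (m + 1)) (k + 1) := by
  have hrhs : (noncrossingWeight p m 0 * if m = 0 then p else 1) *
        (if n - (m + 1) = 0 then cycleValue (1 / 2) (k + 1)
          else noncrossingWeight p (n - (m + 1)) (k + 1))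
      = ∑ x ∈ noncrossing m ×ˢ noncrossing (n - (m + 1)),
        walkWeight p 0 (blockLabel x.1) 0 m * (if m = 0 then p else 1) *
          if n - (m + 1) = 0 then cycleValue (1 / 2) (k + 1)
            else walkWeight p (k + 1) (blockLabel x.2) 0 (n - (m + 1)) := by
    rw [Finset.sum_product, noncrossingWeight, Finset.sum_mul, Finset.sum_mul]
    refine Finset.sum_congr rfl fun σ _ => ?_
    by_cases h : n - (m + 1) = 0
    · have huniq : noncrossing (n - (m + 1)) = {⊥} := by
        rw [h]
        ext π
        rw [mem_noncrossing, Finset.mem_singleton]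
        constructor
        · intro _; exact setPartition_ext fun i j hi => by omega
        · intro _ i j k l _ _ _ hl; omega
      rw [huniq, Finset.sum_singleton, if_pos h, if_pos h]
    · simp only [if_neg h]
      rw [← Finset.mul_sum, noncrossingWeight]
  rw [hrhs]
  refine Finset.sum_bij'
    (fun π _ => (levelPartition m (blockLabel π),
      levelPartition (n - (m + 1)) fun x => blockLabel π (m + 1 + x)))
    (fun x _ => levelPartition n (glueLabel m (blockLabel x.1) (blockLabel x.2))) ?_ ?_ ?_ ?_ ?_
  · intro π hπ
    obtain ⟨h1, h2⟩ := Finset.mem_filter.1 hπ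
    rw [mem_noncrossing] at h1
    have h3 : NoCrossing m (blockLabel π) := fun i j k l a b c d =>
      h1 i j k l a b c (by omega)
    have h4 : NoCrossing (n - (m + 1)) fun x => blockLabel π (m + 1 + x) := fun i j k l a b c d =>
      h1 _ _ _ _ (by omega) (by omega) (by omega) (by omega)
    have h5 := levelPartition_mem_noncrossing h3
    have h6 := levelPartition_mem_noncrossing h4
    exact Finset.mk_mem_product h5 h6
  · intro x hx
    obtain ⟨h1, h2⟩ := Finset.mem_product.1 hx
    rw [mem_noncrossing] at h1 h2
    refine Finset.mem_filter.2 ⟨levelPartition_mem_noncrossing (noCrossing_glueLabel h1 h2), ?_⟩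
    refine eq_lastReturn hm ?_ fun i hi hin => ?_
    · rw [blockLabel_levelPartition _ hm (by omega), glueLabel_self, glueLabel_zero]
    · rw [Ne, blockLabel_levelPartition _ hin (by omega), glueLabel_zero, glueLabel_of_gt _ _ hi]
      simp
  · intro π hπ
    obtain ⟨h1, h2⟩ := Finset.mem_filter.1 hπ
    rw [mem_noncrossing] at h1
    have hcut := h1.isCutPoint (by omega)
    rw [h2] at hcut
    refine setPartition_ext fun i j hi hj => ?_
    rw [blockLabel_levelPartition _ hi hj, ← hcut.glueLabel_eq_iff hi hj]
    exact glueLabel_congr hm (fun i j hi hj => blockLabel_levelPartition _ hi hj)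
      (fun i j hi hj => blockLabel_levelPartition _ hi hj) hi hj
  · rintro ⟨σ, τ⟩ _
    refine Prod.ext (setPartition_ext fun i j hi hj => ?_) (setPartition_ext fun i j hi hj => ?_)
    · rw [blockLabel_levelPartition _ hi hj, blockLabel_levelPartition _ (by omega) (by omega),
        glueLabel_of_lt _ _ hi, glueLabel_of_lt _ _ hj, Sum.inl.injEq]
    · rw [blockLabel_levelPartition _ hi hj, blockLabel_levelPartition _ (by omega) (by omega),
        glueLabel_of_gt _ _ (by omega), glueLabel_of_gt _ _ (by omega), Sum.inr.injEq,
        show m + 1 + i - (m + 1) = i by omega, show m + 1 + j - (m + 1) = j by omega]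
  · intro π hπ
    obtain ⟨h1, h2⟩ := Finset.mem_filter.1 hπ
    rw [mem_noncrossing] at h1
    have hcut := h1.isCutPoint (by omega)
    rw [h2] at hcut
    rw [hcut.walkWeight_eq, walkWeight_levelPartition]
    congr 1
    by_cases h3 : m + 1 = n
    · rw [if_pos h3, if_pos (by omega)]
    · rw [if_neg h3, if_neg (by omega), walkWeight_levelPartition,
        ← walkWeight_shift p (k + 1) (blockLabel π) (m + 1) (n - (m + 1)) (by omega),
        show m + 1 + (n - (m + 1)) = n by omega]

lemma noncrossingWeight_succ (p : ℝ) (n k : ℕ) :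
    noncrossingWeight p (n + 1) k = ∑ m ∈ Finset.range (n + 1),
      (noncrossingWeight p m 0 * if m = 0 then p else 1) *
        if n - m = 0 then cycleValue (1 / 2) (k + 1) else noncrossingWeight p (n - m) (k + 1) := by
  classical
  rw [noncrossingWeight, ← Finset.sum_fiberwise_of_maps_to
    (g := fun π : SetPartition (n + 1) => lastReturn (n + 1) (blockLabel π))
    (t := Finset.range (n + 1)) fun π _ => Finset.mem_range.2 (lastReturn_lt (by omega) _)]
  refine Finset.sum_congr rfl fun m hm => ?_
  rw [sum_noncrossing_lastReturn_eq p k (Finset.mem_range.1 hm), Nat.add_sub_add_right]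

lemma noncrossingWeight_zero (p : ℝ) : noncrossingWeight p 0 0 = 1 := by
  have huniq : noncrossing 0 = {⊥} := by
    ext π
    rw [mem_noncrossing, Finset.mem_singleton]
    constructor
    · intro _; exact setPartition_ext fun i j hi => by omega
    · intro _ i j k l _ _ _ hl; omega
  have hcyc : walkCycles (blockLabel (⊥ : SetPartition 0)) 0 0 = ∅ := by
    ext C
    rw [mem_walkCycles]
    constructor
    · intro h
      obtain ⟨x, hx⟩ := h.nonempty
      have := h.subset hx
      simp at this
    · simp
  rw [noncrossingWeight, huniq, Finset.sum_singleton, walkWeight, hcyc]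
  simp

/-- The conventions f 0 = p and h 0 k = A_k absorb the two exceptional cases, an empty left part and
an empty right part. -/
theorem noncrossingWeight_eq_kmMoment (p : ℝ) {n : ℕ} (hn : 1 ≤ n) :
    noncrossingWeight p n 0 = kmMoment p n := by
  have h := eq_kmMoment_of_recursion (p := p)
    (f := fun m => noncrossingWeight p m 0 * if m = 0 then p else 1)
    (h := fun m k => if m = 0 then cycleValue (1 / 2) k else noncrossingWeight p m k)
    (by simp [noncrossingWeight_zero]) (fun n => by simp [noncrossingWeight_succ])
    (fun k _ => by simp) (fun n k _ => by simp [noncrossingWeight_succ]) n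
  rw [← h, if_neg (by omega), mul_one]

/-! ### The centralized quantity -/

lemma coe_finRotate_eq_cyclicSucc (i : Fin n) : (finRotate n i : ℕ) = cyclicSucc 0 n i := by
  obtain ⟨n, rfl⟩ := Nat.exists_eq_succ_of_ne_zero i.pos.ne'
  rw [coe_finRotate, cyclicSucc]
  have : i = Fin.last n ↔ (i : ℕ) + 1 = n + 1 := by rw [Fin.ext_iff]; simp
  simp only [this]

lemma isCycleOf_iff (π : SetPartition n) (C : Finset (Fin n)) :
    IsCycleOf π C ↔ IsWalkCycle (blockLabel π) 0 n (C.map Fin.valEmbedding) := by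
  have hlab : ∀ x : Fin n, blockLabel π x = π.part x := fun x => blockLabel_of_lt π x.2
  constructor
  · rintro ⟨s, e, hs, hstep, hinj, rfl⟩
    set e' : ℕ → ℕ := fun k => if h : k < s then e ⟨k, h⟩ else 0 with he'
    have he : ∀ k : Fin s, e' k = e k := fun k => dif_pos k.2
    refine ⟨s, e', hs, fun k hk => ?_, fun k hk => ?_, fun i hi j hj hij => ?_, ?_⟩
    · rw [he ⟨k, hk⟩]; exact ⟨Nat.zero_le _, Fin.is_lt _⟩
    · have h1 := hstep ⟨k, hk⟩
      rw [edgeTarget, edgeSource, ← hlab, ← hlab, coe_finRotate_eq_cyclicSucc] at h1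
      have h2 := coe_finRotate_eq_cyclicSucc (⟨k, hk⟩ : Fin s)
      simp only at h2
      rw [he ⟨k, hk⟩, ← h2, he, h1]
    · have h1 := hinj (a₁ := ⟨i, hi⟩) (a₂ := ⟨j, hj⟩) (by
        simp only [edgeSource]
        rwa [← hlab, ← hlab, ← he, ← he])
      simpa using h1
    · ext x
      simp only [Finset.mem_image, Finset.mem_range, Finset.mem_map, Finset.mem_univ, true_and,
        Fin.valEmbedding_apply]
      constructor
      · rintro ⟨k, hk, rfl⟩
        exact ⟨e ⟨k, hk⟩, ⟨_, rfl⟩, (he ⟨k, hk⟩).symm⟩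
      · rintro ⟨_, ⟨k, rfl⟩, rfl⟩
        exact ⟨k, k.2, he k⟩
  · rintro ⟨s, e, hs, he, hstep, hinj, hC⟩
    refine ⟨s, fun k => ⟨e k, (he k k.2).2⟩, hs, fun k => ?_, fun i j hij => ?_, ?_⟩
    · rw [edgeTarget, edgeSource, ← hlab, ← hlab, coe_finRotate_eq_cyclicSucc]
      simp only [coe_finRotate_eq_cyclicSucc]
      exact hstep k k.2
    · simp only [edgeSource] at hij
      rw [← hlab, ← hlab] at hij
      exact Fin.ext (hinj i i.2 j j.2 hij)
    · apply Finset.map_injective Fin.valEmbedding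
      rw [← hC]
      ext x
      simp only [Finset.mem_image, Finset.mem_range, Finset.mem_map, Finset.mem_univ, true_and,
        Fin.valEmbedding_apply]
      constructor
      · rintro ⟨_, ⟨k, rfl⟩, rfl⟩
        exact ⟨k, k.2, rfl⟩
      · rintro ⟨k, hk, rfl⟩
        exact ⟨_, ⟨⟨k, hk⟩, rfl⟩, rfl⟩

open Classical in
lemma prod_isCycleOf_eq (π : SetPartition n) :
    ∏ C ∈ Finset.univ.filter (fun C : Finset (Fin n) => IsCycleOf π C),
        cycleValue (1 / 2) C.card
      = ∏ C ∈ walkCycles (blockLabel π) 0 n, cycleValue (1 / 2) C.card := by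
  have hset : walkCycles (blockLabel π) 0 n
      = (Finset.univ.filter (fun C : Finset (Fin n) => IsCycleOf π C)).image
        (Finset.map Fin.valEmbedding) := by
    ext C
    simp only [mem_walkCycles, Finset.mem_image, Finset.mem_filter, Finset.mem_univ, true_and,
      isCycleOf_iff]
    constructor
    · intro h
      have hC : ∀ x ∈ C, x < n := fun x hx => (Finset.mem_Ico.1 (h.subset hx)).2
      have h1 : (C.attachFin hC).map Fin.valEmbedding = C := by
        ext x
        simp only [Finset.mem_map, Finset.mem_attachFin, Fin.valEmbedding_apply]
        exact ⟨fun ⟨a, ha, hax⟩ => hax ▸ ha, fun hx => ⟨⟨x, hC x hx⟩, hx, rfl⟩⟩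
      exact ⟨_, by rwa [h1], h1⟩
    · rintro ⟨D, hD, rfl⟩
      exact hD
  rw [hset, Finset.prod_image ((Finset.map_injective _).injOn)]
  simp

-- Each block is counted at its least element.
open Classical in
lemma card_parts_eq (π : SetPartition n) :
    π.parts.card = ((Finset.Ico 0 n).filter fun i =>
      IsFirstVisit (blockLabel π) 0 i).card := by
  symm
  refine Finset.card_bij (fun i _ => blockLabel π i) (fun i hi => ?_) (fun i hi j hj hij => ?_)
    fun B hB => ?_
  · have h1 := (Finset.mem_Ico.1 (Finset.mem_filter.1 hi).1).2
    rw [blockLabel_of_lt π h1]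
    exact π.part_mem.2 (Finset.mem_univ _)
  · rw [Finset.mem_filter] at hi hj
    rcases lt_trichotomy i j with h | h | h
    · exact absurd hij (hj.2 i (Nat.zero_le _) h)
    · exact h
    · exact absurd hij.symm (hi.2 j (Nat.zero_le _) h)
  · have hex : ∃ i, i < n ∧ blockLabel π i = B := by
      obtain ⟨x, hx⟩ := π.nonempty_of_mem_parts hB
      exact ⟨x, x.2, by rw [blockLabel_of_lt π x.2]; exact π.part_eq_of_mem hB hx⟩
    obtain ⟨h1, h2⟩ := Nat.find_spec hex
    refine ⟨Nat.find hex, Finset.mem_filter.2 ⟨Finset.mem_Ico.2 ⟨Nat.zero_le _, h1⟩,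
      fun j _ hj hne => ?_⟩, h2⟩
    exact Nat.find_min hex hj ⟨by omega, by rw [hne, h2]⟩

lemma walkWeight_blockLabel (p : ℝ) {π : SetPartition n} (hπ : π ∈ noncrossing n) :
    walkWeight p 0 (blockLabel π) 0 n = partitionValue (1 / 2) π * p ^ π.parts.card := by
  classical
  have h1 : ¬IsCrossing π := (not_isCrossing_iff π).2 (mem_noncrossing.1 hπ)
  rw [partitionValue, if_neg h1, walkWeight, Finset.prod_ite, Finset.prod_const, Finset.prod_const,
    one_pow, mul_one, card_parts_eq, mul_comm, prod_isCycleOf_eq]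
  simp

theorem mCentral_half_eq_kmMoment (p : ℝ) {r : ℕ} (hr : 1 ≤ r) :
    mCentral (1 / 2) p r = kmMoment p r := by
  classical
  rw [← noncrossingWeight_eq_kmMoment p hr, mCentral, noncrossingWeight]
  have hmaps : ∀ π ∈ (Finset.univ : Finset (SetPartition r)),
      π.parts.card ∈ Finset.Icc 1 r := by
    intro π _
    rw [Finset.mem_Icc]
    constructor
    · rw [Nat.one_le_iff_ne_zero, Finset.card_ne_zero]
      exact ⟨_, π.part_mem.2 (Finset.mem_univ (⟨0, hr⟩ : Fin r))⟩
    · simpa using π.card_parts_le_card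
  have h1 : ∀ t ∈ Finset.Icc 1 r,
      (∑ π ∈ Finset.univ.filter (fun π : SetPartition r => π.parts.card = t),
        partitionValue (1 / 2) π) * p ^ t
      = ∑ π ∈ Finset.univ.filter (fun π : SetPartition r => π.parts.card = t),
        partitionValue (1 / 2) π * p ^ π.parts.card := by
    intro t _
    rw [Finset.sum_mul]
    exact Finset.sum_congr rfl fun π hπ => by rw [(Finset.mem_filter.1 hπ).2]
  have h2 : ∑ t ∈ Finset.Icc 1 r,
      ∑ π ∈ Finset.univ.filter (fun π : SetPartition r => π.parts.card = t),
        partitionValue (1 / 2) π * p ^ π.parts.card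
      = ∑ π : SetPartition r, partitionValue (1 / 2) π * p ^ π.parts.card :=
    Finset.sum_fiberwise_of_maps_to hmaps _
  have h3 : ∑ π : SetPartition r, partitionValue (1 / 2) π * p ^ π.parts.card
      = ∑ π ∈ noncrossing r, walkWeight p 0 (blockLabel π) 0 r := by
    rw [noncrossing, Finset.sum_filter]
    refine Finset.sum_congr rfl fun π _ => ?_
    split_ifs with h
    · rw [partitionValue, if_pos h, zero_mul]
    · exact (walkWeight_blockLabel p (mem_noncrossing.2 ((not_isCrossing_iff π).1 h))).symm
  rw [← h3, ← h2]
  convert Finset.sum_congr rfl h1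

end Noncrossing

/-! ### Orthogonality of the rescaled Chebyshev polynomials -/

section Chebyshev

open Polynomial

/-- Monic Chebyshev polynomials of the second kind on `[-2√c, 2√c]`. -/
def monicU (c : ℝ) : ℕ → ℝ[X]
  | 0 => 1
  | 1 => X
  | k + 2 => X * monicU c (k + 1) - C c * monicU c k

lemma momentFunctional_eq_sum (m : ℕ → ℝ) (f : ℝ[X]) :
    momentFunctional m f = ∑ j ∈ Finset.range (f.natDegree + 1), f.coeff j * m j := by
  conv_lhs => rw [f.as_sum_range_C_mul_X_pow]
  rw [map_sum]
  refine Finset.sum_congr rfl fun j _ => ?_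
  rw [← smul_eq_C_mul, map_smul, momentFunctional_X_pow, smul_eq_mul]

lemma integral_eval_mul_semicircle {c : ℝ} (hc : 0 < c) (f : ℝ[X]) :
    ∫ y in -(2 * √c)..(2 * √c), f.eval y * √((2 * √c) ^ 2 - y ^ 2)
      = 2 * Real.pi * momentFunctional (semicircleMoment c) f := by
  simp only [momentFunctional_eq_sum, eval_eq_sum_range, Finset.sum_mul, Finset.mul_sum]
  rw [intervalIntegral.integral_finsetSum]
  · refine Finset.sum_congr rfl fun j _ => ?_
    simp only [mul_assoc]
    rw [intervalIntegral.integral_const_mul, integral_pow_mul_semicircle hc]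
    ring
  · intro j _
    exact Continuous.intervalIntegrable (by fun_prop) _ _

lemma eval_monicU {c : ℝ} (hc : 0 < c) (k : ℕ) (x : ℝ) :
    (monicU c k).eval (2 * √c * x) = √c ^ k * (Chebyshev.U ℝ k).eval x := by
  have hs : √c ^ 2 = c := Real.sq_sqrt hc.le
  induction k using Nat.twoStepInduction with
  | zero => simp [monicU]
  | one => simp [monicU]; ring
  | more k ih1 ih2 =>
    push_cast at ih2 ⊢
    rw [monicU, Chebyshev.U_add_two, eval_sub, eval_mul, eval_mul, eval_X, eval_C, ih1, ih2]
    simp only [eval_sub, eval_mul, eval_X, eval_ofNat]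
    linear_combination (√c ^ k * (Chebyshev.U ℝ k).eval x) * hs

/-- Since (1 - x²)U_(k+1) = (T_(k+1) - T_(k+3))/2, this is an integral of T's of nonzero index
against the arcsine weight. -/
lemma integral_chebyshevU_mul_sqrt (k : ℕ) :
    ∫ x in (-1 : ℝ)..1, (Chebyshev.U ℝ (k + 1 : ℕ)).eval x * √(1 - x ^ 2) = 0 := by
  have h1 : ∀ x : ℝ, (Chebyshev.U ℝ (k + 1 : ℕ)).eval x * √(1 - x ^ 2)
      = (2⁻¹ * ((Chebyshev.T ℝ (k + 1 : ℕ)).eval x - (Chebyshev.T ℝ (k + 3 : ℕ)).eval x))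
        * √(1 - x ^ 2)⁻¹ := by
    intro x
    have h2 := congrArg (eval x) (Chebyshev.one_sub_X_sq_mul_U_eq_pol_in_T ℝ (k + 1 : ℕ))
    have h3 := congrArg (eval x) (Chebyshev.T_add_two ℝ (k + 1 : ℕ))
    simp only [eval_sub, eval_mul, eval_X, eval_one, eval_pow, eval_ofNat] at h2 h3
    push_cast at h2 h3 ⊢
    rw [show (k : ℤ) + 3 = k + 1 + 2 by ring]
    have h4 : 2⁻¹ * ((Chebyshev.T ℝ (k + 1)).eval x - (Chebyshev.T ℝ (k + 1 + 2)).eval x)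
        = (1 - x ^ 2) * (Chebyshev.U ℝ (k + 1)).eval x := by
      rw [h2]; linear_combination 2⁻¹ * h3
    rw [h4, Real.sqrt_inv]
    rcases le_or_gt (1 - x ^ 2) 0 with h | h
    · rw [Real.sqrt_eq_zero_of_nonpos h]; simp
    · have h5 : √(1 - x ^ 2) ≠ 0 := (Real.sqrt_pos.2 h).ne'
      field_simp
      rw [Real.sq_sqrt h.le]
  simp only [h1]
  rw [← Chebyshev.integral_measureT, integral_const_mul, integral_sub,
    Chebyshev.integral_eval_T_real_measureT_of_ne_zero (by positivity),
    Chebyshev.integral_eval_T_real_measureT_of_ne_zero (by positivity)]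
  · simp
  · exact Chebyshev.integrable_measureT (by fun_prop)
  · exact Chebyshev.integrable_measureT (by fun_prop)

theorem momentFunctional_semicircle_monicU {c : ℝ} (hc : 0 < c) (k : ℕ) :
    momentFunctional (semicircleMoment c) (monicU c (k + 1)) = 0 := by
  have ha : 0 < 2 * √c := by positivity
  have h := integral_eval_mul_semicircle hc (monicU c (k + 1))
  have h1 := intervalIntegral.mul_integral_comp_mul_left (a := -1) (b := 1)
    (f := fun y => (monicU c (k + 1)).eval y * √((2 * √c) ^ 2 - y ^ 2)) (c := 2 * √c)
  rw [mul_neg, mul_one, h] at h1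
  have h2 : ∀ x : ℝ, (monicU c (k + 1)).eval (2 * √c * x) * √((2 * √c) ^ 2 - (2 * √c * x) ^ 2)
      = (√c ^ (k + 1) * (2 * √c)) * ((Chebyshev.U ℝ (k + 1 : ℕ)).eval x * √(1 - x ^ 2)) := by
    intro x
    rw [eval_monicU hc, show (2 * √c) ^ 2 - (2 * √c * x) ^ 2 = (2 * √c) ^ 2 * (1 - x ^ 2) by ring,
      Real.sqrt_mul (by positivity), Real.sqrt_sq ha.le]
    ring
  simp only [h2] at h1
  rw [intervalIntegral.integral_const_mul, integral_chebyshevU_mul_sqrt, mul_zero, mul_zero] at h1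
  have hpi := Real.pi_pos
  exact (mul_eq_zero.1 h1.symm).resolve_left (by positivity)

/-- The polynomials by which the compressions of alternating words are expressed. -/
def chainPoly (p : ℝ) : ℕ → ℝ[X]
  | 0 => 1
  | 1 => C (1 - p) * X
  | k + 2 => X * chainPoly p (k + 1) - C (p * (1 - p)) * chainPoly p k

/-- Both families satisfy the same three-term recurrence, so two initial cases suffice. Modulo 1 -
X² times a Chebyshev polynomial, the chain polynomials repeat with period two up to a constant. -/
lemma chainPoly_add_three (p : ℝ) (k : ℕ) :
    chainPoly p (k + 3) = C ((1 - p) ^ 2) * chainPoly p (k + 1)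
      - C (1 - p) * ((1 - X ^ 2) * monicU (p * (1 - p)) (k + 1)) := by
  induction k using Nat.twoStepInduction with
  | zero =>
    simp only [chainPoly, monicU, map_mul, map_sub, map_one, map_pow]
    ring
  | one =>
    simp only [chainPoly, monicU, map_mul, map_sub, map_one, map_pow]
    ring
  | more k ih1 ih2 =>
    have e1 : chainPoly p (k + 5) = X * chainPoly p (k + 4)
        - C (p * (1 - p)) * chainPoly p (k + 3) := rfl
    have e2 : chainPoly p (k + 3) = X * chainPoly p (k + 2)
        - C (p * (1 - p)) * chainPoly p (k + 1) := rfl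
    have e3 : monicU (p * (1 - p)) (k + 3) = X * monicU (p * (1 - p)) (k + 2)
        - C (p * (1 - p)) * monicU (p * (1 - p)) (k + 1) := rfl
    linear_combination e1 + X * ih2 - C (p * (1 - p)) * ih1 - C ((1 - p) ^ 2) * e2
      + C (1 - p) * (1 - X ^ 2) * e3

/-- The factor 1 - X² converts the functional to the semicircle one, for which `monicU` of positive
index has mean 0. What remains are the indices 1 and 2, which use m_1 = 0 and m_0 - m_2 = p(1-p). -/
lemma momentFunctional_km_chainPoly {p : ℝ} (hp0 : 0 < p) (hp1 : p < 1) (k : ℕ) :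
    momentFunctional (kmMoment p) (chainPoly p (k + 1)) = 0 := by
  have hpq : 0 < p * (1 - p) := mul_pos hp0 (by linarith)
  induction k using Nat.twoStepInduction with
  | zero =>
    have := momentFunctional_X_pow (kmMoment p) 1
    rw [pow_one] at this
    rw [chainPoly, ← smul_eq_C_mul, map_smul, this]
    simp [kmMoment]
  | one =>
    have h0 := momentFunctional_X_pow (kmMoment p) 0
    have h2 := momentFunctional_X_pow (kmMoment p) 2
    rw [pow_zero] at h0
    have h3 : chainPoly p (1 + 1) = (1 - p) • X ^ 2 - (p * (1 - p)) • 1 := by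
      simp only [chainPoly, smul_eq_C_mul]; ring
    rw [h3, map_sub, map_smul, map_smul, h0, h2]
    simp [kmMoment, semicircleMoment]
    ring
  | more k ih1 _ =>
    rw [chainPoly_add_three, map_sub, ← smul_eq_C_mul, ← smul_eq_C_mul, map_smul, map_smul, ih1,
      momentFunctional_km_one_sub_sq, momentFunctional_semicircle_monicU hpq]
    simp

end Chebyshev

/-! ### Moments of compressions under a tracial functional -/

section Tracial

variable {A : Type*} [Ring A] [Algebra ℝ A] {φ : A →ₗ[ℝ] ℝ} {P S : A} {a b p : ℝ}

lemma centered_mul_self (hP : P * P = P) :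
    (P - p • (1 : A)) * (P - p • 1) = (1 - 2 * p) • (P - p • 1) + (p * (1 - p)) • 1 := by
  simp only [sub_mul, mul_sub, smul_mul_assoc, mul_smul_comm, one_mul, mul_one, hP]
  module

lemma centered_mul (hP : P * P = P) : (P - p • (1 : A)) * P = (1 - p) • P := by
  rw [sub_mul, smul_mul_assoc, one_mul, hP]; module

lemma mul_centered (hP : P * P = P) : P * (P - p • (1 : A)) = (1 - p) • P := by
  rw [mul_sub, mul_smul_comm, mul_one, hP]; module

/-- Cyclicity brings the two outer letters S together, and S² = aS + b shortens the word. The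
analogous reduction for D follows; together they reduce words of odd length to the alternating words
(DS)^k and to S and D. -/
lemma trace_word_SDS (hφ : ∀ x y, φ (x * y) = φ (y * x)) (hS : S * S = a • S + b • 1) (D : A)
    (k : ℕ) : φ ((S * D) ^ (k + 1) * S) = a * φ ((D * S) ^ (k + 1)) + b * φ (D * (S * D) ^ k) := by
  have h1 : φ ((S * D) ^ (k + 1)) = φ ((D * S) ^ (k + 1)) := by
    rw [pow_succ', mul_assoc, hφ, ← mul_pow_mul, mul_assoc, ← pow_succ]
  rw [hφ, pow_succ', ← mul_assoc, ← mul_assoc, hS, add_mul, add_mul, smul_mul_assoc, smul_mul_assoc,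
    smul_mul_assoc, smul_mul_assoc, one_mul, ← pow_succ', map_add, map_smul, map_smul, h1,
    smul_eq_mul, smul_eq_mul]

lemma trace_word_DSD (hφ : ∀ x y, φ (x * y) = φ (y * x)) {D : A} {α β : ℝ}
    (hD : D * D = α • D + β • 1) (k : ℕ) :
    φ (D * (S * D) ^ (k + 1)) = α * φ ((D * S) ^ (k + 1)) + β * φ ((S * D) ^ k * S) := by
  have h1 : D * (S * D) ^ (k + 1) = (D * (S * D) ^ k * S) * D := by
    rw [pow_succ]; simp only [mul_assoc]
  rw [h1, hφ, ← mul_assoc, ← mul_assoc, hD, add_mul, add_mul, smul_mul_assoc, smul_mul_assoc,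
    smul_mul_assoc, smul_mul_assoc, one_mul, map_add, map_smul, map_smul, smul_eq_mul, smul_eq_mul,
    ← mul_pow_mul, mul_assoc, ← pow_succ]

lemma trace_compressed_word (hφ : ∀ x y, φ (x * y) = φ (y * x)) (hP : P * P = P) (k : ℕ) :
    φ (P * (S * (P - p • 1)) ^ (k + 1))
      = (1 - p) * (p * φ ((S * (P - p • 1)) ^ k * S) + φ (((P - p • 1) * S) ^ (k + 1))) := by
  set D := P - p • (1 : A) with hD
  have h1 : P * (S * D) ^ (k + 1) = (P * (S * D) ^ k * S) * D := by
    rw [pow_succ]; simp only [mul_assoc]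
  have h2 : P = p • 1 + D := by rw [hD]; module
  rw [h1, hφ, ← mul_assoc, ← mul_assoc, hD, centered_mul hP, ← hD, smul_mul_assoc, smul_mul_assoc,
    map_smul, smul_eq_mul]
  conv_lhs => rw [h2]
  rw [add_mul, add_mul, smul_mul_assoc, smul_mul_assoc, one_mul, map_add, map_smul, smul_eq_mul,
    ← mul_pow_mul, mul_assoc, ← pow_succ]

lemma centered_mul_compressed (hP : P * P = P) (j : ℕ) :
    (P - p • (1 : A)) * ((P * S) ^ j * P) = (1 - p) • ((P * S) ^ j * P) := by
  cases j with
  | zero => rw [pow_zero, one_mul, centered_mul hP]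
  | succ j =>
    rw [pow_succ']
    simp only [← mul_assoc, centered_mul hP, smul_mul_assoc]

/-- Cyclicity puts D in front of P, and DP = (1-p)P. This is the origin of the factor in `chainPoly
p 1`. -/
lemma trace_compressed_succ_zero (hφ : ∀ x y, φ (x * y) = φ (y * x)) (hP : P * P = P) (j : ℕ) :
    φ ((P * S) ^ j * P * (S * (P - p • 1))) = (1 - p) * φ ((P * S) ^ (j + 1) * P) := by
  rw [← mul_assoc, hφ, ← mul_assoc, centered_mul_compressed hP, smul_mul_assoc, map_smul,
    smul_eq_mul, mul_assoc, ← pow_succ, hφ _ P, pow_succ', ← mul_assoc, ← mul_assoc, hP]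

/-- Write the P after the last S of (PS)^(j+1) as p + D. The D-term lengthens the alternating tail;
in the other term S² is reduced and PD = (1-p)P is used. For a = 0, b = 1 this is the recurrence of
`chainPoly`. -/
lemma compressed_succ_succ (hP : P * P = P) (hS : S * S = a • S + b • 1) (j k : ℕ) :
    (P * S) ^ (j + 1) * P * (S * (P - p • 1)) ^ (k + 1)
      = (p * a) • ((P * S) ^ j * P * (S * (P - p • 1)) ^ (k + 1))
        + (p * (1 - p) * b) • ((P * S) ^ j * P * (S * (P - p • 1)) ^ k)
        + (P * S) ^ j * P * (S * (P - p • 1)) ^ (k + 2) := by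
  set D := P - p • (1 : A) with hD
  have h2 : P = p • 1 + D := by rw [hD]; module
  have h3 : P * D = (1 - p) • P := mul_centered hP
  have h4 : P * S * P * (S * D) = (p * a) • (P * (S * D)) + (p * (1 - p) * b) • P
      + P * (S * D) * (S * D) := by
    have h5 : P * S * P * (S * D) = p • (P * (S * S) * D) + P * (S * D) * (S * D) := by
      conv_lhs => rw [show P * S * P = P * S * (p • 1 + D) by rw [← h2]]
      simp only [mul_add, add_mul, mul_smul_comm, smul_mul_assoc, mul_one, mul_assoc]
    have h6 : P * (S * S) * D = a • (P * (S * D)) + (b * (1 - p)) • P := by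
      rw [hS, mul_add, add_mul, mul_smul_comm, mul_smul_comm, mul_one, smul_mul_assoc,
        smul_mul_assoc, h3, smul_smul, mul_assoc]
    rw [h5, h6]
    module
  have h7 : (P * S) ^ (j + 1) * P * (S * D) ^ (k + 1)
      = (P * S) ^ j * (P * S * P * (S * D)) * (S * D) ^ k := by
    rw [pow_succ, pow_succ' (S * D)]; simp only [mul_assoc]
  rw [h7, h4]
  simp only [mul_add, add_mul, mul_smul_comm, smul_mul_assoc, pow_succ' (S * D) (k + 1),
    pow_succ' (S * D) k, mul_assoc]

/-- By cyclicity a factor P may be appended on the right, and (P(1+S))^r P = (1+PS)^r P. The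
binomial theorem applies to the last form. -/
lemma trace_pow_compressed (hφ : ∀ x y, φ (x * y) = φ (y * x)) (hP : P * P = P) {r : ℕ}
    (hr : 1 ≤ r) : φ ((P * (1 + S)) ^ r)
      = ∑ j ∈ Finset.range (r + 1), (r.choose j : ℝ) * φ ((P * S) ^ j * P) := by
  have h1 : ∀ r : ℕ, P * ((1 + P * S) ^ r * P) = (1 + P * S) ^ r * P := by
    intro r
    induction r with
    | zero => rw [pow_zero, one_mul, hP]
    | succ r ih =>
      rw [pow_succ', mul_assoc, add_mul, one_mul, mul_add, ih, ← mul_assoc, ← mul_assoc P P S, hP]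
  have h2 : ∀ r : ℕ, (P * (1 + S)) ^ r * P = (1 + P * S) ^ r * P := by
    intro r
    induction r with
    | zero => simp
    | succ r ih =>
      have hW := h1 r
      rw [pow_succ', mul_assoc, ih, pow_succ' (1 + P * S), mul_assoc (1 + P * S)]
      generalize (1 + P * S) ^ r * P = W at hW
      simp only [add_mul, mul_add, one_mul, hW, mul_assoc]
  obtain ⟨r, rfl⟩ := Nat.exists_eq_add_of_le' hr
  have h3 : φ ((P * (1 + S)) ^ (r + 1)) = φ ((P * (1 + S)) ^ (r + 1) * P) := by
    rw [hφ _ P, pow_succ', ← mul_assoc, ← mul_assoc, hP]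
  rw [h3, h2, add_comm (1 : A), (Commute.one_right (P * S)).add_pow, Finset.sum_mul, map_sum]
  refine Finset.sum_congr rfl fun j _ => ?_
  rw [one_pow, mul_one, (Nat.cast_commute _ _).symm.eq, mul_assoc, ← nsmul_eq_mul, map_nsmul,
    nsmul_eq_mul]

open Polynomial in
/-- If `P` and `S` are asymptotically free projections and reflections, then the moments of the
compressions of `S` tend to the Kesten–McKay moments. -/
theorem tendsto_compressed_moments {p : ℝ} (hp0 : 0 < p) (hp1 : p < 1) {A : ℕ → Type*}
    [∀ i, Ring (A i)] [∀ i, Algebra ℝ (A i)] {φ : ∀ i, A i →ₗ[ℝ] ℝ} {P S : ∀ i, A i} {a b : ℕ → ℝ}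
    (hφ : ∀ i x y, φ i (x * y) = φ i (y * x)) (hP : ∀ i, P i * P i = P i)
    (hS : ∀ᶠ i in atTop, S i * S i = a i • S i + b i • 1) (ha : Tendsto a atTop (𝓝 0))
    (hb : Tendsto b atTop (𝓝 1)) (h1 : Tendsto (fun i => φ i 1) atTop (𝓝 1))
    (hS0 : Tendsto (fun i => φ i (S i)) atTop (𝓝 0))
    (hD0 : Tendsto (fun i => φ i (P i - p • 1)) atTop (𝓝 0))
    (hDS : ∀ k, Tendsto (fun i => φ i (((P i - p • 1) * S i) ^ (k + 1))) atTop (𝓝 0)) (j : ℕ) :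
    Tendsto (fun i => φ i ((P i * S i) ^ j * P i)) atTop (𝓝 (kmMoment p j)) := by
  have hwords : ∀ k, Tendsto (fun i => φ i ((S i * (P i - p • 1)) ^ k * S i)) atTop (𝓝 0) ∧
      Tendsto (fun i => φ i ((P i - p • 1) * (S i * (P i - p • 1)) ^ k)) atTop (𝓝 0) := by
    intro k
    induction k with
    | zero =>
      simp only [pow_zero, one_mul, mul_one]
      exact ⟨hS0, hD0⟩
    | succ k ih =>
      constructor
      · have h := (ha.mul (hDS k)).add (hb.mul ih.2)
        rw [mul_zero, mul_zero, add_zero] at h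
        refine h.congr' ?_
        filter_upwards [hS] with i hi
        rw [trace_word_SDS (hφ i) hi]
      · have h := ((hDS k).const_mul (1 - 2 * p)).add (ih.1.const_mul (p * (1 - p)))
        rw [mul_zero, mul_zero, add_zero] at h
        refine h.congr fun i => ?_
        rw [trace_word_DSD (hφ i) (centered_mul_self (hP i))]
  have hq : 1 - p ≠ 0 := by linarith
  -- Induction on j: for j = 0 asymptotic freeness gives the value, 0 for k ≥ 1, and each further
  -- factor PS is traded for a change of k.
  have main : ∀ j k, Tendsto (fun i => φ i ((P i * S i) ^ j * P i * (S i * (P i - p • 1)) ^ k)) atTop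
      (𝓝 (momentFunctional (kmMoment p) (X ^ j * chainPoly p k))) := by
    intro j
    induction j with
    | zero =>
      intro k
      simp only [pow_zero, one_mul]
      cases k with
      | zero =>
        have h0 := momentFunctional_X_pow (kmMoment p) 0
        rw [pow_zero] at h0
        have h := hD0.add (h1.const_mul p)
        simp only [pow_zero, mul_one, chainPoly, h0, kmMoment]
        rw [zero_add, mul_one] at h
        refine h.congr fun i => ?_
        rw [← smul_eq_mul, ← map_smul, ← map_add, sub_add_cancel]
      | succ k =>
        rw [momentFunctional_km_chainPoly hp0 hp1]
        have h := (((hwords k).1.const_mul p).add (hDS k)).const_mul (1 - p)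
        rw [mul_zero, add_zero, mul_zero] at h
        refine h.congr fun i => ?_
        rw [trace_compressed_word (hφ i) (hP i)]
    | succ j ih =>
      intro k
      cases k with
      | zero =>
        have h := (ih 1).const_mul (1 - p)⁻¹
        have h2 : (1 - p)⁻¹ * momentFunctional (kmMoment p) (X ^ j * chainPoly p 1)
            = momentFunctional (kmMoment p) (X ^ (j + 1) * chainPoly p 0) := by
          rw [← smul_eq_mul, ← map_smul]
          congr 1
          rw [chainPoly, chainPoly, smul_eq_C_mul]
          have : (C (1 - p)⁻¹ * C (1 - p) : ℝ[X]) = 1 := by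
            rw [← C_mul, inv_mul_cancel₀ hq, C_1]
          linear_combination X ^ (j + 1) * this
        rw [h2] at h
        refine h.congr fun i => ?_
        rw [pow_one, trace_compressed_succ_zero (hφ i) (hP i), inv_mul_cancel_left₀ hq, pow_zero,
          mul_one]
      | succ k =>
        have h := ((((ha.const_mul p)).mul (ih (k + 1))).add
          ((hb.const_mul (p * (1 - p))).mul (ih k))).add (ih (k + 2))
        have h2 : p * 0 * momentFunctional (kmMoment p) (X ^ j * chainPoly p (k + 1))
            + p * (1 - p) * 1 * momentFunctional (kmMoment p) (X ^ j * chainPoly p k)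
            + momentFunctional (kmMoment p) (X ^ j * chainPoly p (k + 2))
            = momentFunctional (kmMoment p) (X ^ (j + 1) * chainPoly p (k + 1)) := by
          rw [mul_zero, zero_mul, zero_add, mul_one, ← smul_eq_mul, ← map_smul, ← map_add]
          congr 1
          rw [chainPoly, smul_eq_C_mul]
          ring
        rw [h2] at h
        refine h.congr' ?_
        filter_upwards [hS] with i hi
        rw [compressed_succ_succ (hP i) hi, map_add, map_add, map_smul, map_smul, smul_eq_mul,
          smul_eq_mul]
  have h := main j 0
  rw [chainPoly, mul_one, momentFunctional_X_pow] at h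
  simpa using h

end Tracial

/-! ### Traces of powers as sums over closed walks -/

section Walks

variable {R ι : Type*} [CommRing R] [Fintype ι] [DecidableEq ι]

lemma matrix_pow_apply_eq_sum (M : Matrix ι ι R) (k : ℕ) (a b : ι) :
    (M ^ k) a b = ∑ i : Fin (k + 1) → ι, if i 0 = a ∧ i (Fin.last k) = b then
      ∏ l : Fin k, M (i l.castSucc) (i l.succ) else 0 := by
  induction k generalizing a with
  | zero =>
    rw [← (Equiv.funUnique (Fin 1) ι).symm.sum_comp]
    simp only [pow_zero, Matrix.one_apply, Finset.univ_eq_empty, Finset.prod_empty]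
    by_cases h : a = b
    · subst h
      simp [Equiv.funUnique]
    · rw [if_neg h, Finset.sum_eq_zero]
      intro x _
      rw [if_neg]
      rintro ⟨h1, h2⟩
      exact h (h1.symm.trans h2)
  | succ k ih =>
    rw [pow_succ', Matrix.mul_apply, ← (Fin.consEquiv fun _ => ι).sum_comp, Fintype.sum_prod_type]
    refine Eq.trans ?_ (Finset.sum_eq_single a ?_ ?_).symm
    · simp only [ih, Finset.mul_sum]
      rw [Finset.sum_comm]
      refine Finset.sum_congr rfl fun i _ => ?_
      simp only [Fin.consEquiv_apply, Fin.cons_zero, true_and, Fin.prod_univ_succ,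
        Fin.castSucc_zero, Fin.cons_succ, ← Fin.succ_last, ← Fin.succ_castSucc]
      rw [Finset.sum_eq_single (i 0)]
      · simp
      · intro x _ hx
        rw [if_neg (fun h => hx h.1.symm), mul_zero]
      · simp
    · intro x _ hx
      refine Finset.sum_eq_zero fun i _ => if_neg fun h => hx ?_
      simpa using h.1
    · simp

lemma trace_pow_eq_sum (M : Matrix ι ι R) (k : ℕ) :
    (M ^ k).trace = ∑ i : Fin (k + 1) → ι, if i 0 = i (Fin.last k) then
      ∏ l : Fin k, M (i l.castSucc) (i l.succ) else 0 := by
  simp only [Matrix.trace, Matrix.diag_apply, matrix_pow_apply_eq_sum]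
  rw [Finset.sum_comm]
  refine Finset.sum_congr rfl fun i _ => ?_
  rw [Finset.sum_eq_single (i 0)]
  · simp [eq_comm]
  · intro x _ hx
    exact if_neg fun h => hx h.1.symm
  · simp

end Walks

/-! ### Expectations of products of centered Bernoulli variables -/

section Bernoulli

variable {n : ℕ} {p : ℝ}

/-- The probability of the subset `T` when each element is selected with probability `p`. -/
def bernoulliWeight (p : ℝ) (T : Finset (Fin n)) : ℝ := p ^ T.card * (1 - p) ^ (n - T.card)

/-- The centered indicator of `j ∈ T`. -/
def centeredIndicator (p : ℝ) (T : Finset (Fin n)) (j : Fin n) : ℝ := if j ∈ T then 1 - p else -p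

lemma bernoulliWeight_eq_prod (p : ℝ) (T : Finset (Fin n)) :
    bernoulliWeight p T = (∏ _j ∈ T, p) * ∏ _j ∈ Finset.univ \ T, (1 - p) := by
  rw [bernoulliWeight, Finset.prod_const, Finset.prod_const,
    Finset.card_sdiff_of_subset (Finset.subset_univ T), Finset.card_univ, Fintype.card_fin]

lemma bernoulliWeight_nonneg (hp0 : 0 < p) (hp1 : p < 1) (T : Finset (Fin n)) :
    0 ≤ bernoulliWeight p T := by
  have : 0 ≤ 1 - p := by linarith
  unfold bernoulliWeight; positivity

/-- Independence: expanding the product over j of two-term sums over all subsets T gives the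
expectation. -/
lemma sum_bernoulliWeight_mul_prod (p : ℝ) {κ : Type*} [Fintype κ] (f : κ → Fin n) :
    ∑ T : Finset (Fin n), bernoulliWeight p T * ∏ l, centeredIndicator p T (f l)
      = ∏ j, (p * (1 - p) ^ (Finset.univ.filter fun l => f l = j).card
          + (1 - p) * (-p) ^ (Finset.univ.filter fun l => f l = j).card) := by
  rw [Finset.prod_add, Finset.powerset_univ]
  refine Finset.sum_congr rfl fun T _ => ?_
  have h1 : ∏ l, centeredIndicator p T (f l)
      = ∏ j, centeredIndicator p T j ^ (Finset.univ.filter fun l => f l = j).card := by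
    rw [← Finset.prod_fiberwise' Finset.univ f]
    exact Finset.prod_congr rfl fun j _ => Finset.prod_const _
  rw [h1, bernoulliWeight_eq_prod, ← Finset.prod_sdiff (Finset.subset_univ T),
    Finset.prod_mul_distrib, Finset.prod_mul_distrib]
  have h2 : ∏ j ∈ T, centeredIndicator p T j ^ (Finset.univ.filter fun l => f l = j).card
      = ∏ j ∈ T, (1 - p) ^ (Finset.univ.filter fun l => f l = j).card :=
    Finset.prod_congr rfl fun j hj => by rw [centeredIndicator, if_pos hj]
  have h3 : ∏ j ∈ Finset.univ \ T,
        centeredIndicator p T j ^ (Finset.univ.filter fun l => f l = j).card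
      = ∏ j ∈ Finset.univ \ T, (-p) ^ (Finset.univ.filter fun l => f l = j).card :=
    Finset.prod_congr rfl fun j hj => by
      rw [centeredIndicator, if_neg (Finset.mem_sdiff.1 hj).2]
  rw [h2, h3]
  ring

lemma sum_bernoulliWeight (p : ℝ) : ∑ T : Finset (Fin n), bernoulliWeight p T = 1 := by
  have h := sum_bernoulliWeight_mul_prod (n := n) p (κ := Fin 0) Fin.elim0
  simpa using h

/-- An index that occurs once contributes the mean of a centered variable, p(1-p) + (1-p)(-p) = 0.
-/
lemma sum_bernoulliWeight_mul_prod_eq_zero (p : ℝ) {κ : Type*} [Fintype κ] {f : κ → Fin n}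
    {j : Fin n} (hj : (Finset.univ.filter fun l => f l = j).card = 1) :
    ∑ T : Finset (Fin n), bernoulliWeight p T * ∏ l, centeredIndicator p T (f l) = 0 := by
  rw [sum_bernoulliWeight_mul_prod]
  refine Finset.prod_eq_zero (Finset.mem_univ j) ?_
  rw [hj]; ring

lemma abs_sum_bernoulliWeight_mul_prod_le (hp0 : 0 < p) (hp1 : p < 1) {κ : Type*} [Fintype κ]
    (f : κ → Fin n) :
    |∑ T : Finset (Fin n), bernoulliWeight p T * ∏ l, centeredIndicator p T (f l)| ≤ 1 := by
  rw [← sum_bernoulliWeight (n := n) p]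
  refine (Finset.abs_sum_le_sum_abs _ _).trans (Finset.sum_le_sum fun T _ => ?_)
  rw [abs_mul, abs_of_nonneg (bernoulliWeight_nonneg hp0 hp1 T), Finset.abs_prod]
  refine mul_le_of_le_one_right (bernoulliWeight_nonneg hp0 hp1 T) ?_
  refine Finset.prod_le_one (fun _ _ => abs_nonneg _) fun l _ => ?_
  unfold centeredIndicator
  split_ifs
  · rw [abs_of_pos (by linarith)]; linarith
  · rw [abs_neg, abs_of_pos hp0]; exact hp1.le

lemma exists_comp_eq_of_card_image_le {k t : ℕ} (f : Fin (k + 1) → Fin n)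
    (h : (Finset.univ.image f).card ≤ t) :
    ∃ (g : Fin t → Fin n) (e : Fin (k + 1) → Fin t), g ∘ e = f := by
  have hcard : Fintype.card ↥(Finset.univ.image f) ≤ Fintype.card (Fin t) := by
    rwa [Fintype.card_coe, Fintype.card_fin]
  obtain ⟨emb⟩ := Function.Embedding.nonempty_of_card_le hcard
  refine ⟨Function.extend emb Subtype.val fun _ => f 0,
    fun l => emb ⟨f l, Finset.mem_image_of_mem f (Finset.mem_univ l)⟩, ?_⟩
  funext l
  simp only [Function.comp_apply]
  rw [emb.injective.extend_apply]

/-- If every attained value is attained at least twice, there are at most t = (k+1)/2 values, so the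
map factors through `Fin t`. -/
lemma card_filter_forall_fiber_ne_one_le (n k : ℕ) :
    (Finset.univ.filter fun f : Fin (k + 1) → Fin n =>
      ∀ j, (Finset.univ.filter fun l => f l = j).card ≠ 1).card
      ≤ n ^ ((k + 1) / 2) * ((k + 1) / 2) ^ (k + 1) := by
  set t := (k + 1) / 2
  have hsub : (Finset.univ.filter fun f : Fin (k + 1) → Fin n =>
      ∀ j, (Finset.univ.filter fun l => f l = j).card ≠ 1) ⊆
      (Finset.univ : Finset ((Fin t → Fin n) × (Fin (k + 1) → Fin t))).image
        fun x => x.1 ∘ x.2 := by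
    intro f hf
    have hf' := (Finset.mem_filter.1 hf).2
    have h1 : 2 * (Finset.univ.image f).card ≤ k + 1 := by
      have h2 := Finset.card_eq_sum_card_image f (Finset.univ : Finset (Fin (k + 1)))
      rw [Finset.card_univ, Fintype.card_fin] at h2
      refine le_of_le_of_eq ?_ h2.symm
      rw [mul_comm, ← smul_eq_mul, ← Finset.sum_const]
      refine Finset.sum_le_sum fun j hj => ?_
      obtain ⟨l, -, hl⟩ := Finset.mem_image.1 hj
      have h3 : 0 < (Finset.univ.filter fun l => f l = j).card :=
        Finset.card_pos.2 ⟨l, Finset.mem_filter.2 ⟨Finset.mem_univ l, hl⟩⟩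
      have h4 := hf' j
      omega
    obtain ⟨g, e, hge⟩ := exists_comp_eq_of_card_image_le f (t := t) (by omega)
    exact Finset.mem_image.2 ⟨(g, e), Finset.mem_univ _, hge⟩
  refine (Finset.card_le_card hsub).trans (Finset.card_image_le.trans ?_)
  simp [Fintype.card_prod]

end Bernoulli

/-! ### The mean normalized trace of random matrices -/

section MeanTrace

variable {𝕜 : Type*} [RCLike 𝕜] {n : ℕ} {p : ℝ}

/-- Matrices depending on a subset of the index set. -/
abbrev RandomMatrix (𝕜 : Type*) (n : ℕ) : Type _ := Finset (Fin n) → Matrix (Fin n) (Fin n) 𝕜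

/-- The expected normalized trace. -/
def meanTrace (𝕜 : Type*) [RCLike 𝕜] (n : ℕ) (p : ℝ) : RandomMatrix 𝕜 n →ₗ[ℝ] ℝ where
  toFun M := (1 / (n : ℝ)) * ∑ T, bernoulliWeight p T * RCLike.re (M T).trace
  map_add' M N := by
    simp only [Pi.add_apply, Matrix.trace_add, map_add, mul_add, Finset.sum_add_distrib]
  map_smul' c M := by
    simp only [Pi.smul_apply, Matrix.trace_smul, RCLike.smul_re, RingHom.id_apply, smul_eq_mul,
      Finset.mul_sum]
    exact Finset.sum_congr rfl fun T _ => by ring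

lemma meanTrace_apply (M : RandomMatrix 𝕜 n) :
    meanTrace 𝕜 n p M = (1 / (n : ℝ)) * ∑ T, bernoulliWeight p T * RCLike.re (M T).trace := rfl

lemma meanTrace_mul_comm (M N : RandomMatrix 𝕜 n) :
    meanTrace 𝕜 n p (M * N) = meanTrace 𝕜 n p (N * M) := by
  simp only [meanTrace_apply, Pi.mul_apply, Matrix.trace_mul_comm (M _)]

lemma meanTrace_one (hn : 0 < n) : meanTrace 𝕜 n p 1 = 1 := by
  simp only [meanTrace_apply, Pi.one_apply, Matrix.trace_one, Fintype.card_fin,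
    RCLike.natCast_re, ← Finset.sum_mul, sum_bernoulliWeight]
  field_simp

lemma selection_sub_smul_one (T : Finset (Fin n)) :
    selection 𝕜 T - p • 1 = Matrix.diagonal fun j => (centeredIndicator p T j : 𝕜) := by
  ext i j
  by_cases h : i = j
  · subst h
    simp only [selection, centeredIndicator, Matrix.sub_apply, Matrix.diagonal_apply_eq,
      Matrix.smul_apply, Matrix.one_apply_eq]
    rw [RCLike.real_smul_eq_coe_mul]
    split_ifs <;> simp
  · simp [selection, h]

lemma meanTrace_centered :
    meanTrace 𝕜 n p ((fun T => selection 𝕜 T : RandomMatrix 𝕜 n) - p • 1) = 0 := by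
  simp only [meanTrace_apply, Pi.sub_apply, Pi.smul_apply, Pi.one_apply, selection_sub_smul_one,
    Matrix.trace_diagonal, map_sum, RCLike.ofReal_re, Finset.mul_sum]
  rw [Finset.sum_comm]
  refine Finset.sum_eq_zero fun j _ => ?_
  have h := sum_bernoulliWeight_mul_prod_eq_zero p (κ := Fin 1) (f := fun _ => j) (j := j) (by simp)
  simp only [Finset.univ_unique, Finset.prod_singleton] at h
  rw [← Finset.mul_sum, h, mul_zero]

lemma trace_pow_centered_mul (S : Matrix (Fin n) (Fin n) 𝕜) (T : Finset (Fin n)) (k : ℕ) :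
    RCLike.re (((selection 𝕜 T - p • 1) * S) ^ k).trace
      = ∑ i : Fin (k + 1) → Fin n, if i 0 = i (Fin.last k) then
        (∏ l : Fin k, centeredIndicator p T (i l.castSucc)) *
          RCLike.re (∏ l : Fin k, S (i l.castSucc) (i l.succ)) else 0 := by
  rw [trace_pow_eq_sum, map_sum]
  refine Finset.sum_congr rfl fun i _ => ?_
  split_ifs
  · simp only [selection_sub_smul_one, Matrix.diagonal_mul, Finset.prod_mul_distrib]
    rw [← RCLike.ofReal_prod, RCLike.re_ofReal_mul]
  · simp

/-- Expand the trace over closed walks. Only walks in which no vertex occurs exactly once have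
nonzero expectation, and each of them contributes at most ν^(k+1). -/
theorem abs_meanTrace_pow_centered_mul_le (hp0 : 0 < p) (hp1 : p < 1)
    {S : Matrix (Fin n) (Fin n) 𝕜} {ν : ℝ} (hS : ∀ i j, ‖S i j‖ ≤ ν) (k : ℕ) :
    |meanTrace 𝕜 n p ((((fun T => selection 𝕜 T : RandomMatrix 𝕜 n) - p • 1) *
        fun _ => S) ^ (k + 1))|
      ≤ (1 / (n : ℝ)) * (((n ^ ((k + 1) / 2) * ((k + 1) / 2) ^ (k + 1) : ℕ) : ℝ) * ν ^ (k + 1)) := by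
  rw [meanTrace_apply, abs_mul, abs_of_nonneg (by positivity)]
  refine mul_le_mul_of_nonneg_left ?_ (by positivity)
  simp only [Pi.pow_apply, Pi.mul_apply, Pi.sub_apply, Pi.smul_apply, Pi.one_apply,
    trace_pow_centered_mul, Finset.mul_sum]
  rw [Finset.sum_comm]
  set good := Finset.univ.filter fun f : Fin (k + 1) → Fin n =>
      ∀ j, (Finset.univ.filter fun l => f l = j).card ≠ 1
  set I := Finset.univ.filter fun i : Fin (k + 1 + 1) → Fin n =>
      i 0 = i (Fin.last (k + 1)) ∧ (fun l : Fin (k + 1) => i l.castSucc) ∈ good with hI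
  -- A closed walk is determined by all its vertices but the last.
  have hcardI : I.card ≤ n ^ ((k + 1) / 2) * ((k + 1) / 2) ^ (k + 1) := by
    refine le_trans ?_ (card_filter_forall_fiber_ne_one_le n k)
    refine Finset.card_le_card_of_injOn (fun i l => i l.castSucc)
      (fun i hi => (Finset.mem_filter.1 hi).2.2) fun i hi i' hi' h => ?_
    have h1 := (Finset.mem_filter.1 hi).2.1
    have h2 := (Finset.mem_filter.1 hi').2.1
    funext l
    refine Fin.lastCases ?_ (fun l => congrFun h l) l
    rw [← h1, ← h2]
    exact congrFun h 0
  have hterm : ∀ i : Fin (k + 1 + 1) → Fin n,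
      |∑ T : Finset (Fin n), bernoulliWeight p T * (if i 0 = i (Fin.last (k + 1)) then
        (∏ l : Fin (k + 1), centeredIndicator p T (i l.castSucc)) *
          RCLike.re (∏ l : Fin (k + 1), S (i l.castSucc) (i l.succ)) else 0)|
      ≤ if i ∈ I then ν ^ (k + 1) else 0 := by
    intro i
    by_cases h0 : i 0 = i (Fin.last (k + 1))
    · simp only [if_pos h0, ← mul_assoc, ← Finset.sum_mul]
      by_cases hg : (fun l : Fin (k + 1) => i l.castSucc) ∈ good
      · rw [if_pos (Finset.mem_filter.2 ⟨Finset.mem_univ _, h0, hg⟩), abs_mul]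
        have h1 := abs_sum_bernoulliWeight_mul_prod_le hp0 hp1 fun l : Fin (k + 1) => i l.castSucc
        have h2 : |RCLike.re (∏ l : Fin (k + 1), S (i l.castSucc) (i l.succ))| ≤ ν ^ (k + 1) := by
          refine (RCLike.abs_re_le_norm _).trans ?_
          rw [norm_prod]
          refine (Finset.prod_le_prod (fun _ _ => norm_nonneg _) fun l _ => hS _ _).trans ?_
          simp
        calc _ ≤ 1 * ν ^ (k + 1) := mul_le_mul h1 h2 (abs_nonneg _) zero_le_one
          _ = _ := one_mul _
      · have hg' := hg
        simp only [good, Finset.mem_filter, Finset.mem_univ, true_and, not_forall, not_not] at hg'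
        obtain ⟨j, hj⟩ := hg'
        rw [sum_bernoulliWeight_mul_prod_eq_zero p hj, if_neg]
        · simp
        · intro h; exact hg (Finset.mem_filter.1 h).2.2
    · simp only [if_neg h0, mul_zero, Finset.sum_const_zero, abs_zero]
      rw [if_neg]
      intro h; exact h0 (Finset.mem_filter.1 h).2.1
  refine (Finset.abs_sum_le_sum_abs _ _).trans ((Finset.sum_le_sum fun i _ => hterm i).trans ?_)
  rw [← Finset.sum_filter, Finset.sum_const, nsmul_eq_mul, Finset.filter_mem_eq_inter,
    Finset.univ_inter]
  -- Nonnegativity of ν comes from an entry of S, which exists only if n > 0.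
  rcases I.eq_empty_or_nonempty with h | ⟨i, -⟩
  · rw [h]
    rcases Nat.eq_zero_or_pos n with rfl | hn
    · simp only [Finset.card_empty, Nat.cast_zero, zero_mul]
      by_cases h2 : (k + 1) / 2 = 0
      · rw [h2]; simp
      · rw [zero_pow h2]; simp
    · have hν : 0 ≤ ν := (norm_nonneg _).trans (hS ⟨0, hn⟩ ⟨0, hn⟩)
      simp only [Finset.card_empty, Nat.cast_zero, zero_mul]
      positivity
  · have hν : 0 ≤ ν := (norm_nonneg _).trans (hS (i 0) (i 0))
    exact mul_le_mul_of_nonneg_right (by exact_mod_cast hcardI) (by positivity)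

end MeanTrace

/-! ### Equiangular tight frames -/

section ETF

variable {𝕜 : Type*} [RCLike 𝕜] {m n : ℕ} {F : Matrix (Fin m) (Fin n) 𝕜} {ν ρ : ℝ}

lemma gram_diag_eq_one (h : ∀ i j, ‖(Fᴴ * F) i j‖ = if i = j then 1 else ν) (i : Fin n) :
    (Fᴴ * F) i i = 1 := by
  have h1 : (Fᴴ * F) i i = ((∑ j, ‖F j i‖ ^ 2 : ℝ) : 𝕜) := by
    rw [Matrix.mul_apply]
    push_cast
    refine Finset.sum_congr rfl fun j _ => ?_
    rw [Matrix.conjTranspose_apply, RCLike.star_def, RCLike.conj_mul]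
  have h2 := h i i
  rw [if_pos rfl, h1, RCLike.norm_ofReal, abs_of_nonneg (by positivity)] at h2
  rw [h1, h2, RCLike.ofReal_one]

lemma gram_mul_self (hF : F * Fᴴ = (ρ : 𝕜) • (1 : Matrix (Fin m) (Fin m) 𝕜)) :
    (Fᴴ * F) * (Fᴴ * F) = ρ • (Fᴴ * F) := by
  rw [Matrix.mul_assoc, ← Matrix.mul_assoc F, hF, RCLike.real_smul_eq_coe_smul (K := 𝕜)]
  simp

lemma frameBound_mul_eq (h : ∀ i j, ‖(Fᴴ * F) i j‖ = if i = j then 1 else ν)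
    (hF : F * Fᴴ = (ρ : 𝕜) • (1 : Matrix (Fin m) (Fin m) 𝕜)) : ρ * m = n := by
  have h1 := Matrix.trace_mul_comm F Fᴴ
  rw [hF, Matrix.trace_smul, Matrix.trace_one, Matrix.trace] at h1
  simp only [Matrix.diag_apply, gram_diag_eq_one h, Finset.sum_const, Finset.card_univ,
    Fintype.card_fin, nsmul_eq_mul, mul_one, smul_eq_mul] at h1
  exact_mod_cast h1

/-- Compare a diagonal entry on the two sides of G² = ρG for the Gram matrix G, which is Hermitian.
-/
lemma welch_eq (hn : 0 < n) (h : ∀ i j, ‖(Fᴴ * F) i j‖ = if i = j then 1 else ν)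
    (hF : F * Fᴴ = (ρ : 𝕜) • (1 : Matrix (Fin m) (Fin m) 𝕜)) :
    ((n : ℝ) - 1) * ν ^ 2 = ρ - 1 := by
  set i : Fin n := ⟨0, hn⟩
  have h1 := congrFun (congrFun (gram_mul_self hF) i) i
  rw [Matrix.smul_apply, gram_diag_eq_one h, Matrix.mul_apply] at h1
  have hherm : (Fᴴ * F)ᴴ = Fᴴ * F := by simp
  have h2 : ∀ j, (Fᴴ * F) i j * (Fᴴ * F) j i = ((‖(Fᴴ * F) i j‖ ^ 2 : ℝ) : 𝕜) := by
    intro j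
    have : (Fᴴ * F) j i = star ((Fᴴ * F) i j) := by
      conv_lhs => rw [← hherm]
      rw [Matrix.conjTranspose_apply]
    rw [this, RCLike.star_def, RCLike.mul_conj]
    push_cast; rfl
  have h3 : ∑ j, ‖(Fᴴ * F) i j‖ ^ 2 = ρ := by
    simp only [h2] at h1
    rw [RCLike.real_smul_eq_coe_mul, mul_one] at h1
    exact_mod_cast h1
  rw [← h3, ← Finset.add_sum_erase _ _ (Finset.mem_univ i), h, if_pos rfl,
    Finset.sum_congr rfl fun j hj => by rw [h, if_neg (Finset.ne_of_mem_erase hj).symm],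
    Finset.sum_const, Finset.card_erase_of_mem (Finset.mem_univ i), Finset.card_univ,
    Fintype.card_fin, nsmul_eq_mul, Nat.cast_sub hn]
  push_cast
  ring

lemma centeredGram_mul_self (hF : F * Fᴴ = (ρ : 𝕜) • (1 : Matrix (Fin m) (Fin m) 𝕜)) :
    (Fᴴ * F - 1) * (Fᴴ * F - 1) = (ρ - 2) • (Fᴴ * F - 1) + (ρ - 1) • (1 : Matrix _ _ 𝕜) := by
  rw [sub_mul, mul_sub, gram_mul_self hF, mul_one, one_mul]
  module

lemma norm_centeredGram_le (hν : 0 ≤ ν) (h : ∀ i j, ‖(Fᴴ * F) i j‖ = if i = j then 1 else ν)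
    (i j : Fin n) : ‖(Fᴴ * F - 1 : Matrix (Fin n) (Fin n) 𝕜) i j‖ ≤ ν := by
  by_cases hij : i = j
  · subst hij
    rw [Matrix.sub_apply, gram_diag_eq_one h, Matrix.one_apply_eq, sub_self, norm_zero]
    exact hν
  · rw [Matrix.sub_apply, Matrix.one_apply_ne hij, sub_zero, h, if_neg hij]

lemma trace_centeredGram (h : ∀ i j, ‖(Fᴴ * F) i j‖ = if i = j then 1 else ν) :
    (Fᴴ * F - 1).trace = 0 := by
  rw [Matrix.trace]
  refine Finset.sum_eq_zero fun i _ => ?_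
  rw [Matrix.diag_apply, Matrix.sub_apply, gram_diag_eq_one h, Matrix.one_apply_eq, sub_self]

lemma trace_pow_mul_comm {R ι κ : Type*} [CommRing R] [Fintype ι] [Fintype κ] [DecidableEq ι]
    [DecidableEq κ] (M : Matrix ι κ R) (N : Matrix κ ι R) (r : ℕ) :
    ((M * N) ^ (r + 1)).trace = ((N * M) ^ (r + 1)).trace := by
  have h : ∀ r : ℕ, (M * N) ^ (r + 1) = M * (N * M) ^ r * N := by
    intro r
    induction r with
    | zero => simp
    | succ r ih =>
      rw [pow_succ, ih, pow_succ (N * M)]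
      simp only [Matrix.mul_assoc]
  rw [h, Matrix.mul_assoc, Matrix.trace_mul_comm, Matrix.mul_assoc, ← pow_succ]

lemma selection_mul_self (T : Finset (Fin n)) : selection 𝕜 T * selection 𝕜 T = selection 𝕜 T := by
  rw [selection, Matrix.diagonal_mul_diagonal]
  congr 1
  ext i
  split_ifs <;> simp

/-- Cyclicity of the trace moves F to the right of F†, and F†F = 1 + S. -/
lemma meanMoment_eq_meanTrace (F : Matrix (Fin m) (Fin n) 𝕜) (p : ℝ) {r : ℕ} (hr : 1 ≤ r) :
    meanMoment F p r = meanTrace 𝕜 n p (((fun T => selection 𝕜 T : RandomMatrix 𝕜 n) *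
      (1 + fun _ => Fᴴ * F - 1)) ^ r) := by
  obtain ⟨r, rfl⟩ := Nat.exists_eq_add_of_le' hr
  rw [meanMoment, meanTrace_apply]
  congr 1
  refine Finset.sum_congr rfl fun T _ => ?_
  rw [bernoulliWeight]
  congr 2
  rw [Matrix.mul_assoc, trace_pow_mul_comm, Matrix.mul_assoc]
  simp only [Pi.pow_apply, Pi.mul_apply, Pi.add_apply, Pi.one_apply]
  rw [add_sub_cancel]

end ETF

lemma tendsto_frameBound {m n : ℕ → ℕ} {ρ : ℕ → ℝ} (hρ : ∀ i, ρ i * m i = n i)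
    (hn : Tendsto n atTop atTop)
    (hmn : Tendsto (fun i => (m i : ℝ) / (n i : ℝ)) atTop (𝓝 (1 / 2))) :
    Tendsto ρ atTop (𝓝 2) := by
  have h := hmn.inv₀ (by norm_num)
  rw [show ((1 : ℝ) / 2)⁻¹ = 2 by norm_num] at h
  refine h.congr' ?_
  filter_upwards [hn.eventually_ge_atTop 1] with i hi
  have h1 : (m i : ℝ) ≠ 0 := by
    intro h0
    have h2 := hρ i
    rw [h0, mul_zero] at h2
    have : (1 : ℝ) ≤ n i := by exact_mod_cast hi
    linarith
  rw [inv_div, ← hρ i]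
  field_simp

/-- By the Welch identity nν² stays bounded, so n^(K/2) ν^K does too, and the prefactor 1/n gives
the decay. -/
lemma tendsto_coherence_bound {n : ℕ → ℕ} {ν ρ : ℕ → ℝ} (hν : ∀ i, 0 ≤ ν i)
    (hn : Tendsto n atTop atTop) (hρ : Tendsto ρ atTop (𝓝 2))
    (hw : ∀ i, 0 < n i → ((n i : ℝ) - 1) * ν i ^ 2 = ρ i - 1) (K : ℕ) :
    Tendsto (fun i => (1 / (n i : ℝ)) * (((n i ^ (K / 2) * (K / 2) ^ K : ℕ) : ℝ) * ν i ^ K)) atTop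
      (𝓝 0) := by
  set t := K / 2 with ht
  have hupper : Tendsto (fun i => ((t : ℝ) ^ K * 4 ^ t) * (n i : ℝ)⁻¹) atTop (𝓝 0) := by
    have h1 : Tendsto (fun i => (n i : ℝ)⁻¹) atTop (𝓝 0) :=
      tendsto_inv_atTop_zero.comp (tendsto_natCast_atTop_atTop.comp hn)
    simpa using h1.const_mul ((t : ℝ) ^ K * 4 ^ t)
  refine tendsto_of_tendsto_of_tendsto_of_le_of_le' tendsto_const_nhds hupper
    (Eventually.of_forall fun i => by have := hν i; positivity) ?_
  filter_upwards [hn.eventually_ge_atTop 4, hρ.eventually_le_const (show (2 : ℝ) < 3 by norm_num)]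
    with i hi hρi
  have hn4 : (4 : ℝ) ≤ n i := by exact_mod_cast hi
  have h1 := hw i (by omega)
  have h2 : n i * ν i ^ 2 ≤ 4 := by nlinarith [sq_nonneg (ν i)]
  have h3 : ν i ≤ 1 := by
    have := hν i
    nlinarith [sq_nonneg (ν i)]
  have h4 : (n i : ℝ) ^ t * ν i ^ K ≤ 4 ^ t := by
    -- For odd K one factor ν is left over; it is at most 1.
    have hK : K = 2 * t + (K - 2 * t) := by omega
    have h5 : (n i : ℝ) ^ t * ν i ^ K = (n i * ν i ^ 2) ^ t * ν i ^ (K - 2 * t) := by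
      conv_lhs => rw [hK]
      rw [pow_add, pow_mul, mul_pow, mul_assoc]
    rw [h5]
    have h6 : (n i * ν i ^ 2) ^ t ≤ 4 ^ t :=
      pow_le_pow_left₀ (mul_nonneg (by positivity) (sq_nonneg _)) h2 t
    have h7 : ν i ^ (K - 2 * t) ≤ 1 := pow_le_one₀ (hν i) h3
    calc _ ≤ (4 : ℝ) ^ t * 1 := mul_le_mul h6 h7 (pow_nonneg (hν i) _) (by positivity)
      _ = 4 ^ t := mul_one _
  push_cast
  calc (1 / (n i : ℝ)) * ((n i : ℝ) ^ t * (t : ℝ) ^ K * ν i ^ K)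
      = (t : ℝ) ^ K * ((n i : ℝ) ^ t * ν i ^ K) * (n i : ℝ)⁻¹ := by ring
    _ ≤ (t : ℝ) ^ K * 4 ^ t * (n i : ℝ)⁻¹ := by gcongr

theorem tendsto_meanMoment {p : ℝ} (hp0 : 0 < p) (hp1 : p < 1) {r : ℕ} (hr : 1 ≤ r) {𝕜 : Type*}
    [RCLike 𝕜] {m n : ℕ → ℕ} {F : ∀ i, Matrix (Fin (m i)) (Fin (n i)) 𝕜} (hF : ∀ i, IsETF (F i))
    (hn : Tendsto n atTop atTop)
    (hmn : Tendsto (fun i => (m i : ℝ) / (n i : ℝ)) atTop (𝓝 (1 / 2))) :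
    Tendsto (fun i => meanMoment (F i) p r) atTop (𝓝 (kmShiftedMoment p r)) := by
  choose ν ρ hν hρ0 hnorm htight using hF
  have hρ : Tendsto ρ atTop (𝓝 2) :=
    tendsto_frameBound (fun i => frameBound_mul_eq (hnorm i) (htight i)) hn hmn
  have hlim := tendsto_compressed_moments hp0 hp1 (A := fun i => RandomMatrix 𝕜 (n i))
    (φ := fun i => meanTrace 𝕜 (n i) p) (P := fun i T => selection 𝕜 T)
    (S := fun i _ => (F i)ᴴ * F i - 1) (a := fun i => ρ i - 2) (b := fun i => ρ i - 1)
    (fun i x y => meanTrace_mul_comm x y) (fun i => funext fun T => selection_mul_self T)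
    (Eventually.of_forall fun i => funext fun T => centeredGram_mul_self (htight i))
    (by simpa using hρ.sub_const 2) (by
      have h := hρ.sub_const 1
      rwa [show (2 : ℝ) - 1 = 1 by norm_num] at h)
    (tendsto_const_nhds.congr' (by
      filter_upwards [hn.eventually_ge_atTop 1] with i hi
      exact (meanTrace_one hi).symm))
    (tendsto_const_nhds.congr fun i => by
      simp [meanTrace_apply, trace_centeredGram (hnorm i)])
    (tendsto_const_nhds.congr fun i => meanTrace_centered.symm)
    (fun k => by
      refine squeeze_zero_norm (fun i => ?_) (tendsto_coherence_bound hν hn hρ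
        (fun i hi => welch_eq hi (hnorm i) (htight i)) (k + 1))
      exact abs_meanTrace_pow_centered_mul_le hp0 hp1 (norm_centeredGram_le (hν i) (hnorm i)) k)
  have hsum : Tendsto (fun i => ∑ j ∈ Finset.range (r + 1), (r.choose j : ℝ) *
      meanTrace 𝕜 (n i) p (((fun T => selection 𝕜 T : RandomMatrix 𝕜 (n i)) *
        fun _ => (F i)ᴴ * F i - 1) ^ j * fun T => selection 𝕜 T)) atTop
      (𝓝 (kmShiftedMoment p r)) :=
    tendsto_finsetSum _ fun j _ => (hlim j).const_mul _
  refine hsum.congr fun i => ?_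
  rw [meanMoment_eq_meanTrace (F i) p hr, trace_pow_compressed (fun x y => meanTrace_mul_comm x y)
    (funext fun T => selection_mul_self T) hr]

/-! ### The decentralized quantity -/

/-- At γ = 1/2 both γ⁻¹ - 1 and γ⁻¹/2 equal 1, and the separate summand p is the term j = 0 of the
binomial transform, since m_0 = p. -/
theorem mStar_half_eq (p : ℝ) (r : ℕ) : mStar (1 / 2) p r = kmShiftedMoment p r := by
  have h1 : ((1 : ℝ) / 2)⁻¹ - 1 = 1 := by norm_num
  have h2 : ((1 : ℝ) / 2)⁻¹ / 2 = 1 := by norm_num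
  rw [mStar, kmShiftedMoment, h1, h2, Finset.sum_range_succ', add_comm]
  simp only [one_pow, Real.one_rpow, one_mul, kmMoment, Nat.choose_zero_right, Nat.cast_one]
  congr 1
  rw [← Finset.Ico_add_one_right_eq_Icc, Finset.sum_Ico_eq_sum_range, Nat.add_sub_cancel]
  refine Finset.sum_congr rfl fun j _ => ?_
  rw [mCentral_half_eq_kmMoment p (by omega), add_comm 1 j]

end PaleyKM

end

theorem mainTheorem4 (p : ℝ) (hp0 : 0 < p) (hp1 : p < 1) (r : ℕ) (hr : 1 ≤ r) :
    -- the centralized quantity is the Kesten–McKay moment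
    (Integrable (fun x : ℝ => (p * x) ^ r) (PaleyKM.kestenMcKay p⁻¹) ∧
      PaleyKM.mCentral (1 / 2) p r = PaleyKM.mKestenMcKay p r) ∧
    -- the decentralized quantity is the MANOVA moment, in closed form and as an integral
    -- (γ = 1/2, β = p/γ = 2p)
    (PaleyKM.mStar (1 / 2) p r = PaleyKM.mManova (1 / 2) p r ∧
      Integrable (fun x : ℝ => x ^ r) (PaleyKM.manovaMeasure (2 * p) (1 / 2)) ∧
      PaleyKM.mManova (1 / 2) p r =
        p * ∫ x, x ^ r ∂(PaleyKM.manovaMeasure (2 * p) (1 / 2))) ∧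
    -- mean moments of random subsets of redundancy-2 ETFs converge to the MANOVA moment
    (∀ (𝕜 : Type) [RCLike 𝕜] (m n : ℕ → ℕ) (F : ∀ i, Matrix (Fin (m i)) (Fin (n i)) 𝕜),
      (∀ i, PaleyKM.IsETF (F i)) →
      Tendsto n atTop atTop →
      Tendsto (fun i => (m i : ℝ) / (n i : ℝ)) atTop (𝓝 (1 / 2)) →
      Tendsto (fun i => PaleyKM.meanMoment (F i) p r) atTop
        (𝓝 (PaleyKM.mManova (1 / 2) p r))) := by
  refine ⟨⟨(PaleyKM.integrable_and_mKestenMcKay_eq hp0 hp1 r).1, ?_⟩,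
    ⟨?_, (PaleyKM.integrable_and_integral_manova hp0 hp1 r).1, ?_⟩, ?_⟩
  · rw [PaleyKM.mCentral_half_eq_kmMoment p hr,
      (PaleyKM.integrable_and_mKestenMcKay_eq hp0 hp1 r).2]
  · rw [PaleyKM.mStar_half_eq, PaleyKM.mManova_half_eq hp1 hr]
  · rw [PaleyKM.mManova_half_eq hp1 hr, (PaleyKM.integrable_and_integral_manova hp0 hp1 r).2]
  · intro 𝕜 _ m n F hF hn hmn
    rw [PaleyKM.mManova_half_eq hp1 hr]
    exact PaleyKM.tendsto_meanMoment hp0 hp1 hr hF hn hmn
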